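/- Let $\alpha,T>0$, let $\mathbb T=\mathbb R/\mathbb Z$ with Lebesgue measure $\mathcal L_{\mathbb T}$, let $\Omega_1=\mathbb T\times\{-1,1\}$, $\iota(x,v)=(x,-v)$, and let $\pi=\mathcal L_{\mathbb T}\otimes\mathrm{Unif}\{-1,1\}$. For a set $\mathcal X$ of this kind, $\mathcal M(\mathcal X)$ denotes the finite signed Borel measures and $\mathcal P(\mathcal X)$ the probability measures on $\mathcal X$, both with the narrow topology (duality with bounded continuous functions). For $\mu\in\mathcal M(\mathcal X)$ and a finite nonnegative measure $\nu$ put $\mathrm{Ent}(\mu|\nu)=\int(f\log f-f+1)\,d\nu$ if $\mu\ge 0$ and $\mu=f\nu$, and $\mathrm{Ent}(\mu|\nu)=+\infty$ otherwise. A pair $(\sigma,j)$, $j=(j^1,j^2)$, belongs to $\mathrm{CE}(0,T;\Omega_1)$ if $\sigma\in C([0,T];\mathcal P(\Omega_1))$, $(j_t)_{t\in(0,T)}\subset\mathcal M(\Omega_1;\mathbb R^2)$ is a measurable family with $\int_0^T\|j_t\|_{\mathrm{TV}}\,dt<\infty$, and, for all $\varphi$ on $\Omega_1$ that are $C^1$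 in $x$ and all $0\le s\le t\le T$, $$\int\varphi\,d\sigma_t-\int\varphi\,d\sigma_s=\int_s^t\Big(\int\partial_x\varphi\,dj^1_r+\int(\varphi\circ\iota-\varphi)\,dj^2_r\Big)dr .$$ For $V>0$ (with switching rate $\lambda=V^2/(2\alpha)$) let $$\mathscr I^V(\sigma,j)=\int_0^T\mathscr L^V(\sigma_t,j_t)\,dt\ \text{ if }(\sigma,j)\in\mathrm{CE}(0,T;\Omega_1),\qquad \mathscr I^V(\sigma,j)=+\infty\ \text{ otherwise},$$ where $\mathscr L^V(\sigma,j)=\mathrm{Ent}\big(j^2\,\big|\,\tfrac{V^2}{2\alpha}\sigma\big)$ if $j^1=V\,v\,\sigma$, and $\mathscr L^V(\sigma,j)=+\infty$ otherwise. For $\rho:[0,T]\to\mathcal P(\mathbb T)$ and $\omega\in\mathcal M((0,T)\times\mathbb T)$, say that $(\rho,\omega)\in\mathrm{CE}(0,T;\mathbb T)$ if $\rho$ is continuous and $\int\psi\,d\rho_t-\int\psi\,d\rho_s=\int_{(s,t)\times\mathbb T}\partial_x\psi\,d\omega$ for all $\psi\in C^1(\mathbb T)$ and $0\le s\le t\le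 T$. Write also $\rho$ for $\rho_t(dx)\,dt$ and $D\rho$ for its distributional derivative in $x$ on $(0,T)\times\mathbb T$. Define $$\bar{\mathscr J}(\rho,\omega)=\frac1{4\alpha}\int_0^T\!\int_{\mathbb T}\Big|\alpha\frac{dD\rho}{d\rho}+\frac{d\omega}{d\rho}\Big|^2\rho_t(dx)\,dt$$ if $\omega\ll\rho$, $D\rho$ is a finite signed measure with $D\rho\ll\rho$, and $(\rho,\omega)\in\mathrm{CE}(0,T;\mathbb T)$; and $\bar{\mathscr J}(\rho,\omega)=+\infty$ otherwise. **(i) Liminf inequality.** Let $V_n\ge1$ with $V_n\to\infty$, let $(\sigma^n,j^n)\in\mathrm{CE}(0,T;\Omega_1)$ with $\sup_n\{\mathrm{Ent}(\sigma^n_0|\pi)+\mathscr I^{V_n}(\sigma^n,j^n)\}<\infty$, and put $$\rho^n_t(dx)=\sum_{v=\pm1}\sigma^n_t(dx,v),\quad \omega^n_t(dx)=V_n\sum_{v=\pm1}v\,\sigma^n_t(dx,v),\quad J^n_t(dx)=\sum_{v=\pm1}\frac v{V_n}\,j^{2,n}_t(dx,v).$$ Suppose that $\rho^n_t\to\bar\rho_t$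 narrowly in $\mathcal P(\mathbb T)$ for every $t\in[0,T]$, and that $\omega^n_t(dx)\,dt\to\bar\omega$ and $J^n_t(dx)\,dt\to\bar J$ narrowly in $\mathcal M((0,T)\times\mathbb T)$. Then $$\liminf_{n\to\infty}\mathscr I^{V_n}(\sigma^n,j^n)\ \ge\ \bar{\mathscr J}(\bar\rho,\bar\omega).$$ **(ii) Zeros of the limit functional.** If $\bar{\mathscr J}(\rho,\omega)=0$, then $\rho$ is a weak solution of the heat equation $\partial_t\rho=\alpha\,\partial_x^2\rho$: $\rho\in C([0,T];\mathcal P(\mathbb T))$ and, for all $\psi\in C^2(\mathbb T)$ and $0\le s\le t\le T$, $$\int\psi\,d\rho_t-\int\psi\,d\rho_s=\alpha\int_s^t\int\partial_x^2\psi\,d\rho_r\,dr .$$ -/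

import Mathlib

open MeasureTheory Filter Topology Set
open scoped ENNReal NNReal BoundedContinuousFunction VectorMeasure

noncomputable section

namespace KacDiffusive

/-- The one-dimensional torus `ℝ / ℤ`; `volume` is Lebesgue measure, of total mass one. -/
abbrev Torus : Type := UnitAddCircle

/-- The rescaled state space `𝕋 × {-1, 1}`. The two velocities are labelled by `Bool`;
`vel` gives the value of a label. -/
abbrev Omega : Type := Torus × Bool

/-- The velocity with a given label: `true` is `1` and `false` is `-1`. -/
def vel (b : Bool) : ℝ := if b then 1 else -1

/-- Velocity reversal `ι (x, v) = (x, -v)`. -/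
def reversal (p : Omega) : Omega := (p.1, !p.2)

/-- The stationary measure: Lebesgue measure on the torus times the uniform measure on
`{-1, 1}`. -/
def stationary : Measure Omega :=
  (volume : Measure Torus).prod (ProbabilityTheory.uniformOn (Set.univ : Set Bool))

/-- `ψ ∈ C¹(𝕋)` with derivative `ψ'` (functions on the torus are differentiated through their
periodic lifts to `ℝ`). -/
def IsC1 (ψ ψ' : Torus → ℝ) : Prop :=
  Continuous ψ' ∧ ∀ x : ℝ, HasDerivAt (fun y : ℝ => ψ (y : Torus)) (ψ' (x : Torus)) x

/-- `φ ∈ C^{1,0}(𝕋 × {-1, 1})` with `∂ₓ φ = φ'`. -/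
def IsC10 (φ φ' : Omega → ℝ) : Prop :=
  ∀ b : Bool, IsC1 (fun x => φ (x, b)) (fun x => φ' (x, b))

/-- Relative entropy of a signed measure with respect to a finite nonnegative measure:
`∫ (f log f - f + 1) dν` if `μ` is nonnegative and `μ = f ν`, and `+∞` otherwise.
(For finite measures this integral is Mathlib's `klDiv`; see `klDiv_eq_lintegral_klFun`.) -/
def relEnt {X : Type*} [MeasurableSpace X] (μ : SignedMeasure X) (ν : Measure X) : ℝ≥0∞ :=
  open scoped Classical in
  if μ.toJordanDecomposition.negPart = 0 then
    InformationTheory.klDiv μ.toJordanDecomposition.posPart ν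
  else ⊤

/-- `(m_t)_{t ∈ (0, T)}` is a measurable family of finite signed measures. -/
def IsMeasurableFamily {X : Type*} [MeasurableSpace X] (T : ℝ) (m : ℝ → SignedMeasure X) : Prop :=
  ∀ E : Set X, MeasurableSet E → Measurable fun t : Set.Ioo (0 : ℝ) T => m t E

/-- The continuity equation `CE(0, T; 𝕋 × {-1, 1})` for a curve `σ` of probability measures and a
family of fluxes `j_t = (j¹_t, j²_t)`. Only the values on `[0, T]` of `σ` and on `(0, T)` of `j`
matter. -/
structure KacCE (T : ℝ) (σ : ℝ → ProbabilityMeasure Omega)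
    (j : ℝ → SignedMeasure Omega × SignedMeasure Omega) : Prop where
  continuousOn : ContinuousOn σ (Set.Icc 0 T)
  measurable_fst : IsMeasurableFamily T fun t => (j t).1
  measurable_snd : IsMeasurableFamily T fun t => (j t).2
  finite_variation : ∫⁻ t in Set.Ioo (0 : ℝ) T,
    ((j t).1.totalVariation Set.univ + (j t).2.totalVariation Set.univ) < ⊤
  weak_eq : ∀ φ φ' : Omega → ℝ, IsC10 φ φ' → ∀ s t : ℝ, 0 ≤ s → s ≤ t → t ≤ T →
    ∫ p, φ p ∂(σ t : Measure Omega) - ∫ p, φ p ∂(σ s : Measure Omega) =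
      ∫ r in s..t, ((∫ᵛ p, φ' p ∂<•(j r).1) + ∫ᵛ p, (φ (reversal p) - φ p) ∂<•(j r).2)

/-- The rescaled Lagrangian: `Ent(j² | V²/(2α) σ)` if `j¹ = V v σ`, and `+∞` otherwise. -/
def lagrangian (α V : ℝ) (σ : ProbabilityMeasure Omega)
    (j : SignedMeasure Omega × SignedMeasure Omega) : ℝ≥0∞ :=
  open scoped Classical in
  if j.1 = (σ : Measure Omega).withDensityᵥ (fun p => V * vel p.2) then
    relEnt j.2 (ENNReal.ofReal (V ^ 2 / (2 * α)) • (σ : Measure Omega))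
  else ⊤

/-- The rescaled rate functional `𝓘^V`. -/
def rateV (α T V : ℝ) (σ : ℝ → ProbabilityMeasure Omega)
    (j : ℝ → SignedMeasure Omega × SignedMeasure Omega) : ℝ≥0∞ :=
  open scoped Classical in
  if KacCE T σ j then ∫⁻ t in Set.Ioo (0 : ℝ) T, lagrangian α V (σ t) (j t) else ⊤

/-- The measure `m(dx, v)` on the torus, for a fixed velocity `v`. -/
def slice (b : Bool) (m : SignedMeasure Omega) : SignedMeasure Torus :=
  (m.restrict {p | p.2 = b}).map Prod.fst

/-- The density `ρ(dx) = ∑_v σ(dx, v)`. -/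
def density (σ : ProbabilityMeasure Omega) : ProbabilityMeasure Torus :=
  σ.map (f := Prod.fst) measurable_fst.aemeasurable

/-- The flux `ω(dx) = V ∑_v v σ(dx, v)`. -/
def flux (V : ℝ) (σ : ProbabilityMeasure Omega) : SignedMeasure Torus :=
  V • ∑ b : Bool, vel b • slice b (σ : Measure Omega).toSignedMeasure

/-- The derived flux `J(dx) = ∑_v (v / V) j²(dx, v)`. -/
def derivedFlux (V : ℝ) (j : SignedMeasure Omega × SignedMeasure Omega) : SignedMeasure Torus :=
  ∑ b : Bool, (vel b / V) • slice b j.2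

/-- Lebesgue measure on the open interval `(0, T)`. -/
def timeMeasure (T : ℝ) : Measure (Set.Ioo (0 : ℝ) T) :=
  (volume : Measure ℝ).comap Subtype.val

/-- Narrow convergence in the finite signed measures on `(0, T) × 𝕋` of the sequence
`μⁿ(dt dx) = mⁿ_t(dx) dt` to `μ`: convergence of the integrals of all bounded continuous
functions on `(0, T) × 𝕋`. -/
def TendstoNarrowly (T : ℝ) (m : ℕ → ℝ → SignedMeasure Torus)
    (μ : SignedMeasure (Set.Ioo (0 : ℝ) T × Torus)) : Prop :=
  ∀ f : (Set.Ioo (0 : ℝ) T × Torus) →ᵇ ℝ,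
    Tendsto (fun n => ∫ t, (∫ᵛ x, f (t, x) ∂<•(m n t)) ∂(timeMeasure T)) atTop
      (𝓝 (∫ᵛ z, f z ∂<•μ))

/-- The measure `ρ(dt dx) = ρ_t(dx) dt` on `(0, T) × 𝕋`, for a continuous curve `ρ`. -/
def spaceTime (T : ℝ) (ρ : ℝ → ProbabilityMeasure Torus) :
    Measure (Set.Ioo (0 : ℝ) T × Torus) :=
  (timeMeasure T).bind fun t => (ρ t : Measure Torus).map (Prod.mk t)

/-- The continuity equation `∂ₜ ρ + ∂ₓ ω = 0` on the torus. If `ω(dt dx) = ω_t(dx) dt`, as is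
automatic when `ω ≪ ρ_t(dx) dt`, the right-hand side is `∫_s^t ∫ ∂ₓψ dω_r dr`. -/
structure TorusCE (T : ℝ) (ρ : ℝ → ProbabilityMeasure Torus)
    (ω : SignedMeasure (Set.Ioo (0 : ℝ) T × Torus)) : Prop where
  continuousOn : ContinuousOn ρ (Set.Icc 0 T)
  weak_eq : ∀ ψ ψ' : Torus → ℝ, IsC1 ψ ψ' → ∀ s t : ℝ, 0 ≤ s → s ≤ t → t ≤ T →
    ∫ x, ψ x ∂(ρ t : Measure Torus) - ∫ x, ψ x ∂(ρ s : Measure Torus) =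
      ∫ᵛ z in {z : Set.Ioo (0 : ℝ) T × Torus | s < z.1 ∧ z.1 < t}, ψ' z.2 ∂<•ω

/-- The signed measure `D` on `(0, T) × 𝕋` is the distributional derivative `Dρ` in the space
variable of `ρ_t(dx) dt`. Such a `D` is unique if it exists. -/
def IsSpaceDerivative (T : ℝ) (ρ : ℝ → ProbabilityMeasure Torus)
    (D : SignedMeasure (Set.Ioo (0 : ℝ) T × Torus)) : Prop :=
  ∀ χ : ℝ → ℝ, ContDiff ℝ 1 χ → HasCompactSupport χ → tsupport χ ⊆ Set.Ioo 0 T →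
    ∀ ψ ψ' : Torus → ℝ, IsC1 ψ ψ' →
      ∫ t in (0 : ℝ)..T, χ t * ∫ x, ψ' x ∂(ρ t : Measure Torus) =
        -∫ᵛ z, χ z.1 * ψ z.2 ∂<•D

/-- The limiting functional:
`(1/4α) ∫∫ |α dDρ/dρ + dω/dρ|² dρ_t dt` if `ω ≪ ρ`, `Dρ ≪ ρ` and `(ρ, ω)` solves the continuity
equation, and `+∞` otherwise. There is at most one `D = Dρ`, so the infimum is its value at
`Dρ`, or `inf ∅ = +∞`. -/
def limitFunctional (α T : ℝ) (ρ : ℝ → ProbabilityMeasure Torus)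
    (ω : SignedMeasure (Set.Ioo (0 : ℝ) T × Torus)) : ℝ≥0∞ :=
  ⨅ (D : SignedMeasure (Set.Ioo (0 : ℝ) T × Torus))
    (_ : ω ≪ᵥ (spaceTime T ρ).toENNRealVectorMeasure ∧ IsSpaceDerivative T ρ D ∧
      D ≪ᵥ (spaceTime T ρ).toENNRealVectorMeasure ∧ TorusCE T ρ ω),
    ENNReal.ofReal (1 / (4 * α)) *
      ∫⁻ z, ENNReal.ofReal
        (|α * D.rnDeriv (spaceTime T ρ) z + ω.rnDeriv (spaceTime T ρ) z| ^ 2) ∂(spaceTime T ρ)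

/-- `ρ` is a weak solution of the heat equation `∂ₜ ρ = α ∂ₓ² ρ` on `[0, T] × 𝕋`. -/
structure IsWeakHeatSolution (α T : ℝ) (ρ : ℝ → ProbabilityMeasure Torus) : Prop where
  continuousOn : ContinuousOn ρ (Set.Icc 0 T)
  weak_eq : ∀ ψ ψ' ψ'' : Torus → ℝ, IsC1 ψ ψ' → IsC1 ψ' ψ'' →
    ∀ s t : ℝ, 0 ≤ s → s ≤ t → t ≤ T →
      ∫ x, ψ x ∂(ρ t : Measure Torus) - ∫ x, ψ x ∂(ρ s : Measure Torus) =
        α * ∫ r in s..t, ∫ x, ψ'' x ∂(ρ r : Measure Torus)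

end KacDiffusive

end

/-! Finite rate forces the transport flux to be `V v σ` at almost every time, so the continuity
equation has two useful moments. Testing it with `ψ(x)` gives conservation of mass, `∂ₜρ + ∂ₓω = 0`.
Testing it with `v ψ(x)` and dividing by `V` leaves a time derivative of order `1/V`. In the limit
`∫ψ' dρ = 2 ∫ψ dJ` weakly in time, that is `Dρ = -2J` (`KacSequence.isSpaceDerivative`).

The liminf bound is convex duality. The entropy of the switching flux is bounded below by `∫ g dj² -
λ ∫ (e^g - 1) dσ`. With `g = v φ / V` and `λ = V²/(2α)`, a Taylor expansion turns this into `∫φ dJ -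
(1/2α) ∫φ dω - (1/4α) ∫φ² dρ` up to `O(1/V)` (`KacPath.ofReal_le_rate`). Every term passes to the
limit. Optimizing over `φ` bounds the `L²(ρ)` norm of the density of `κ = J - ω/(2α)`
(`absolutelyContinuous_and_lintegral_rnDeriv_sq_le`), and `α Dρ + ω = -2α κ`.

Duality controls only `κ`, so `ω ≪ ρ` needs an a priori estimate. Formally, transport preserves the
entropy `H` relative to `stationary`. Taking `g = ½ log(u₋/u₊)` at velocity `+` and its negative at
velocity `-` in the same duality gives `½ dH/dt + λ ∫(√u₊ - √u₋)² ≤ Lagrangian`. Integrating in time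
and using `H ≥ 0` bounds `V² ∫∫ (√u₊ - √u₋)²` by the initial entropy plus the rate
(`sq_mul_integral_velocityFisher_le`). Since `ω = V (u₊ - u₋)` factors through this difference of
roots, `∫φ dω - ½ ∫φ² dρ ≤ 2αC` follows (`flux_quadratic_bound`). The computation is made rigorous
on a smoothed path, obtained from a Markov kernel that convolves in space and mixes in some uniform
measure. This smoothing is compatible with the equation, increases neither entropy nor rate, and
keeps densities bounded away from zero.

Localized in time, the same estimate makes the densities uniformly Hölder-½ in time when tested
against `C¹` functions. It also rules out concentration of the flux in time. Hence the limit curve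
is continuous and satisfies the continuity equation with sharp time cutoffs (`KacSequence.torusCE`).

For the second claim, a vanishing functional forces `ω = -α Dρ` when tested against products of
cutoffs in time and `C¹` functions of space. Inserting this in the continuity equation with test
function `ψ'` gives the heat equation. -/

namespace KacDiffusive

/-! ### Integration against signed measures and measurable families of them -/

section SignedIntegral

variable {X Y : Type*} [MeasurableSpace X] [MeasurableSpace Y]

instance isFiniteMeasure_variation (μ : SignedMeasure X) : IsFiniteMeasure μ.variation := by
  rw [← SignedMeasure.totalVariation_eq_variation]
  infer_instance

lemma integrable_of_measurable_of_bound {f : X → ℝ} {M : ℝ} (hf : Measurable f)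
    (hM : ∀ x, |f x| ≤ M) (μ : Measure X) [IsFiniteMeasure μ] : Integrable f μ :=
  Integrable.of_bound hf.aestronglyMeasurable M (ae_of_all _ hM)

lemma abs_signedIntegral_le (μ : SignedMeasure X) {f : X → ℝ} {M : ℝ} (hM : ∀ x, |f x| ≤ M) :
    |∫ᵛ x, f x ∂<•μ| ≤ M * μ.variation.real univ := by
  have h : ‖∫ᵛ x, f x ∂<•μ‖ ≤
      M * ‖(ContinuousLinearMap.lsmul ℝ ℝ (E := ℝ)).flip‖ * μ.variation.real univ :=
    VectorMeasure.norm_integral_le_of_norm_le_const (ae_of_all _ hM)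
  rwa [ContinuousLinearMap.opNorm_flip, ContinuousLinearMap.opNorm_lsmul, mul_one] at h

lemma enorm_signedIntegral_le (μ : SignedMeasure X) {f : X → ℝ} {M : ℝ} (hM : ∀ x, |f x| ≤ M) :
    ‖∫ᵛ x, f x ∂<•μ‖ₑ ≤ ENNReal.ofReal M * μ.totalVariation univ := by
  rw [SignedMeasure.totalVariation_eq_variation, ← ofReal_measureReal (measure_ne_top _ _),
    ← ENNReal.ofReal_mul' measureReal_nonneg, Real.enorm_eq_ofReal_abs]
  exact ENNReal.ofReal_le_ofReal (abs_signedIntegral_le μ hM)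

lemma signedIntegral_indicator_one (μ : SignedMeasure X) {s : Set X} (hs : MeasurableSet s) :
    ∫ᵛ x, s.indicator (fun _ => (1 : ℝ)) x ∂<•μ = μ s := by
  rw [VectorMeasure.integral_indicator_const _ hs]
  simp

lemma signedIntegral_withDensity (μ : Measure X) [IsFiniteMeasure μ] {f g : X → ℝ} {M : ℝ}
    (hf : Measurable f) (hM : ∀ x, |f x| ≤ M) (hg : Measurable g) (hgi : Integrable g μ) :
    ∫ᵛ x, f x ∂<•(μ.withDensityᵥ g) = ∫ x, f x * g x ∂μ := by
  have h1 : IsFiniteMeasure (μ.withDensity fun x => ENNReal.ofReal (g x)) :=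
    isFiniteMeasure_withDensity_ofReal hgi.2
  have h2 : IsFiniteMeasure (μ.withDensity fun x => ENNReal.ofReal (-g x)) :=
    isFiniteMeasure_withDensity_ofReal hgi.neg.2
  rw [withDensityᵥ_eq_withDensity_pos_part_sub_withDensity_neg_part hgi,
    VectorMeasure.integral_sub_vectorMeasure
      (integrable_of_measurable_of_bound hf hM _) (integrable_of_measurable_of_bound hf hM _),
    VectorMeasure.integral_toSignedMeasure, VectorMeasure.integral_toSignedMeasure,
    integral_withDensity_eq_integral_toReal_smul (by fun_prop) (by simp),
    integral_withDensity_eq_integral_toReal_smul (by fun_prop) (by simp), ← integral_sub]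
  · refine integral_congr_ae (ae_of_all _ fun x => ?_)
    simp only [smul_eq_mul, ENNReal.toReal_ofReal']
    rcases le_total (g x) 0 with h | h
    · rw [max_eq_right h, max_eq_left (neg_nonneg.2 h)]; ring
    · rw [max_eq_left h, max_eq_right (neg_nonpos.2 h)]; ring
  all_goals
    simp only [smul_eq_mul, ENNReal.toReal_ofReal']
    refine Integrable.mul_bdd (c := M) ?_ hf.aestronglyMeasurable (ae_of_all _ hM)
  · exact hgi.pos_part
  · exact hgi.neg_part

/-- A π-λ argument starting from measurable rectangles, where the section is either `B` or empty.
Complements are handled by subtraction from the mass of `univ`, which is legitimate for finite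
signed measures. -/
lemma measurable_signedMeasure_preimage {m : X → SignedMeasure Y}
    (hm : ∀ E, MeasurableSet E → Measurable fun x => m x E) {E : Set (X × Y)}
    (hE : MeasurableSet E) : Measurable fun x => m x (Prod.mk x ⁻¹' E) := by
  have hsec : ∀ (x : X) {t : Set (X × Y)}, MeasurableSet t → MeasurableSet (Prod.mk x ⁻¹' t) :=
    fun x t ht => measurable_prodMk_left ht
  induction E, hE using MeasurableSpace.induction_on_inter generateFrom_prod.symm
    isPiSystem_prod with
  | empty => simp
  | basic t ht =>
    obtain ⟨A, hA, B, hB, rfl⟩ := ht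
    classical
    have : (fun x => m x (Prod.mk x ⁻¹' A ×ˢ B)) = A.indicator fun x => m x B := by
      ext x
      by_cases hx : x ∈ A <;> simp [hx]
    rw [this]
    exact (hm B hB).indicator hA
  | compl t ht ih =>
    have : (fun x => m x (Prod.mk x ⁻¹' tᶜ)) = fun x => m x univ - m x (Prod.mk x ⁻¹' t) := by
      ext x
      rw [preimage_compl, eq_sub_iff_add_eq, add_comm, compl_eq_univ_sdiff,
        VectorMeasure.of_add_of_sdiff (hsec x ht) .univ (subset_univ _)]
    rw [this]
    exact (hm univ .univ).sub ih
  | iUnion f hd hf ih =>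
    refine measurable_of_tendsto_metrizable
      (f := fun n x => ∑ i ∈ Finset.range n, m x (Prod.mk x ⁻¹' f i))
      (fun n => Finset.measurable_fun_sum _ fun i _ => ih i) (tendsto_pi_nhds.2 fun x => ?_)
    rw [preimage_iUnion]
    exact (VectorMeasure.hasSum_of_disjoint_iUnion (v := m x) (fun i => hsec x (hf i))
      fun i k hik => (hd hik).preimage _).tendsto_sum_nat

/-- Integrals of a bounded jointly measurable function against a measurable family of signed
measures depend measurably on the parameter. -/
lemma measurable_signedIntegral {m : X → SignedMeasure Y}
    (hm : ∀ E, MeasurableSet E → Measurable fun x => m x E) {F : X → Y → ℝ} {M : ℝ}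
    (hF : Measurable (Function.uncurry F)) (hM : ∀ x y, |F x y| ≤ M) :
    Measurable fun x => ∫ᵛ y, F x y ∂<•(m x) := by
  have hsimple : ∀ g : SimpleFunc (X × Y) ℝ, Measurable fun x => ∫ᵛ y, g (x, y) ∂<•(m x) := by
    intro g
    induction g using SimpleFunc.induction with
    | const c hs =>
      rename_i s
      have : (fun x => ∫ᵛ y, (SimpleFunc.piecewise s hs (SimpleFunc.const _ c)
          (SimpleFunc.const _ 0) : X × Y → ℝ) (x, y) ∂<•(m x)) =
          fun x => c * m x (Prod.mk x ⁻¹' s) := by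
        ext x
        rw [← signedIntegral_indicator_one _ (measurable_prodMk_left hs), ← smul_eq_mul c,
          ← VectorMeasure.integral_fun_smul]
        congr 1
        ext y
        by_cases h : (x, y) ∈ s <;> simp [h]
      rw [this]
      exact (measurable_signedMeasure_preimage hm hs).const_mul c
    | add hd hf hg =>
      rename_i f g
      obtain ⟨A, hA⟩ := f.exists_forall_norm_le
      obtain ⟨B, hB⟩ := g.exists_forall_norm_le
      have : (fun x => ∫ᵛ y, (f + g) (x, y) ∂<•(m x)) =
          fun x => ∫ᵛ y, f (x, y) ∂<•(m x) + ∫ᵛ y, g (x, y) ∂<•(m x) := by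
        ext x
        exact VectorMeasure.integral_fun_add
          (integrable_of_measurable_of_bound (f.measurable.comp measurable_prodMk_left)
            (fun y => hA (x, y)) _)
          (integrable_of_measurable_of_bound (g.measurable.comp measurable_prodMk_left)
            (fun y => hB (x, y)) _)
      rw [this]
      exact hf.add hg
  have hs := hF.stronglyMeasurable
  refine measurable_of_tendsto_metrizable (fun n => hsimple (hs.approxBounded M n))
    (tendsto_pi_nhds.2 fun x => ?_)
  refine VectorMeasure.tendsto_integral_of_dominated_convergence (fun _ => M)
    (fun n => ((hs.approxBounded M n).measurable.comp measurable_prodMk_left).aestronglyMeasurable)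
    (integrable_const M) (fun n => ae_of_all _ fun y => ?_) (ae_of_all _ fun y => ?_)
  · exact hs.norm_approxBounded_le ((abs_nonneg _).trans (hM x y)) n (x, y)
  · exact hs.tendsto_approxBounded_of_norm_le (hM x y)

end SignedIntegral
end KacDiffusive

namespace KacDiffusive

/-! ### Duality between quadratic bounds and square integrable densities -/

section QuadraticDuality

variable {Z : Type*} [TopologicalSpace Z] [TopologicalSpace.PseudoMetrizableSpace Z]
  [MeasurableSpace Z] [BorelSpace Z]

/-- Bounded continuous functions are dense in `L¹(τ)`, and an `L¹` convergent sequence has an almost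
everywhere convergent subsequence. Truncation at `±M` restores the uniform bound and leaves the
limit alone because `|f| ≤ M`. -/
lemma exists_boundedContinuous_tendsto_ae (τ : Measure Z) [IsFiniteMeasure τ] {f : Z → ℝ} {M : ℝ}
    (hf : Measurable f) (hM : ∀ z, |f z| ≤ M) :
    ∃ g : ℕ → (Z →ᵇ ℝ), (∀ n z, |g n z| ≤ M) ∧
      ∀ᵐ z ∂τ, Tendsto (fun n => g n z) atTop (𝓝 (f z)) := by
  have hmem : MemLp f 1 τ := memLp_one_iff_integrable.2 (integrable_of_measurable_of_bound hf hM τ)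
  have hex : ∀ n : ℕ, ∃ g : Z →ᵇ ℝ, eLpNorm (f - ⇑g) 1 τ ≤ ((n : ℝ≥0∞) + 1)⁻¹ ∧ MemLp (⇑g) 1 τ :=
    fun n => hmem.exists_boundedContinuous_eLpNorm_sub_le (by simp)
      (ENNReal.inv_ne_zero.2 (by finiteness))
  choose g hg hgm using hex
  have hlim : Tendsto (fun n => eLpNorm (⇑(g n) - f) 1 τ) atTop (𝓝 0) := by
    have h0 : Tendsto (fun n : ℕ => ((n : ℝ≥0∞) + 1)⁻¹) atTop (𝓝 0) := by
      have := (tendsto_add_atTop_iff_nat 1).2 ENNReal.tendsto_inv_nat_nhds_zero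
      simpa using this
    refine tendsto_of_tendsto_of_tendsto_of_le_of_le tendsto_const_nhds h0 (fun _ => zero_le)
      fun n => ?_
    rw [eLpNorm_sub_comm]
    exact hg n
  obtain ⟨ns, -, hns⟩ := (tendstoInMeasure_of_tendsto_eLpNorm one_ne_zero
    (fun n => (hgm n).aestronglyMeasurable) hmem.aestronglyMeasurable hlim).exists_seq_tendsto_ae
  have hbd : ∀ n z, |max (-M) (min (g (ns n) z) M)| ≤ M := fun n z => by
    have : 0 ≤ M := (abs_nonneg _).trans (hM z)
    rw [abs_le]
    exact ⟨le_max_left _ _, max_le (by linarith) (min_le_right _ _)⟩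
  refine ⟨fun n => BoundedContinuousFunction.ofNormedAddCommGroup
    (fun z => max (-M) (min (g (ns n) z) M)) (by fun_prop) M (hbd n), hbd, ?_⟩
  filter_upwards [hns] with z hz
  have := (tendsto_const_nhds (x := -M)).max (hz.min (tendsto_const_nhds (x := M)))
  rwa [min_eq_left (abs_le.1 (hM z)).2, max_eq_right (abs_le.1 (hM z)).1] at this

/-- Approximating almost everywhere for `μ.variation + ν` gives one sequence that serves both
integrals, so dominated convergence applies to each of them. -/
lemma quadratic_bound_of_boundedContinuous (μ : SignedMeasure Z) (ν : Measure Z)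
    [IsFiniteMeasure ν] {c C : ℝ}
    (h : ∀ g : Z →ᵇ ℝ, ∫ᵛ z, g z ∂<•μ - c / 2 * ∫ z, g z ^ 2 ∂ν ≤ C) {f : Z → ℝ} {M : ℝ}
    (hf : Measurable f) (hM : ∀ z, |f z| ≤ M) :
    ∫ᵛ z, f z ∂<•μ - c / 2 * ∫ z, f z ^ 2 ∂ν ≤ C := by
  obtain ⟨g, hgM, hg⟩ := exists_boundedContinuous_tendsto_ae (μ.variation + ν) hf hM
  rw [ae_add_measure_iff] at hg
  have h1 : Tendsto (fun n => ∫ᵛ z, g n z ∂<•μ) atTop (𝓝 (∫ᵛ z, f z ∂<•μ)) :=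
    VectorMeasure.tendsto_integral_of_dominated_convergence (fun _ => M)
      (fun n => (g n).continuous.measurable.aestronglyMeasurable) (integrable_const M)
      (fun n => ae_of_all _ (hgM n)) hg.1
  have h2 : Tendsto (fun n => ∫ z, g n z ^ 2 ∂ν) atTop (𝓝 (∫ z, f z ^ 2 ∂ν)) := by
    refine tendsto_integral_of_dominated_convergence (fun _ => M ^ 2)
      (fun n => ((g n).continuous.measurable.pow_const 2).aestronglyMeasurable)
      (integrable_const _) (fun n => ae_of_all _ fun z => ?_) ?_
    · rw [norm_pow, Real.norm_eq_abs]
      exact pow_le_pow_left₀ (abs_nonneg _) (hgM n z) 2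
    · filter_upwards [hg.2] with z hz using hz.pow 2
  exact le_of_tendsto' (h1.sub (h2.const_mul _)) fun n => h (g n)

/-- A signed measure controlled by a quadratic form of `ν` has a square integrable density. -/
theorem absolutelyContinuous_and_lintegral_rnDeriv_sq_le (μ : SignedMeasure Z) (ν : Measure Z)
    [IsFiniteMeasure ν] {c C : ℝ} (hc : 0 < c)
    (h : ∀ g : Z →ᵇ ℝ, ∫ᵛ z, g z ∂<•μ - c / 2 * ∫ z, g z ^ 2 ∂ν ≤ C) :
    μ ≪ᵥ ν.toENNRealVectorMeasure ∧
      ∫⁻ z, ENNReal.ofReal (|μ.rnDeriv ν z| ^ 2) ∂ν ≤ ENNReal.ofReal (2 * c * C) := by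
  have hac : μ ≪ᵥ ν.toENNRealVectorMeasure := by
    refine VectorMeasure.AbsolutelyContinuous.mk fun s hs hνs => ?_
    rw [Measure.toENNRealVectorMeasure_apply_measurable hs] at hνs
    -- On a `ν`-null set the quadratic penalty vanishes while the linear term scales freely, which
    -- is only possible if `μ s = 0`.
    have key : ∀ L : ℝ, L * μ s ≤ C := fun L => by
      have hb := quadratic_bound_of_boundedContinuous μ ν h (f := s.indicator fun _ => L)
        (M := |L|) (measurable_const.indicator hs)
        (fun z => by by_cases hz : z ∈ s <;> simp [hz])
      rw [VectorMeasure.integral_indicator_const _ hs] at hb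
      have h0 : ∫ z, (s.indicator (fun _ => L) z) ^ 2 ∂ν = 0 := by
        refine integral_eq_zero_of_ae ?_
        filter_upwards [measure_eq_zero_iff_ae_notMem.1 hνs] with z hz
        simp [hz]
      simpa [h0, mul_comm] using hb
    by_contra hne
    have := key ((C + 1) / μ s)
    rw [div_mul_cancel₀ _ hne] at this
    linarith
  refine ⟨hac, ?_⟩
  set r := μ.rnDeriv ν with hr
  have hrm : Measurable r := SignedMeasure.measurable_rnDeriv μ ν
  have hri : Integrable r ν := SignedMeasure.integrable_rnDeriv μ ν
  have hμ : ν.withDensityᵥ r = μ := SignedMeasure.withDensityᵥ_rnDeriv_eq μ ν hac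
  have htrunc : ∀ n : ℕ, ∫⁻ z, ENNReal.ofReal ({z | |r z| ≤ n}.indicator (fun z => |r z| ^ 2) z) ∂ν
      ≤ ENNReal.ofReal (2 * c * C) := fun n => by
    have hS : MeasurableSet {z | |r z| ≤ n} := measurableSet_le hrm.abs measurable_const
    set q : Z → ℝ := {z | |r z| ≤ n}.indicator fun z => |r z| ^ 2 with hq
    have hqb : ∀ z, |q z| ≤ (n : ℝ) ^ 2 := fun z => by
      by_cases hz : |r z| ≤ n
      · simp only [hq, indicator, mem_ofPred_eq, hz, if_true, abs_pow, abs_abs]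
        exact pow_le_pow_left₀ (abs_nonneg _) hz 2
      · simp [hq, hz]
    have hqm : Measurable q := (hrm.abs.pow_const 2).indicator hS
    have hq0 : ∀ z, 0 ≤ q z := fun z => indicator_nonneg (fun _ _ => by positivity) z
    -- The pointwise maximizer of `f r - (c/2) f²` is `r/c`. It is truncated where `|r| > n` to be a
    -- bounded test function, and monotone convergence removes the truncation at the end.
    set f : Z → ℝ := {z | |r z| ≤ n}.indicator fun z => c⁻¹ * r z with hf
    have hfm : Measurable f := (hrm.const_mul _).indicator hS
    have hfb : ∀ z, |f z| ≤ c⁻¹ * n := fun z => by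
      by_cases hz : |r z| ≤ n
      · simp only [hf, indicator, mem_ofPred_eq, hz, if_true, abs_mul, abs_of_pos (inv_pos.2 hc)]
        gcongr
      · simp [hf, hz]
        positivity
    have hb := quadratic_bound_of_boundedContinuous μ ν h hfm hfb
    nth_rewrite 1 [← hμ] at hb
    rw [signedIntegral_withDensity ν hfm hfb hrm hri] at hb
    have e1 : ∫ z, f z * r z ∂ν = c⁻¹ * ∫ z, q z ∂ν := by
      rw [← integral_const_mul]
      congr 1; ext z
      by_cases hz : |r z| ≤ n
      · simp [hf, hq, hz]; ring
      · simp [hf, hq, hz]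
    have e2 : ∫ z, f z ^ 2 ∂ν = c⁻¹ ^ 2 * ∫ z, q z ∂ν := by
      rw [← integral_const_mul]
      congr 1; ext z
      by_cases hz : |r z| ≤ n
      · simp [hf, hq, hz]; ring
      · simp [hf, hq, hz]
    rw [e1, e2] at hb
    rw [← ofReal_integral_eq_lintegral_ofReal (integrable_of_measurable_of_bound hqm hqb ν)
      (ae_of_all _ hq0)]
    refine ENNReal.ofReal_le_ofReal ?_
    have : c⁻¹ * ∫ z, q z ∂ν - c / 2 * (c⁻¹ ^ 2 * ∫ z, q z ∂ν) = (∫ z, q z ∂ν) / (2 * c) := by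
      field_simp; ring
    rw [this, div_le_iff₀ (by positivity)] at hb
    linarith
  refine le_of_tendsto' (lintegral_tendsto_of_tendsto_of_monotone (fun n => ?_) ?_ ?_) htrunc
  · exact (((hrm.abs.pow_const 2).indicator
      (measurableSet_le hrm.abs measurable_const)).ennreal_ofReal).aemeasurable
  · refine ae_of_all _ fun z n k hnk => ENNReal.ofReal_le_ofReal ?_
    refine indicator_le_indicator_of_subset (fun z (hz : |r z| ≤ n) => ?_)
      (fun _ => by positivity) z
    exact hz.trans (Nat.cast_le.2 hnk)
  · refine ae_of_all _ fun z => tendsto_const_nhds.congr' ?_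
    filter_upwards [eventually_ge_atTop ⌈|r z|⌉₊] with n hn
    have hz : |r z| ≤ n := (Nat.le_ceil _).trans (Nat.cast_le.2 hn)
    simp [indicator, hz]

end QuadraticDuality

/-! ### Variational lower bounds for relative entropy -/

section Entropy

open InformationTheory

variable {X : Type*} [MeasurableSpace X]

/-- Young's inequality for the conjugate pair `klFun` and `exp - 1`. For `f > 0` it is `1 + x ≤ exp
x` at `x = g - log f`. -/
lemma mul_sub_exp_le_klFun {f : ℝ} (hf : 0 ≤ f) (g : ℝ) :
    g * f - (Real.exp g - 1) ≤ klFun f := by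
  rw [klFun_apply]
  rcases hf.eq_or_lt with rfl | hf
  · have := Real.exp_pos g
    simp only [mul_zero, zero_mul]
    linarith
  · have h := Real.add_one_le_exp (g - Real.log f)
    rw [Real.exp_sub, Real.exp_log hf, le_div_iff₀ hf] at h
    nlinarith

/-- No integrability is required: the Bochner integral of a non-integrable function is `0`. This
lets real-valued duality bounds be compared with entropies that may be infinite. -/
lemma ofReal_integral_le_lintegral_ofReal {ν : Measure X} (f : X → ℝ) :
    ENNReal.ofReal (∫ x, f x ∂ν) ≤ ∫⁻ x, ENNReal.ofReal (f x) ∂ν := by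
  by_cases hf : Integrable f ν
  · refine (ENNReal.ofReal_le_ofReal (integral_mono hf hf.pos_part fun x => le_max_left _ _)).trans
      ?_
    rw [ofReal_integral_eq_lintegral_ofReal hf.pos_part (ae_of_all _ fun x => le_max_right _ _)]
    refine lintegral_mono fun x => ?_
    simp [ENNReal.ofReal_max]
  · simp [integral_undef hf]

/-- The weighted variational lower bound for the relative entropy. -/
lemma ofReal_sub_le_lintegral_klFun {μ ν : Measure X} [IsFiniteMeasure μ] [IsFiniteMeasure ν]
    (hac : μ ≪ ν) {w g : X → ℝ} {A B : ℝ} (hw : Measurable w) (hw0 : ∀ x, 0 ≤ w x)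
    (hwA : ∀ x, w x ≤ A) (hg : Measurable g) (hgB : ∀ x, |g x| ≤ B) :
    ENNReal.ofReal (∫ x, w x * g x ∂μ - ∫ x, w x * (Real.exp (g x) - 1) ∂ν) ≤
      ∫⁻ x, ENNReal.ofReal (w x) * ENNReal.ofReal (klFun (μ.rnDeriv ν x).toReal) ∂ν := by
  rw [← integral_rnDeriv_smul hac]
  have hwA' : ∀ x, |w x| ≤ A := fun x => by rw [abs_of_nonneg (hw0 x)]; exact hwA x
  have h1 : Integrable (fun x => (μ.rnDeriv ν x).toReal • (w x * g x)) ν := by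
    refine Integrable.mul_bdd (c := A * B) Measure.integrable_toReal_rnDeriv
      (hw.mul hg).aestronglyMeasurable (ae_of_all _ fun x => ?_)
    rw [Real.norm_eq_abs, abs_mul]
    exact mul_le_mul (hwA' x) (hgB x) (abs_nonneg _) ((abs_nonneg _).trans (hwA' x))
  have h2 : Integrable (fun x => w x * (Real.exp (g x) - 1)) ν := by
    refine integrable_of_measurable_of_bound (M := A * (Real.exp B + 1)) (by fun_prop)
      (fun x => ?_) ν
    rw [abs_mul]
    refine mul_le_mul (hwA' x) ?_ (abs_nonneg _) ((abs_nonneg _).trans (hwA' x))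
    have := Real.exp_le_exp.2 (abs_le.1 (hgB x)).2
    have := Real.exp_pos (g x)
    rw [abs_le]; constructor <;> linarith
  rw [← integral_sub h1 h2]
  refine (ofReal_integral_le_lintegral_ofReal _).trans (lintegral_mono fun x => ?_)
  rw [← ENNReal.ofReal_mul (hw0 x)]
  refine ENNReal.ofReal_le_ofReal ?_
  have := mul_le_mul_of_nonneg_left
    (mul_sub_exp_le_klFun (f := (μ.rnDeriv ν x).toReal) ENNReal.toReal_nonneg (g x)) (hw0 x)
  calc _ = w x * (g x * (μ.rnDeriv ν x).toReal - (Real.exp (g x) - 1)) := by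
        rw [smul_eq_mul]; ring
    _ ≤ _ := this

end Entropy

/-! ### Chain rule along absolutely continuous functions -/

section ChainRule

/-- Chain rule for the composition of a function with an indefinite integral. -/
lemma comp_sub_comp_eq_integral {f U F F' : ℝ → ℝ} {T a b : ℝ} (hT : 0 ≤ T)
    (hf : IntervalIntegrable f volume 0 T)
    (hU : ∀ t ∈ Icc 0 T, U t - U 0 = ∫ r in (0 : ℝ)..t, f r)
    (hab : ∀ t ∈ Icc 0 T, U t ∈ Icc a b) (hF : ∀ x ∈ Icc a b, HasDerivAt F (F' x) x)
    (hF' : ContinuousOn F' (Icc a b)) :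
    F (U T) - F (U 0) = ∫ r in (0 : ℝ)..T, F' (U r) * f r := by
  -- `U` is controlled only on `[0, T]`, so it is replaced by this primitive, which agrees with it
  -- there and is differentiable at almost every time. As `F` is Lipschitz on `[a, b]`, the
  -- composition stays absolutely continuous and equals the integral of its derivative.
  set W : ℝ → ℝ := fun t => U 0 + ∫ r in (0 : ℝ)..t, f r with hW
  have hUW : ∀ t ∈ Icc 0 T, U t = W t := fun t ht => by simp only [hW]; linarith [hU t ht]
  have h0 : (0 : ℝ) ∈ uIcc 0 T := left_mem_uIcc
  have hWac : AbsolutelyContinuousOnInterval W 0 T :=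
    (LipschitzOnWith.absolutelyContinuousOnInterval (K := 0)
      (LipschitzWith.const (U 0)).lipschitzOnWith).fun_add
      (hf.absolutelyContinuousOnInterval_intervalIntegral h0)
  obtain ⟨C, hC⟩ := isCompact_Icc.exists_bound_of_continuousOn hF'
  have hlip : ∀ x ∈ Icc a b, ∀ y ∈ Icc a b, dist (F x) (F y) ≤ C * dist x y := fun x hx y hy => by
    rw [Real.dist_eq, Real.dist_eq]
    exact (convex_Icc a b).norm_image_sub_le_of_norm_hasDerivWithin_le
      (fun z hz => (hF z hz).hasDerivWithinAt) hC hy hx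
  have hac : AbsolutelyContinuousOnInterval (F ∘ W) 0 T := by
    rw [absolutelyContinuousOnInterval_iff] at hWac ⊢
    intro ε hε
    obtain ⟨δ, hδ, h⟩ := hWac (ε / (|C| + 1)) (by positivity)
    refine ⟨δ, hδ, fun E hE1 hE2 => ?_⟩
    have h3 := h E hE1 hE2
    have hmem : ∀ t ∈ uIcc 0 T, W t ∈ Icc a b := fun t ht => by
      rw [uIcc_of_le hT] at ht
      rw [← hUW t ht]; exact hab t ht
    calc _ ≤ ∑ i ∈ Finset.range E.1, (|C| + 1) * dist (W (E.2 i).1) (W (E.2 i).2) := by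
          refine Finset.sum_le_sum fun i hi => ?_
          refine (hlip _ (hmem _ (hE1.1 i hi).1) _ (hmem _ (hE1.1 i hi).2)).trans ?_
          exact mul_le_mul_of_nonneg_right (by linarith [le_abs_self C]) dist_nonneg
      _ = (|C| + 1) * ∑ i ∈ Finset.range E.1, dist (W (E.2 i).1) (W (E.2 i).2) := by
          rw [Finset.mul_sum]
      _ < ε := by rwa [lt_div_iff₀' (by positivity)] at h3
  have hfin := hac.integral_deriv_eq_sub
  simp only [Function.comp] at hfin
  rw [hUW T (right_mem_Icc.2 hT), hUW 0 (left_mem_Icc.2 hT), ← hfin]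
  refine intervalIntegral.integral_congr_ae ?_
  filter_upwards [hf.ae_hasDerivAt_integral] with x hx hxm
  have hxm' : x ∈ uIcc 0 T := uIoc_subset_uIcc hxm
  have hd : HasDerivAt W (f x) x := (hx hxm' 0 h0).const_add (U 0)
  rw [uIcc_of_le hT] at hxm'
  have hx2 := hUW x hxm'
  rw [hx2]
  exact ((hF (W x) (hx2 ▸ hab x hxm')).comp x hd).deriv

end ChainRule

end KacDiffusive

namespace KacDiffusive

/-! ### Differentiable functions on the torus, mollifiers, and test functions for narrow continuity
-/

instance isProbabilityMeasure_volume_torus : IsProbabilityMeasure (volume : Measure Torus) :=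
  ⟨UnitAddCircle.measure_univ⟩

section PeriodicFunctions

variable {ψ ψ' χ χ' : Torus → ℝ}

lemma IsC1.continuous (h : IsC1 ψ ψ') : Continuous ψ := by
  have hq : Topology.IsQuotientMap ((↑) : ℝ → Torus) :=
    QuotientAddGroup.isOpenQuotientMap_mk.isQuotientMap
  rw [hq.continuous_iff]
  exact continuous_iff_continuousAt.2 fun x => (h.2 x).continuousAt

lemma exists_abs_le_of_continuous {X : Type*} [TopologicalSpace X] [CompactSpace X] {f : X → ℝ}
    (hf : Continuous f) : ∃ M, 0 ≤ M ∧ ∀ x, |f x| ≤ M := by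
  obtain ⟨M, hM⟩ := isCompact_univ.exists_bound_of_continuousOn hf.continuousOn
  exact ⟨max M 0, le_max_right _ _, fun x => (hM x (mem_univ x)).trans (le_max_left _ _)⟩

lemma integrable_of_continuous {X : Type*} [TopologicalSpace X] [CompactSpace X]
    [MeasurableSpace X] [BorelSpace X] {f : X → ℝ} (hf : Continuous f) (μ : Measure X)
    [IsFiniteMeasure μ] : Integrable f μ := by
  obtain ⟨M, -, hM⟩ := exists_abs_le_of_continuous hf
  exact integrable_of_measurable_of_bound hf.measurable hM μ

lemma IsC1.integral_deriv_eq_zero (h : IsC1 ψ ψ') : ∫ y, ψ' y = 0 := by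
  rw [← AddCircle.intervalIntegral_preimage 1 0 ψ',
    intervalIntegral.integral_eq_sub_of_hasDerivAt (fun x _ => h.2 x)
      ((h.1.comp (AddCircle.continuous_mk' 1)).intervalIntegrable _ _)]
  have : ((0 + 1 : ℝ) : Torus) = ((0 : ℝ) : Torus) := by
    simp
  rw [this, sub_self]

lemma IsC1.const_mul (h : IsC1 ψ ψ') (c : ℝ) : IsC1 (fun x => c * ψ x) (fun x => c * ψ' x) :=
  ⟨h.1.const_mul c, fun x => (h.2 x).const_mul c⟩

lemma IsC1.add_const (h : IsC1 ψ ψ') (c : ℝ) : IsC1 (fun x => ψ x + c) ψ' :=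
  ⟨h.1, fun x => (h.2 x).add_const c⟩

lemma IsC1.pow (h : IsC1 ψ ψ') (n : ℕ) :
    IsC1 (fun x => ψ x ^ n) (fun x => n * ψ x ^ (n - 1) * ψ' x) := by
  refine ⟨?_, fun x => (h.2 x).fun_pow n⟩
  have := h.continuous
  have := h.1
  fun_prop

lemma IsC1.comp_sub_left (h : IsC1 ψ ψ') (y : Torus) :
    IsC1 (fun x => ψ (y - x)) (fun x => -ψ' (y - x)) := by
  refine ⟨(h.1.comp (continuous_const.sub continuous_id)).neg, fun x => ?_⟩
  obtain ⟨y, rfl⟩ := QuotientAddGroup.mk_surjective y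
  have := (h.2 (y - x)).comp x ((hasDerivAt_id x).const_sub y)
  simpa using! this

lemma IsC1.comp_sub_right (h : IsC1 ψ ψ') (y : Torus) :
    IsC1 (fun x => ψ (x - y)) (fun x => ψ' (x - y)) := by
  refine ⟨h.1.comp (continuous_id.sub continuous_const), fun x => ?_⟩
  obtain ⟨y, rfl⟩ := QuotientAddGroup.mk_surjective y
  have := (h.2 (x - y)).comp x ((hasDerivAt_id x).sub_const y)
  simpa using! this

lemma isC1_re_fourier (n : ℤ) : ∃ ψ', IsC1 (fun x => (fourier n x : ℂ).re) ψ' := by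
  refine ⟨fun x => (2 * Real.pi * Complex.I * n / (1 : ℝ) * fourier n x : ℂ).re, ?_, fun x => ?_⟩
  · fun_prop
  · exact Complex.reCLM.hasFDerivAt.comp_hasDerivAt x (hasDerivAt_fourier 1 n x)

lemma isC1_im_fourier (n : ℤ) : ∃ ψ', IsC1 (fun x => (fourier n x : ℂ).im) ψ' := by
  refine ⟨fun x => (2 * Real.pi * Complex.I * n / (1 : ℝ) * fourier n x : ℂ).im, ?_, fun x => ?_⟩
  · fun_prop
  · exact Complex.imCLM.hasFDerivAt.comp_hasDerivAt x (hasDerivAt_fourier 1 n x)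

/-- A nonnegative continuously differentiable approximate identity on the torus. -/
lemma exists_mollifier : ∃ k k' : ℕ → Torus → ℝ, (∀ m, IsC1 (k m) (k' m)) ∧
    (∀ m x, 0 ≤ k m x) ∧ (∀ m, ∫ x, k m x = 1) ∧
    ∀ g : Torus → ℝ, Continuous g → ∀ x,
      Tendsto (fun m => ∫ y, k m (y - x) * g y) atTop (𝓝 (g x)) := by
  obtain ⟨c', hc'⟩ := isC1_re_fourier 1
  -- The mollifiers are the normalized powers of `2 + cos(2πx)`. Its unique maximum at `0` makes
  -- them concentrate there, and the shift by `2` keeps the base at least `1`, so the powers are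
  -- positive.
  set c : Torus → ℝ := fun x => (fourier 1 x : ℂ).re + 2 with hc
  have hC : IsC1 c c' := hc'.add_const 2
  have habs : ∀ x : Torus, |(fourier 1 x : ℂ).re| ≤ 1 := fun x => by
    refine (Complex.abs_re_le_norm _).trans ?_
    rw [fourier_apply, Circle.norm_coe]
  have hpos : ∀ x, 1 ≤ c x := fun x => by
    have := (abs_le.1 (habs x)).1
    simp only [hc]; linarith
  have hmax : ∀ x, x ≠ 0 → c x < c 0 := fun x hx => by
    have h0 : (fourier 1 (0 : Torus) : ℂ) = 1 := fourier_eval_zero 1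
    simp only [hc, h0, Complex.one_re]
    have h1 := (abs_le.1 (habs x)).2
    refine add_lt_add_left (lt_of_le_of_ne h1 fun h => hx ?_) _
    have hn : ‖(fourier 1 x : ℂ)‖ = 1 := by rw [fourier_apply, Circle.norm_coe]
    have him : (fourier 1 x : ℂ).im = 0 := by
      have := Complex.sq_norm_sub_sq_re (fourier 1 x : ℂ)
      rw [hn, h] at this
      simpa using this.symm
    have h2 : (fourier 1 x : ℂ) = 1 := Complex.ext h him
    rw [fourier_one] at h2
    refine AddCircle.injective_toCircle one_ne_zero ?_
    rw [AddCircle.toCircle_zero]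
    exact Circle.ext h2
  have hcc : Continuous c := hC.continuous
  have hint : ∀ m, 0 < ∫ x, c x ^ m := fun m => by
    have h1 : ∫ _ : Torus, (1 : ℝ) ≤ ∫ x, c x ^ m :=
      integral_mono (integrable_const _) (integrable_of_continuous (hcc.pow m) _)
        fun x => one_le_pow₀ (hpos x)
    simp at h1
    linarith
  refine ⟨fun m x => (∫ x, c x ^ m)⁻¹ * c x ^ m, _, fun m => (hC.pow m).const_mul _,
    fun m x => ?_, fun m => ?_, fun g hg x => ?_⟩
  · have := hint m
    have := hpos x
    positivity
  · rw [integral_const_mul, inv_mul_cancel₀ (hint m).ne']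
  · have h := tendsto_setIntegral_pow_smul_of_unique_maximum_of_isCompact_of_continuousOn
      (μ := (volume : Measure Torus)) (g := g) (x₀ := x) (c := fun y => c (y - x)) isCompact_univ
      (by fun_prop) (fun y _ hy => ?_) (fun y _ => ?_) ?_ (by simp) hg.continuousOn
    · simp only [Measure.restrict_univ, smul_eq_mul] at h
      refine h.congr fun m => ?_
      rw [integral_sub_right_eq_self (fun y => c y ^ m) x, ← integral_const_mul]
      simp only [mul_assoc]
    · simpa using hmax (y - x) (sub_ne_zero.2 hy)
    · linarith [hpos (y - x)]
    · linarith [hpos (x - x)]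

/-- Real and imaginary parts of Fourier modes are `C¹`, and trigonometric polynomials are uniformly
dense in the continuous functions. All measures have mass one, so the approximation is uniform in
time and `C¹` tests detect narrow continuity. -/
lemma continuousOn_of_forall_isC1 {ρ : ℝ → ProbabilityMeasure Torus} {S : Set ℝ}
    (h : ∀ ψ ψ' : Torus → ℝ, IsC1 ψ ψ' → ContinuousOn (fun t => ∫ x, ψ x ∂(ρ t : Measure Torus)) S) :
    ContinuousOn ρ S := by
  have hi : ∀ (f : C(Torus, ℂ)) t, Integrable f (ρ t : Measure Torus) := fun f t =>
    f.continuous.integrable_of_hasCompactSupport (HasCompactSupport.of_compactSpace _)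
  have hspan : ∀ f ∈ Submodule.span ℂ (range (@fourier 1)),
      ContinuousOn (fun t => ∫ x, f x ∂(ρ t : Measure Torus)) S := by
    intro f hf
    induction hf using Submodule.span_induction with
    | mem f hf =>
      obtain ⟨n, rfl⟩ := hf
      obtain ⟨a, ha⟩ := isC1_re_fourier n
      obtain ⟨b, hb⟩ := isC1_im_fourier n
      refine ContinuousOn.congr (f := fun t =>
        ((∫ x, (fourier n x : ℂ).re ∂(ρ t : Measure Torus) : ℝ) : ℂ) +
          ((∫ x, (fourier n x : ℂ).im ∂(ρ t : Measure Torus) : ℝ) : ℂ) * Complex.I) ?_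
        fun t _ => (integral_re_add_im (hi (fourier n) t)).symm
      exact (Complex.continuous_ofReal.comp_continuousOn (h _ _ ha)).add
        ((Complex.continuous_ofReal.comp_continuousOn (h _ _ hb)).mul continuousOn_const)
    | zero => simpa using continuousOn_const
    | add f g _ _ hf hg =>
      simp only [ContinuousMap.add_apply, integral_add (hi f _) (hi g _)]
      exact hf.add hg
    | smul c f _ hf =>
      simp only [ContinuousMap.smul_apply, integral_smul]
      exact hf.const_smul c
  have hall : ∀ f : C(Torus, ℂ), ContinuousOn (fun t => ∫ x, f x ∂(ρ t : Measure Torus)) S := by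
    intro f
    refine continuousOn_of_uniform_approx_of_continuousOn fun u hu => ?_
    obtain ⟨ε, hε, hεu⟩ := Metric.mem_uniformity_dist.1 hu
    have hf : f ∈ closure (Submodule.span ℂ (range (@fourier 1)) : Set C(Torus, ℂ)) := by
      rw [← Submodule.topologicalClosure_coe, span_fourier_closure_eq_top]
      trivial
    obtain ⟨g, hg, hfg⟩ := Metric.mem_closure_iff.1 hf ε hε
    refine ⟨_, hspan g hg, fun t _ => hεu ?_⟩
    rw [dist_eq_norm, ← integral_sub (hi f t) (hi g t)]
    refine (norm_integral_le_of_norm_le_const (C := dist f g) (ae_of_all _ fun x => ?_)).trans_lt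
      (by simpa using hfg)
    rw [← dist_eq_norm]
    exact ContinuousMap.dist_apply_le_dist x
  intro t ht
  rw [ContinuousWithinAt, ProbabilityMeasure.tendsto_iff_forall_integral_tendsto]
  intro f
  have hc := Complex.continuous_re.continuousAt.tendsto.comp
    (hall ⟨fun x => ((f x : ℝ) : ℂ), by fun_prop⟩ t ht)
  simpa [Function.comp_def, integral_complex_ofReal] using hc

end PeriodicFunctions

/-! ### Measurability and continuity along curves of probability measures -/

section Curves

/-- Closed sets form a generating π-system. The measure of a closed set is a limit of integrals of
continuous functions, each of which is continuous in time. -/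
lemma measurable_of_continuous_curve {X : Type*} [TopologicalSpace X] [MeasurableSpace X]
    [BorelSpace X] [HasOuterApproxClosed X] {σ : ℝ → ProbabilityMeasure X} (hσ : Continuous σ) :
    Measurable fun t => (σ t : Measure X) := by
  refine Measurable.measure_of_isPiSystem_of_isProbabilityMeasure
    (S := {s | IsClosed s}) ?_ isPiSystem_isClosed fun F hF => ?_
  · rw [← borel_eq_generateFrom_isClosed]
    exact BorelSpace.measurable_eq
  · refine measurable_of_tendsto_metrizable
      (f := fun n t => ∫⁻ x, (IsClosed.apprSeq hF n x : ℝ≥0∞) ∂(σ t : Measure X)) (fun n => ?_)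
      (tendsto_pi_nhds.2 fun t => HasOuterApproxClosed.tendsto_lintegral_apprSeq hF _)
    have h : Continuous fun t => (σ t).toFiniteMeasure.testAgainstNN (IsClosed.apprSeq hF n) :=
      (FiniteMeasure.continuous_testAgainstNN_eval _).comp
        (ProbabilityMeasure.toFiniteMeasure_continuous.comp hσ)
    have h2 := (ENNReal.continuous_coe.comp h).measurable
    simpa only [Function.comp_def, FiniteMeasure.testAgainstNN_coe_eq] using! h2

lemma continuous_integral_of_continuous_curve {X : Type*} [TopologicalSpace X]
    [MeasurableSpace X] [BorelSpace X] [CompactSpace X] {σ : ℝ → ProbabilityMeasure X}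
    (hσ : Continuous σ) {f : X → ℝ} (hf : Continuous f) :
    Continuous fun t => ∫ x, f x ∂(σ t : Measure X) :=
  continuous_iff_continuousAt.2 fun _ =>
    (ProbabilityMeasure.tendsto_iff_forall_integral_tendsto.1 hσ.continuousAt)
      (BoundedContinuousFunction.mkOfCompact ⟨f, hf⟩)

lemma measurable_integral_curve {X Y : Type*} [MeasurableSpace X] [MeasurableSpace Y]
    {σ : Y → ProbabilityMeasure X} (hσ : Measurable fun t => (σ t : Measure X)) {F : Y → X → ℝ}
    {M : ℝ}
    (hF : Measurable (Function.uncurry F)) (hM : ∀ t x, |F t x| ≤ M) :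
    Measurable fun t => ∫ x, F t x ∂(σ t : Measure X) := by
  simp_rw [← VectorMeasure.integral_toSignedMeasure]
  refine measurable_signedIntegral (fun E hE => ?_) hF hM
  simp only [Measure.toSignedMeasure_apply_measurable hE]
  exact ((Measure.measurable_coe hE).comp hσ).ennreal_toReal

end Curves

end KacDiffusive

namespace KacDiffusive

/-! ### Velocity labels and the smoothing Markov kernel -/

lemma vel_not (b : Bool) : vel (!b) = -vel b := by cases b <;> simp [vel]

lemma vel_mul_self (b : Bool) : vel b * vel b = 1 := by cases b <;> simp [vel]

lemma abs_vel (b : Bool) : |vel b| = 1 := by cases b <;> simp [vel]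

lemma continuous_vel_snd : Continuous fun p : Omega => vel p.2 :=
  (continuous_of_discreteTopology (f := vel)).comp continuous_snd

/-- The indicator function of the states with velocity label `b`. -/
noncomputable def velInd (b : Bool) (p : Omega) : ℝ := if p.2 = b then 1 else 0

lemma continuous_velInd (b : Bool) : Continuous (velInd b) :=
  (continuous_of_discreteTopology (f := fun c : Bool => if c = b then (1 : ℝ) else 0)).comp
    continuous_snd

lemma velInd_nonneg (b : Bool) (p : Omega) : 0 ≤ velInd b p := by
  unfold velInd; split_ifs <;> norm_num

lemma velInd_reversal (b : Bool) (p : Omega) : velInd b (reversal p) = velInd (!b) p := by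
  rcases p with ⟨x, c⟩; cases b <;> cases c <;> simp [velInd, reversal]

lemma vel_mul_velInd (b : Bool) (p : Omega) : vel p.2 * velInd b p = vel b * velInd b p := by
  rcases p with ⟨x, c⟩; cases b <;> cases c <;> simp [velInd]

lemma sum_velInd (p : Omega) : ∑ b : Bool, velInd b p = 1 := by
  rcases p with ⟨x, c⟩; cases c <;> simp [velInd]

lemma sum_vel_mul_velInd (p : Omega) : ∑ b : Bool, vel b * velInd b p = vel p.2 := by
  rcases p with ⟨x, c⟩; cases c <;> simp [velInd]

/-- The smoothing kernel: convolution with `k` in space, mixed with the uniform measure. -/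
noncomputable def smoothKernel (k : Torus → ℝ) (ε : ℝ) (b : Bool) (y : Torus) (p : Omega) : ℝ :=
  (1 - ε) * (velInd b p * k (y - p.1)) + ε / 2

section Kernel

variable {k k' : Torus → ℝ} {ε : ℝ}

lemma continuous_smoothKernel (hk : Continuous k) (b : Bool) :
    Continuous (Function.uncurry (smoothKernel k ε b)) := by
  unfold smoothKernel Function.uncurry
  have := continuous_velInd b
  fun_prop

lemma continuous_smoothKernel_right (hk : Continuous k) (b : Bool) (y : Torus) :
    Continuous (smoothKernel k ε b y) :=
  (continuous_smoothKernel hk b).comp (Continuous.prodMk_right y)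

/-- Mixing in the uniform measure is done for the sake of this lower bound: for `ε > 0` it makes
logarithms of smoothed densities bounded. -/
lemma smoothKernel_ge (hk0 : ∀ x, 0 ≤ k x) (hε1 : ε ≤ 1) (b : Bool) (y : Torus) (p : Omega) :
    ε / 2 ≤ smoothKernel k ε b y p := by
  have := mul_nonneg (sub_nonneg.2 hε1) (mul_nonneg (velInd_nonneg b p) (hk0 (y - p.1)))
  unfold smoothKernel
  linarith

/-- The spatial kernel does not depend on the velocity and the mixed-in constant is symmetric, so
smoothing commutes with switching. This preserves the form of the switching term under smoothing. -/
lemma smoothKernel_reversal (b : Bool) (y : Torus) (p : Omega) :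
    smoothKernel k ε b y (reversal p) = smoothKernel k ε (!b) y p := by
  rw [smoothKernel, velInd_reversal]; rfl

lemma isC10_smoothKernel (hk : IsC1 k k') (b : Bool) (y : Torus) :
    IsC10 (smoothKernel k ε b y) fun p => -((1 - ε) * (velInd b p * k' (y - p.1))) := by
  intro c
  have h := (((hk.comp_sub_left y).const_mul (velInd b (y, c))).const_mul (1 - ε)).add_const (ε / 2)
  simp only [velInd, mul_neg] at h
  exact h

lemma integral_smooth_sub (hk1 : ∫ x, k x = 1) (x : Torus) : ∫ y, k (y - x) = 1 := by
  rw [integral_sub_right_eq_self, hk1]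

lemma integral_smoothKernel_left (hk : Continuous k) (hk1 : ∫ x, k x = 1) (b : Bool)
    (p : Omega) : ∫ y, smoothKernel k ε b y p = (1 - ε) * velInd b p + ε / 2 := by
  unfold smoothKernel
  rw [integral_add (integrable_of_continuous (by fun_prop) _) (integrable_const _),
    integral_const_mul, integral_const_mul, integral_smooth_sub hk1]
  simp

/-- The Markov property of the kernel, which is what prevents smoothing from increasing entropy. -/
lemma sum_lintegral_smoothKernel (hk : Continuous k) (hk0 : ∀ x, 0 ≤ k x) (hk1 : ∫ x, k x = 1)
    (hε0 : 0 ≤ ε) (hε1 : ε ≤ 1) (p : Omega) :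
    ∑ b : Bool, ∫⁻ y, ENNReal.ofReal (smoothKernel k ε b y p) = 1 := by
  have h : ∀ b : Bool, ∫⁻ y, ENNReal.ofReal (smoothKernel k ε b y p) =
      ENNReal.ofReal ((1 - ε) * velInd b p + ε / 2) := fun b => by
    rw [← integral_smoothKernel_left hk hk1, ofReal_integral_eq_lintegral_ofReal]
    · exact integrable_of_continuous ((continuous_smoothKernel hk b).comp
        (Continuous.prodMk_left p)) _
    · exact ae_of_all _ fun y => (by positivity : 0 ≤ ε / 2).trans (smoothKernel_ge hk0 hε1 b y p)
  simp only [h]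
  rw [← ENNReal.ofReal_sum_of_nonneg, Finset.sum_add_distrib, ← Finset.mul_sum, sum_velInd]
  · rw [Fintype.sum_bool, ENNReal.ofReal_eq_one]; ring
  · intro b _
    have := mul_nonneg (sub_nonneg.2 hε1) (velInd_nonneg b p)
    positivity

instance isProbabilityMeasure_uniformOn_bool :
    IsProbabilityMeasure (ProbabilityTheory.uniformOn (Set.univ : Set Bool)) :=
  ProbabilityTheory.isProbabilityMeasure_uniformOn finite_univ univ_nonempty

instance isProbabilityMeasure_stationary : IsProbabilityMeasure stationary := by
  unfold stationary; infer_instance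

/-- Convolution does not increase the relative entropy (in variational form). -/
lemma ofReal_integral_smoothKernel_le_klDiv (hk : Continuous k) (hk0 : ∀ x, 0 ≤ k x)
    (hk1 : ∫ x, k x = 1) (hε0 : 0 ≤ ε) (hε1 : ε ≤ 1) (μ ν : Measure Omega) [IsFiniteMeasure μ]
    [IsFiniteMeasure ν] (g : Bool → Torus → ℝ) :
    ENNReal.ofReal (∫ y, ∑ b, ((∫ p, smoothKernel k ε b y p ∂μ) * g b y -
      (∫ p, smoothKernel k ε b y p ∂ν) * (Real.exp (g b y) - 1))) ≤
      InformationTheory.klDiv μ ν := by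
  by_cases hac : μ ≪ ν
  swap
  · rw [InformationTheory.klDiv_of_not_ac hac]; exact le_top
  rw [InformationTheory.klDiv_eq_lintegral_klFun_of_ac hac]
  set q : Omega → ℝ≥0∞ := fun p =>
    ENNReal.ofReal (InformationTheory.klFun (μ.rnDeriv ν p).toReal) with hq
  have hqm : Measurable q := by
    have := InformationTheory.measurable_klFun
    fun_prop
  have hcont := fun b => continuous_smoothKernel (ε := ε) hk b
  -- For each target point `(b, y)` the weighted variational bound is used with the kernel as weight
  -- and a constant exponent. Integrating over the target points, the weights sum to one and the
  -- full entropy reappears.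
  have hpt : ∀ b y, ENNReal.ofReal ((∫ p, smoothKernel k ε b y p ∂μ) * g b y -
      (∫ p, smoothKernel k ε b y p ∂ν) * (Real.exp (g b y) - 1)) ≤
      ∫⁻ p, ENNReal.ofReal (smoothKernel k ε b y p) * q p ∂ν := fun b y => by
    obtain ⟨A, -, hA⟩ := exists_abs_le_of_continuous (continuous_smoothKernel_right (ε := ε) hk b y)
    have := ofReal_sub_le_lintegral_klFun hac (w := smoothKernel k ε b y) (g := fun _ => g b y)
      (continuous_smoothKernel_right hk b y).measurable
      (fun p => (by positivity : 0 ≤ ε / 2).trans (smoothKernel_ge hk0 hε1 b y p))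
      (fun p => (le_abs_self _).trans (hA p)) measurable_const (fun _ => le_rfl)
    rwa [integral_mul_const, integral_mul_const] at this
  calc _ ≤ ∫⁻ y, ∑ b, ∫⁻ p, ENNReal.ofReal (smoothKernel k ε b y p) * q p ∂ν := by
        refine (ofReal_integral_le_lintegral_ofReal _).trans (lintegral_mono fun y => ?_)
        refine (Finset.le_sum_of_subadditive ENNReal.ofReal (by simp)
          (fun _ _ => ENNReal.ofReal_add_le) _ _).trans (Finset.sum_le_sum fun b _ => hpt b y)
    _ = ∫⁻ p, q p ∂ν := by
        have hm : ∀ b, Measurable (Function.uncurry fun y p =>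
            ENNReal.ofReal (smoothKernel k ε b y p) * q p) := fun b =>
          ((hcont b).measurable.ennreal_ofReal).mul (hqm.comp measurable_snd)
        rw [lintegral_finsetSum _ fun b _ => (hm b).lintegral_prod_right]
        simp_rw [fun b => lintegral_lintegral_swap (hm b).aemeasurable (μ := volume) (ν := ν)]
        rw [← lintegral_finsetSum _ fun b _ => (hm b).lintegral_prod_left]
        refine lintegral_congr fun p => ?_
        have hm2 : ∀ b, Measurable fun y => ENNReal.ofReal (smoothKernel k ε b y p) := fun b =>
          ((hcont b).comp (Continuous.prodMk_left p)).measurable.ennreal_ofReal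
        simp_rw [fun b => lintegral_mul_const (μ := volume) (q p) (hm2 b)]
        rw [← Finset.sum_mul, sum_lintegral_smoothKernel hk hk0 hk1 hε0 hε1, one_mul]

/-- Smoothing preserves `stationary`, whose density is `1/2` in each velocity. The initial entropy
can therefore be compared with the same reference measure. -/
lemma integral_smoothKernel_stationary (hk : Continuous k) (hk1 : ∫ x, k x = 1) (b : Bool)
    (y : Torus) : ∫ p, smoothKernel k ε b y p ∂stationary = 1 / 2 := by
  have hv := continuous_velInd b
  have h1 : ∫ p, velInd b p * k (y - p.1) ∂stationary = 1 / 2 := by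
    have h := integral_prod_mul (μ := (volume : Measure Torus))
      (ν := ProbabilityTheory.uniformOn (Set.univ : Set Bool)) (fun x => k (y - x))
      (fun c => if c = b then (1 : ℝ) else 0)
    rw [integral_sub_left_eq_self, hk1, one_mul] at h
    simp_rw [mul_comm (velInd _ _)]
    refine h.trans ?_
    rw [integral_fintype .of_finite, Fintype.sum_bool]
    simp only [Measure.real, ProbabilityTheory.uniformOn_univ, Measure.count_singleton]
    cases b <;> simp
  unfold smoothKernel
  rw [integral_add (integrable_of_continuous (by fun_prop) _) (integrable_const _),
    integral_const_mul, h1]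
  simp
  ring

lemma isC1_integral_smoothKernel (hk : IsC1 k k') (σ : Measure Omega) [IsFiniteMeasure σ]
    (b : Bool) : IsC1 (fun y => ∫ p, smoothKernel k ε b y p ∂σ)
      fun y => ∫ p, (1 - ε) * (velInd b p * k' (y - p.1)) ∂σ := by
  have hk0 := hk.continuous
  have hk' := hk.1
  have hv := continuous_velInd b
  have hcont : Continuous fun q : Torus × Omega =>
    (1 - ε) * (velInd b q.2 * k' (q.1 - q.2.1)) := by fun_prop
  obtain ⟨A, hA0, hA⟩ := exists_abs_le_of_continuous hcont
  refine ⟨?_, fun x => ?_⟩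
  · refine continuous_of_dominated (bound := fun _ => A) (fun y => ?_)
      (fun y => ae_of_all _ fun p => hA (y, p)) (integrable_const A)
      (ae_of_all _ fun p => by fun_prop)
    exact (by fun_prop : Continuous fun p : Omega =>
      (1 - ε) * (velInd b p * k' (y - p.1))).aestronglyMeasurable
  · refine (hasDerivAt_integral_of_dominated_loc_of_deriv_le
      (F := fun (y : ℝ) p => smoothKernel k ε b (y : Torus) p)
      (F' := fun (y : ℝ) p => (1 - ε) * (velInd b p * k' ((y : Torus) - p.1)))
      (bound := fun _ => A) univ_mem ?_ ?_ ?_ ?_ (integrable_const A) ?_).2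
    · exact Eventually.of_forall fun y =>
        (continuous_smoothKernel_right hk0 b _).aestronglyMeasurable
    · exact integrable_of_continuous (continuous_smoothKernel_right hk0 b _) _
    · exact (by fun_prop : Continuous fun p : Omega =>
        (1 - ε) * (velInd b p * k' ((x : Torus) - p.1))).aestronglyMeasurable
    · exact ae_of_all _ fun p y _ => hA (y, p)
    · exact ae_of_all _ fun p y _ =>
        ((((hk.comp_sub_right p.1).const_mul (velInd b p)).const_mul (1 - ε)).add_const (ε / 2)).2 y

end Kernel

/-- Two-velocity paths with their switching flux, after elimination of the transport flux and
extension to all times. -/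
structure KacPath (α T V : ℝ) (R : ℝ≥0∞) (σ : ℝ → ProbabilityMeasure Omega)
    (j : ℝ → SignedMeasure Omega) : Prop where
  continuous : Continuous σ
  measurable : ∀ E, MeasurableSet E → Measurable fun t => j t E
  finite_variation : ∫⁻ t in Ioo (0 : ℝ) T, (j t).totalVariation univ < ⊤
  weak_eq : ∀ φ φ' : Omega → ℝ, IsC10 φ φ' → ∀ s t : ℝ, 0 ≤ s → s ≤ t → t ≤ T →
    ∫ p, φ p ∂(σ t : Measure Omega) - ∫ p, φ p ∂(σ s : Measure Omega) =
      ∫ r in s..t, (V * ∫ p, vel p.2 * φ' p ∂(σ r : Measure Omega) +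
        ∫ᵛ p, (φ (reversal p) - φ p) ∂<•(j r))
  entropy_le : ∫⁻ t in Ioo (0 : ℝ) T,
    relEnt (j t) (ENNReal.ofReal (V ^ 2 / (2 * α)) • (σ t : Measure Omega)) ≤ R

end KacDiffusive

/-! ### The smoothed path and its entropy balance -/

namespace KacDiffusive

/-- The density of the smoothed path. -/
noncomputable def smoothDensity (k : Torus → ℝ) (ε : ℝ) (σ : ℝ → ProbabilityMeasure Omega)
    (b : Bool) (r : ℝ) (y : Torus) : ℝ :=
  ∫ p, smoothKernel k ε b y p ∂(σ r : Measure Omega)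

/-- The space derivative of the density of the smoothed path. -/
noncomputable def smoothDensityDeriv (k' : Torus → ℝ) (ε : ℝ) (σ : ℝ → ProbabilityMeasure Omega)
    (b : Bool) (r : ℝ) (y : Torus) : ℝ :=
  ∫ p, (1 - ε) * (velInd b p * k' (y - p.1)) ∂(σ r : Measure Omega)

/-- The density of the smoothed switching flux. -/
noncomputable def smoothFlux (k : Torus → ℝ) (ε : ℝ) (j : ℝ → SignedMeasure Omega)
    (b : Bool) (r : ℝ) (y : Torus) : ℝ :=
  ∫ᵛ p, smoothKernel k ε b y p ∂<•(j r)

section Dissipation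

variable {α T V ε : ℝ} {R : ℝ≥0∞} {σ : ℝ → ProbabilityMeasure Omega} {j : ℝ → SignedMeasure Omega}
  {k k' : Torus → ℝ}

lemma smoothDensity_ge (hk : Continuous k) (hk0 : ∀ x, 0 ≤ k x) (hε1 : ε ≤ 1) (b : Bool) (r : ℝ)
    (y : Torus) : ε / 2 ≤ smoothDensity k ε σ b r y := by
  have := integral_mono (μ := (σ r : Measure Omega)) (integrable_const (ε / 2))
    (integrable_of_continuous (continuous_smoothKernel_right hk b y) _)
    (smoothKernel_ge hk0 hε1 b y)
  simpa [smoothDensity] using! this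

lemma exists_smoothKernel_le (hk : Continuous k) :
    ∃ A, 0 ≤ A ∧ ∀ b y p, |smoothKernel k ε b y p| ≤ A := by
  choose A hA0 hA using fun b => exists_abs_le_of_continuous (continuous_smoothKernel (ε := ε) hk b)
  exact ⟨A true + A false, add_nonneg (hA0 _) (hA0 _), fun b y p => (hA b (y, p)).trans
    (by cases b <;> linarith [hA0 true, hA0 false])⟩

lemma abs_integral_le_of_abs_le {X : Type*} [MeasurableSpace X] (μ : Measure X)
    [IsProbabilityMeasure μ] {f : X → ℝ} {A : ℝ} (hf : ∀ x, |f x| ≤ A) : |∫ x, f x ∂μ| ≤ A := by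
  simpa using norm_integral_le_of_norm_le_const (μ := μ) (f := f) (C := A) (ae_of_all _ hf)

lemma measurable_smoothDensity (hσ : Continuous σ) (hk : Continuous k) (b : Bool) :
    Measurable (Function.uncurry (smoothDensity k ε σ b)) := by
  obtain ⟨A, -, hA⟩ := exists_smoothKernel_le (ε := ε) hk
  exact measurable_integral_curve (σ := fun q : ℝ × Torus => σ q.1)
    (F := fun q p => smoothKernel k ε b q.2 p)
    ((measurable_of_continuous_curve hσ).comp measurable_fst)
    ((continuous_smoothKernel hk b).measurable.comp
      ((measurable_snd.comp measurable_fst).prodMk measurable_snd)) fun q p => hA b q.2 p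

lemma measurable_smoothDensityDeriv (hσ : Continuous σ) (hk : Continuous k') (b : Bool) :
    Measurable (Function.uncurry (smoothDensityDeriv k' ε σ b)) := by
  have hv := continuous_velInd b
  have hc : Continuous fun q : Torus × Omega => (1 - ε) * (velInd b q.2 * k' (q.1 - q.2.1)) := by
    fun_prop
  obtain ⟨A, -, hA⟩ := exists_abs_le_of_continuous hc
  exact measurable_integral_curve (σ := fun q : ℝ × Torus => σ q.1)
    (F := fun q p => (1 - ε) * (velInd b p * k' (q.2 - p.1)))
    ((measurable_of_continuous_curve hσ).comp measurable_fst)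
    (hc.measurable.comp ((measurable_snd.comp measurable_fst).prodMk measurable_snd))
    fun q p => hA (q.2, p)

lemma measurable_smoothFlux (hj : ∀ E, MeasurableSet E → Measurable fun t => j t E)
    (hk : Continuous k) (b : Bool) : Measurable (Function.uncurry (smoothFlux k ε j b)) := by
  obtain ⟨A, -, hA⟩ := exists_smoothKernel_le (ε := ε) hk
  exact measurable_signedIntegral (m := fun q : ℝ × Torus => j q.1)
    (F := fun q p => smoothKernel k ε b q.2 p) (fun E hE => (hj E hE).comp measurable_fst)
    ((continuous_smoothKernel hk b).measurable.comp
      ((measurable_snd.comp measurable_fst).prodMk measurable_snd)) fun q p => hA b q.2 p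

lemma exists_smoothDensityDeriv_le (hk : Continuous k') :
    ∃ A, ∀ b r y, |smoothDensityDeriv k' ε σ b r y| ≤ A := by
  have hc : ∀ b, Continuous fun q : Torus × Omega =>
      (1 - ε) * (velInd b q.2 * k' (q.1 - q.2.1)) := fun b => by
    have hv := continuous_velInd b
    fun_prop
  choose A hA0 hA using fun b => exists_abs_le_of_continuous (hc b)
  exact ⟨A true + A false, fun b r y => (abs_integral_le_of_abs_le _ fun p => hA b (y, p)).trans
    (by cases b <;> linarith [hA0 true, hA0 false])⟩

lemma integrable_smoothFlux_prod (h : KacPath α T V R σ j) (hk : Continuous k) (b : Bool) :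
    Integrable (Function.uncurry (smoothFlux k ε j b))
      ((volume.restrict (Ioo 0 T)).prod (volume : Measure Torus)) := by
  obtain ⟨A, hA0, hA⟩ := exists_smoothKernel_le (ε := ε) hk
  have hm := measurable_smoothFlux (ε := ε) h.measurable hk b
  refine ⟨hm.aestronglyMeasurable, ?_⟩
  rw [HasFiniteIntegral, lintegral_prod _ hm.enorm.aemeasurable]
  refine (lintegral_mono (g := fun t => ENNReal.ofReal A * (j t).totalVariation univ)
    fun t => ?_).trans_lt ?_
  · refine (lintegral_mono fun y => enorm_signedIntegral_le (j t) (hA b y)).trans ?_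
    simp
  · rw [lintegral_const_mul' _ _ (by finiteness)]
    exact ENNReal.mul_lt_top (by finiteness) h.finite_variation

lemma integrableOn_signedIntegral (h : KacPath α T V R σ j) {F : ℝ → Omega → ℝ} {A : ℝ}
    (hF : Measurable (Function.uncurry F)) (hA : ∀ r p, |F r p| ≤ A) :
    IntegrableOn (fun r => ∫ᵛ p, F r p ∂<•(j r)) (Ioo 0 T) := by
  refine ⟨(measurable_signedIntegral h.measurable hF hA).aestronglyMeasurable, ?_⟩
  refine (lintegral_mono (g := fun t => ENNReal.ofReal A * (j t).totalVariation univ)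
    fun t => enorm_signedIntegral_le (j t) (hA t)).trans_lt ?_
  rw [lintegral_const_mul' _ _ (by finiteness)]
  exact ENNReal.mul_lt_top (by finiteness) h.finite_variation

lemma integrableOn_smoothFlux (h : KacPath α T V R σ j) (hk : Continuous k) (b : Bool)
    (y : Torus) : IntegrableOn (fun r => smoothFlux k ε j b r y) (Ioo 0 T) := by
  obtain ⟨A, -, hA⟩ := exists_smoothKernel_le (ε := ε) hk
  exact integrableOn_signedIntegral h (F := fun _ p => smoothKernel k ε b y p)
    ((continuous_smoothKernel_right hk b y).measurable.comp measurable_snd) fun _ p => hA b y p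

/-- The time derivative of the density of the smoothed path. -/
noncomputable def smoothRate (V : ℝ) (k k' : Torus → ℝ) (ε : ℝ) (σ : ℝ → ProbabilityMeasure Omega)
    (j : ℝ → SignedMeasure Omega) (b : Bool) (r : ℝ) (y : Torus) : ℝ :=
  -(V * vel b) * smoothDensityDeriv k' ε σ b r y + (smoothFlux k ε j (!b) r y -
    smoothFlux k ε j b r y)

/-- The kernel at a fixed target point is itself an admissible test function, so the weak equation
becomes an evolution equation for the smoothed density at that point. -/
lemma smoothDensity_sub_eq (h : KacPath α T V R σ j) (hk : IsC1 k k') (b : Bool) (y : Torus)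
    {t : ℝ} (ht : t ∈ Icc 0 T) :
    smoothDensity k ε σ b t y - smoothDensity k ε σ b 0 y =
      ∫ r in (0 : ℝ)..t, smoothRate V k k' ε σ j b r y := by
  refine (h.weak_eq _ _ (isC10_smoothKernel (ε := ε) hk b y) 0 t le_rfl ht.1 ht.2).trans ?_
  refine intervalIntegral.integral_congr fun r _ => ?_
  have hc := fun b => continuous_smoothKernel_right (ε := ε) hk.continuous b y
  obtain ⟨A, -, hA⟩ := exists_smoothKernel_le (ε := ε) hk.continuous
  have hi := fun b => integrable_of_measurable_of_bound (hc b).measurable (hA b y) (j r).variation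
  have e1 : ∫ p, vel p.2 * -((1 - ε) * (velInd b p * k' (y - p.1))) ∂(σ r : Measure Omega) =
      -vel b * smoothDensityDeriv k' ε σ b r y := by
    rw [smoothDensityDeriv, ← integral_const_mul]
    refine integral_congr_ae (ae_of_all _ fun p => ?_)
    linear_combination (-(1 - ε) * k' (y - p.1)) * vel_mul_velInd b p
  simp only [e1, smoothKernel_reversal, smoothRate, smoothFlux]
  rw [VectorMeasure.integral_fun_sub (hi _) (hi _)]
  ring

lemma integrableOn_smoothRate (h : KacPath α T V R σ j) (hk : IsC1 k k') (b : Bool) (y : Torus) :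
    IntegrableOn (fun r => smoothRate V k k' ε σ j b r y) (Ioo 0 T) := by
  obtain ⟨A, hA⟩ := exists_smoothDensityDeriv_le (ε := ε) (σ := σ) hk.1
  have h1 := integrable_of_measurable_of_bound (f := fun r => smoothDensityDeriv k' ε σ b r y)
    ((measurable_smoothDensityDeriv (ε := ε) h.continuous hk.1 b).comp
      (measurable_id.prodMk measurable_const)) (fun r => hA b r y) (volume.restrict (Ioo 0 T))
  exact (h1.const_mul _).add ((integrableOn_smoothFlux h hk.continuous _ y).sub
    (integrableOn_smoothFlux h hk.continuous _ y))

lemma integrable_smoothRate_prod (h : KacPath α T V R σ j) (hk : IsC1 k k') (b : Bool) :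
    Integrable (Function.uncurry (smoothRate V k k' ε σ j b))
      ((volume.restrict (Ioo 0 T)).prod (volume : Measure Torus)) := by
  obtain ⟨A, hA⟩ := exists_smoothDensityDeriv_le (ε := ε) (σ := σ) hk.1
  have h1 := integrable_of_measurable_of_bound
    (measurable_smoothDensityDeriv (ε := ε) h.continuous hk.1 b) (fun q => hA b q.1 q.2)
    ((volume.restrict (Ioo 0 T)).prod (volume : Measure Torus))
  exact (h1.const_mul _).add ((integrable_smoothFlux_prod h hk.continuous _).sub
    (integrable_smoothFlux_prod h hk.continuous _))

open InformationTheory in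
/-- Entropy balance for the smoothed path. -/
lemma entropy_balance (h : KacPath α T V R σ j) (hT : 0 < T) (hk : IsC1 k k')
    (hk0 : ∀ x, 0 ≤ k x) (hε0 : 0 < ε) (hε1 : ε ≤ 1) (b : Bool) (y : Torus) :
    klFun (2 * smoothDensity k ε σ b T y) / 2 - klFun (2 * smoothDensity k ε σ b 0 y) / 2 =
      ∫ r in Ioo 0 T, Real.log (2 * smoothDensity k ε σ b r y) *
        smoothRate V k k' ε σ j b r y := by
  obtain ⟨A, -, hA⟩ := exists_smoothKernel_le (ε := ε) hk.continuous
  rw [← integral_Ioc_eq_integral_Ioo, ← intervalIntegral.integral_of_le hT.le]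
  -- Relative to the reference density `1/2` the entropy density of `u` is `klFun (2u) / 2`, with
  -- derivative `log (2u)`. It is smooth on `[ε/2, A]`, where the smoothed density takes its values.
  refine comp_sub_comp_eq_integral (U := fun r => smoothDensity k ε σ b r y)
    (F := fun x => klFun (2 * x) / 2) (F' := fun x => Real.log (2 * x)) (a := ε / 2) (b := A) hT.le
    ?_ (fun t ht => smoothDensity_sub_eq h hk b y ht) (fun t _ => ⟨smoothDensity_ge hk.continuous
      hk0 hε1 b t y, (le_abs_self _).trans (abs_integral_le_of_abs_le _ (hA b y))⟩) ?_ ?_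
  · rw [intervalIntegrable_iff_integrableOn_Ioo_of_le hT.le]
    exact integrableOn_smoothRate h hk b y
  · intro x hx
    have hx0 : 2 * x ≠ 0 := by linarith [hx.1]
    have := ((hasDerivAt_klFun hx0).comp x ((hasDerivAt_id x).const_mul 2)).div_const 2
    simpa [Function.comp_def] using! this
  · refine ContinuousOn.log (by fun_prop) fun x hx => by linarith [hx.1]

end Dissipation

end KacDiffusive

namespace KacDiffusive

/-! ### Entropy production and Fisher information in the velocity variable -/

section Dissipation

variable {α T V ε : ℝ} {R : ℝ≥0∞} {σ : ℝ → ProbabilityMeasure Omega} {j : ℝ → SignedMeasure Omega}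
  {k k' : Torus → ℝ}

open InformationTheory

lemma exists_log_smoothDensity_le (hk : Continuous k) (hk0 : ∀ x, 0 ≤ k x) (hε0 : 0 < ε)
    (hε1 : ε ≤ 1) : ∃ L, ∀ b r y, |Real.log (2 * smoothDensity k ε σ b r y)| ≤ L := by
  obtain ⟨A, -, hA⟩ := exists_smoothKernel_le (ε := ε) hk
  have hc : ContinuousOn (fun x => Real.log (2 * x)) (Icc (ε / 2) A) :=
    ContinuousOn.log (by fun_prop) fun x hx => by linarith [hx.1]
  obtain ⟨L, hL⟩ := isCompact_Icc.exists_bound_of_continuousOn hc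
  exact ⟨L, fun b r y => hL _ ⟨smoothDensity_ge hk hk0 hε1 b r y,
    (le_abs_self _).trans (abs_integral_le_of_abs_le _ (hA b y))⟩⟩

/-- Transport does not change the entropy: the integrand is the space derivative of `klFun (2u) /
2`, which is periodic. -/
lemma integral_log_mul_smoothDensityDeriv (hk : IsC1 k k') (hk0 : ∀ x, 0 ≤ k x) (hε0 : 0 < ε)
    (hε1 : ε ≤ 1) (b : Bool) (r : ℝ) :
    ∫ y, Real.log (2 * smoothDensity k ε σ b r y) * smoothDensityDeriv k' ε σ b r y = 0 := by
  have h := isC1_integral_smoothKernel (ε := ε) hk (σ r : Measure Omega) b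
  have hpos : ∀ y, 2 * smoothDensity k ε σ b r y ≠ 0 := fun y => by
    have := smoothDensity_ge (σ := σ) hk.continuous hk0 hε1 b r y
    linarith
  refine IsC1.integral_deriv_eq_zero (ψ := fun y => klFun (2 * smoothDensity k ε σ b r y) / 2)
    ⟨((continuous_const.mul h.continuous).log hpos).mul h.1, fun x => ?_⟩
  have := ((hasDerivAt_klFun (hpos x)).comp x ((h.2 x).const_mul 2)).div_const 2
  have e : ∀ a b : ℝ, a * (2 * b) / 2 = a * b := fun a b => by ring
  rw [e] at this
  exact this

/-- The entropy production of the smoothed switching flux. -/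
noncomputable def fluxProduction (k : Torus → ℝ) (ε : ℝ) (σ : ℝ → ProbabilityMeasure Omega)
    (j : ℝ → SignedMeasure Omega) (r : ℝ) (y : Torus) : ℝ :=
  ∑ b, smoothFlux k ε j b r y * (Real.log (2 * smoothDensity k ε σ (!b) r y) -
    Real.log (2 * smoothDensity k ε σ b r y))

/-- The Fisher information density of the smoothed path in the velocity variable. -/
noncomputable def velocityFisher (k : Torus → ℝ) (ε : ℝ) (σ : ℝ → ProbabilityMeasure Omega)
    (r : ℝ) (y : Torus) : ℝ :=
  (√(smoothDensity k ε σ true r y) - √(smoothDensity k ε σ false r y)) ^ 2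

lemma integrable_fluxProduction (h : KacPath α T V R σ j) (hk : Continuous k)
    (hk0 : ∀ x, 0 ≤ k x) (hε0 : 0 < ε) (hε1 : ε ≤ 1) :
    Integrable (Function.uncurry (fluxProduction k ε σ j))
      ((volume.restrict (Ioo 0 T)).prod (volume : Measure Torus)) := by
  obtain ⟨L, hL⟩ := exists_log_smoothDensity_le (σ := σ) hk hk0 hε0 hε1
  have hm := fun b => measurable_smoothDensity (ε := ε) h.continuous hk b
  simp only [Function.uncurry_def, fluxProduction]
  refine integrable_finsetSum _ fun b _ => ?_
  refine (integrable_smoothFlux_prod h hk b).mul_bdd (c := L + L) ?_ (ae_of_all _ fun q => ?_)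
  · have h1 := hm b
    have h2 := hm (!b)
    exact ((h2.const_mul 2).log.sub (h1.const_mul 2).log).aestronglyMeasurable
  · exact (norm_sub_le _ _).trans (add_le_add (hL _ _ _) (hL _ _ _))

lemma measurable_velocityFisher (hσ : Continuous σ) (hk : Continuous k) :
    Measurable (Function.uncurry (velocityFisher k ε σ)) :=
  ((measurable_smoothDensity hσ hk true).sqrt.sub
    (measurable_smoothDensity hσ hk false).sqrt).pow_const 2

lemma exists_velocityFisher_le (hk : Continuous k) (hk0 : ∀ x, 0 ≤ k x) (hε0 : 0 < ε)
    (hε1 : ε ≤ 1) : ∃ L, ∀ r y, |velocityFisher k ε σ r y| ≤ L := by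
  obtain ⟨A, -, hA⟩ := exists_smoothKernel_le (ε := ε) hk
  refine ⟨A + A, fun r y => ?_⟩
  have hs : ∀ b, 0 ≤ smoothDensity k ε σ b r y ∧ smoothDensity k ε σ b r y ≤ A := fun b =>
    ⟨(by positivity : 0 ≤ ε / 2).trans (smoothDensity_ge hk hk0 hε1 b r y),
      (le_abs_self _).trans (abs_integral_le_of_abs_le _ (hA b y))⟩
  unfold velocityFisher
  rw [abs_of_nonneg (sq_nonneg _), sub_sq, Real.sq_sqrt (hs true).1, Real.sq_sqrt (hs false).1]
  have := Real.sqrt_nonneg (smoothDensity k ε σ true r y)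
  have := Real.sqrt_nonneg (smoothDensity k ε σ false r y)
  have := (hs true).2
  have := (hs false).2
  have : 0 ≤ 2 * √(smoothDensity k ε σ true r y) * √(smoothDensity k ε σ false r y) := by positivity
  linarith

lemma integrable_velocityFisher (hσ : Continuous σ) (hk : Continuous k) (hk0 : ∀ x, 0 ≤ k x)
    (hε0 : 0 < ε) (hε1 : ε ≤ 1) :
    Integrable (Function.uncurry (velocityFisher k ε σ))
      ((volume.restrict (Ioo 0 T)).prod (volume : Measure Torus)) := by
  obtain ⟨L, hL⟩ := exists_velocityFisher_le (σ := σ) hk hk0 hε0 hε1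
  exact integrable_of_measurable_of_bound (measurable_velocityFisher hσ hk) (fun q => hL q.1 q.2) _

lemma integral_log_mul_smoothRate (hσ : Continuous σ) (hk : IsC1 k k') (hk0 : ∀ x, 0 ≤ k x)
    (hε0 : 0 < ε) (hε1 : ε ≤ 1) (hj : ∀ E, MeasurableSet E → Measurable fun t => j t E) (r : ℝ) :
    ∫ y, ∑ b, Real.log (2 * smoothDensity k ε σ b r y) * smoothRate V k k' ε σ j b r y =
      ∫ y, fluxProduction k ε σ j r y := by
  obtain ⟨L, hL⟩ := exists_log_smoothDensity_le (σ := σ) hk.continuous hk0 hε0 hε1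
  obtain ⟨A, -, hA⟩ := exists_smoothKernel_le (ε := ε) hk.continuous
  obtain ⟨D, hD⟩ := exists_smoothDensityDeriv_le (ε := ε) (σ := σ) hk.1
  have hlogm : ∀ b, Measurable fun y => Real.log (2 * smoothDensity k ε σ b r y) := fun b =>
    (((measurable_smoothDensity hσ hk.continuous b).comp
      (measurable_const.prodMk measurable_id)).const_mul 2).log
  have hfi : ∀ b, Integrable (fun y => smoothFlux k ε j b r y) volume := fun b =>
    integrable_of_measurable_of_bound ((measurable_smoothFlux hj hk.continuous b).comp
      (measurable_const.prodMk measurable_id)) (fun y => abs_signedIntegral_le (j r) (hA b y)) _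
  have hdi : ∀ b, Integrable (fun y => smoothDensityDeriv k' ε σ b r y) volume := fun b =>
    integrable_of_measurable_of_bound ((measurable_smoothDensityDeriv hσ hk.1 b).comp
      (measurable_const.prodMk measurable_id)) (fun y => hD b r y) _
  have hti : ∀ b, Integrable (fun y => -(V * vel b) *
      (Real.log (2 * smoothDensity k ε σ b r y) * smoothDensityDeriv k' ε σ b r y)) volume :=
    fun b => ((hdi b).bdd_mul (hlogm b).aestronglyMeasurable
      (ae_of_all _ fun y => hL b r y)).const_mul _
  have hPi : Integrable (fun y => fluxProduction k ε σ j r y) volume := by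
    refine integrable_finsetSum _ fun b _ => (hfi b).mul_bdd (c := L + L)
      ((hlogm _).sub (hlogm _)).aestronglyMeasurable (ae_of_all _ fun y => ?_)
    exact (norm_sub_le _ _).trans (add_le_add (hL _ _ _) (hL _ _ _))
  have e : ∀ y, ∑ b, Real.log (2 * smoothDensity k ε σ b r y) * smoothRate V k k' ε σ j b r y =
      ∑ b, -(V * vel b) * (Real.log (2 * smoothDensity k ε σ b r y) *
        smoothDensityDeriv k' ε σ b r y) + fluxProduction k ε σ j r y := fun y => by
    simp only [fluxProduction, smoothRate, Fintype.sum_bool, Bool.not_true, Bool.not_false]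
    ring
  simp only [e]
  rw [integral_add (integrable_finsetSum _ fun b _ => hti b) hPi,
    integral_finsetSum _ fun b _ => hti b]
  simp only [integral_const_mul, integral_log_mul_smoothDensityDeriv hk hk0 hε0 hε1, mul_zero,
    Finset.sum_const_zero, zero_add]

/-- With `g = ½ log(u_{!b} / u_b)` one has `u_b e^g = √(u_b u_{!b})`, so the exponential terms sum
to minus the squared difference of the roots, while the linear term is half the entropy production.
-/
lemma half_fluxProduction_add_eq (hk : Continuous k) (hk0 : ∀ x, 0 ≤ k x) (hε0 : 0 < ε)
    (hε1 : ε ≤ 1) (l r : ℝ) (y : Torus) :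
    ∑ b, (smoothFlux k ε j b r y * ((Real.log (2 * smoothDensity k ε σ (!b) r y) -
      Real.log (2 * smoothDensity k ε σ b r y)) / 2) -
      l * smoothDensity k ε σ b r y * (Real.exp ((Real.log (2 * smoothDensity k ε σ (!b) r y) -
      Real.log (2 * smoothDensity k ε σ b r y)) / 2) - 1)) =
    fluxProduction k ε σ j r y / 2 + l * velocityFisher k ε σ r y := by
  have hpos : ∀ b, 0 < smoothDensity k ε σ b r y := fun b =>
    (by positivity : 0 < ε / 2).trans_le (smoothDensity_ge hk hk0 hε1 b r y)
  have hexp : ∀ b, smoothDensity k ε σ b r y *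
      Real.exp ((Real.log (2 * smoothDensity k ε σ (!b) r y) -
        Real.log (2 * smoothDensity k ε σ b r y)) / 2) =
      √(smoothDensity k ε σ b r y) * √(smoothDensity k ε σ (!b) r y) := fun b => by
    have hs := Real.sqrt_pos.2 (hpos b)
    rw [Real.log_mul two_ne_zero (hpos _).ne', Real.log_mul two_ne_zero (hpos _).ne',
      add_sub_add_left_eq_sub, sub_div, ← Real.log_sqrt (hpos _).le, ← Real.log_sqrt (hpos _).le,
      Real.exp_sub, Real.exp_log (Real.sqrt_pos.2 (hpos _)), Real.exp_log hs]
    nth_rewrite 1 [← Real.mul_self_sqrt (hpos b).le]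
    field_simp
  have e : ∀ b, l * smoothDensity k ε σ b r y *
      (Real.exp ((Real.log (2 * smoothDensity k ε σ (!b) r y) -
        Real.log (2 * smoothDensity k ε σ b r y)) / 2) - 1) =
      l * (√(smoothDensity k ε σ b r y) * √(smoothDensity k ε σ (!b) r y) -
        √(smoothDensity k ε σ b r y) * √(smoothDensity k ε σ b r y)) := fun b => by
    rw [← hexp, Real.mul_self_sqrt (hpos b).le]; ring
  simp only [e, fluxProduction, velocityFisher, Fintype.sum_bool, Bool.not_true, Bool.not_false]
  ring

/-- The inequality at a fixed time behind the a priori estimate: entropy contraction under the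
kernel, tested with the exponent `½ log(u_{!b} / u_b)`. -/
lemma ofReal_half_fluxProduction_add_le (hk : Continuous k) (hk0 : ∀ x, 0 ≤ k x)
    (hk1 : ∫ x, k x = 1) (hε0 : 0 < ε) (hε1 : ε ≤ 1) {l : ℝ} (hl : 0 ≤ l) (r : ℝ) :
    ENNReal.ofReal (∫ y, (fluxProduction k ε σ j r y / 2 + l * velocityFisher k ε σ r y)) ≤
      relEnt (j r) (ENNReal.ofReal l • (σ r : Measure Omega)) := by
  unfold relEnt
  split_ifs with hneg
  swap
  · exact le_top
  have hj : j r = (j r).toJordanDecomposition.posPart.toSignedMeasure := by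
    conv_lhs => rw [← SignedMeasure.toSignedMeasure_toJordanDecomposition (j r)]
    rw [JordanDecomposition.toSignedMeasure]
    simp [hneg]
  have hflux : ∀ b y, smoothFlux k ε j b r y =
      ∫ p, smoothKernel k ε b y p ∂(j r).toJordanDecomposition.posPart := fun b y => by
    rw [smoothFlux]
    conv_lhs => rw [hj]
    rw [VectorMeasure.integral_toSignedMeasure]
  have hdens : ∀ b y, ∫ p, smoothKernel k ε b y p ∂(ENNReal.ofReal l • (σ r : Measure Omega)) =
      l * smoothDensity k ε σ b r y := fun b y => by
    rw [integral_smul_measure, ENNReal.toReal_ofReal hl, smul_eq_mul, smoothDensity]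
  have hfin : IsFiniteMeasure (ENNReal.ofReal l • (σ r : Measure Omega)) :=
    Measure.smul_finite _ ENNReal.ofReal_ne_top
  have := ofReal_integral_smoothKernel_le_klDiv hk hk0 hk1 hε0.le hε1
    (j r).toJordanDecomposition.posPart (ENNReal.ofReal l • (σ r : Measure Omega))
    fun b y => (Real.log (2 * smoothDensity k ε σ (!b) r y) -
      Real.log (2 * smoothDensity k ε σ b r y)) / 2
  simp only [hdens, ← hflux] at this
  simpa only [half_fluxProduction_add_eq hk hk0 hε0 hε1] using this

/-- Entropy contraction with the optimal exponent, the logarithm of the smoothed density relative to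
`1/2`, for which the variational bound is an equality. -/
lemma ofReal_initial_entropy_le (hk : Continuous k) (hk0 : ∀ x, 0 ≤ k x)
    (hk1 : ∫ x, k x = 1) (hε0 : 0 < ε) (hε1 : ε ≤ 1) :
    ENNReal.ofReal (∫ y, ∑ b, klFun (2 * smoothDensity k ε σ b 0 y) / 2) ≤
      klDiv (σ 0 : Measure Omega) stationary := by
  have := ofReal_integral_smoothKernel_le_klDiv hk hk0 hk1 hε0.le hε1 (σ 0 : Measure Omega)
    stationary fun b y => Real.log (2 * smoothDensity k ε σ b 0 y)
  have e : ∀ b y, klFun (2 * smoothDensity k ε σ b 0 y) / 2 =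
      smoothDensity k ε σ b 0 y * Real.log (2 * smoothDensity k ε σ b 0 y) -
        1 / 2 * (Real.exp (Real.log (2 * smoothDensity k ε σ b 0 y)) - 1) := fun b y => by
    have hpos : 0 < 2 * smoothDensity k ε σ b 0 y := by
      have := smoothDensity_ge (σ := σ) hk hk0 hε1 b 0 y
      linarith
    rw [Real.exp_log hpos, klFun_apply]
    ring
  simp only [integral_smoothKernel_stationary hk hk1] at this
  simp only [e]
  exact this

/-- The entropy-Fisher information-rate functional inequality for the smoothed path. -/
theorem sq_mul_integral_velocityFisher_le (h : KacPath α T V R σ j) (hα : 0 < α) (hT : 0 < T)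
    (hk : IsC1 k k') (hk0 : ∀ x, 0 ≤ k x) (hk1 : ∫ x, k x = 1) (hε0 : 0 < ε) (hε1 : ε ≤ 1)
    {C : ℝ≥0} (hC : klDiv (σ 0 : Measure Omega) stationary + R ≤ C) :
    V ^ 2 * ∫ r in Ioo 0 T, ∫ y, velocityFisher k ε σ r y ≤ 2 * α * C := by
  have hkc := hk.continuous
  obtain ⟨L, hL⟩ := exists_log_smoothDensity_le (σ := σ) hkc hk0 hε0 hε1
  set H : ℝ → ℝ := fun t => ∫ y, ∑ b, klFun (2 * smoothDensity k ε σ b t y) / 2 with hH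
  set τ := (volume.restrict (Ioo 0 T)).prod (volume : Measure Torus) with hτ
  have hli : ∀ b, Integrable (Function.uncurry fun r y =>
      Real.log (2 * smoothDensity k ε σ b r y) * smoothRate V k k' ε σ j b r y) τ := fun b =>
    (integrable_smoothRate_prod h hk b).bdd_mul
      ((measurable_smoothDensity h.continuous hkc b).const_mul 2).log.aestronglyMeasurable
      (ae_of_all _ fun q => hL b q.1 q.2)
  have hcont : ∀ b t, Continuous fun y => klFun (2 * smoothDensity k ε σ b t y) / 2 :=
    fun b t => (continuous_klFun.comp (continuous_const.mul
      (isC1_integral_smoothKernel (ε := ε) hk (σ t : Measure Omega) b).continuous)).div_const 2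
  -- The balance at each point is integrated over the torus. After Fubini the transport part drops
  -- out at each time, leaving only the switching flux.
  have hbal : H T - H 0 = ∫ r in Ioo 0 T, ∫ y, fluxProduction k ε σ j r y := by
    simp only [hH]
    rw [← integral_sub (integrable_finsetSum _ fun b _ => integrable_of_continuous (hcont b T) _)
      (integrable_finsetSum _ fun b _ => integrable_of_continuous (hcont b 0) _)]
    simp only [← Finset.sum_sub_distrib, entropy_balance h hT hk hk0 hε0 hε1]
    have hs : ∀ y, (∀ b, Integrable (fun r => Real.log (2 * smoothDensity k ε σ b r y) *
        smoothRate V k k' ε σ j b r y) (volume.restrict (Ioo 0 T))) := fun y b =>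
      (integrableOn_smoothRate h hk b y).bdd_mul
        (((measurable_smoothDensity h.continuous hkc b).comp
          (measurable_id.prodMk measurable_const)).const_mul 2).log.aestronglyMeasurable
        (ae_of_all _ fun r => hL b r y)
    simp only [← integral_finsetSum _ fun b _ => hs _ b]
    rw [← integral_integral_swap (f := fun r y => ∑ b, Real.log (2 * smoothDensity k ε σ b r y) *
        smoothRate V k k' ε σ j b r y)]
    · simp only [integral_log_mul_smoothRate h.continuous hk hk0 hε0 hε1 h.measurable]
    · exact integrable_finsetSum _ fun b _ => hli b
  have hHT : 0 ≤ H T := integral_nonneg fun y => Finset.sum_nonneg fun b _ => by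
    have hpos := smoothDensity_ge (σ := σ) hkc hk0 hε1 b T y
    have := klFun_nonneg (x := 2 * smoothDensity k ε σ b T y) (by linarith)
    positivity
  set l := V ^ 2 / (2 * α) with hl
  have hl0 : 0 ≤ l := by positivity
  have hPi := integrable_fluxProduction h hkc hk0 hε0 hε1
  have hFi := integrable_velocityFisher (T := T) h.continuous hkc hk0 hε0 hε1
  have hle : ENNReal.ofReal (∫ r in Ioo 0 T, ∫ y, (fluxProduction k ε σ j r y / 2 +
      l * velocityFisher k ε σ r y)) ≤ R :=
    ((ofReal_integral_le_lintegral_ofReal _).trans (lintegral_mono fun r =>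
      ofReal_half_fluxProduction_add_le hkc hk0 hk1 hε0 hε1 hl0 r)).trans h.entropy_le
  have hsplit : ∫ r in Ioo 0 T, ∫ y, (fluxProduction k ε σ j r y / 2 +
      l * velocityFisher k ε σ r y) = (H T - H 0) / 2 +
        l * ∫ r in Ioo 0 T, ∫ y, velocityFisher k ε σ r y := by
    rw [hbal, integral_integral ((hPi.div_const 2).add (hFi.const_mul l)),
      integral_integral hPi, integral_integral hFi, ← integral_div, ← integral_const_mul]
    exact integral_add (hPi.div_const 2) (hFi.const_mul l)
  have hH0 := ofReal_initial_entropy_le (σ := σ) hkc hk0 hk1 hε0 hε1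
  have hfin : klDiv (σ 0 : Measure Omega) stationary ≠ ⊤ ∧ R ≠ ⊤ := by
    rw [← not_or, ← ENNReal.add_eq_top]
    exact (hC.trans_lt ENNReal.coe_lt_top).ne
  have h1 := ENNReal.ofReal_le_iff_le_toReal hfin.1 |>.1 hH0
  have h2 := ENNReal.ofReal_le_iff_le_toReal hfin.2 |>.1 hle
  have h3 : (klDiv (σ 0 : Measure Omega) stationary).toReal + R.toReal ≤ C := by
    rw [← ENNReal.toReal_add hfin.1 hfin.2]
    exact ENNReal.toReal_le_of_le_ofReal C.2 (by simpa using hC)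
  rw [hsplit] at h2
  -- The terminal entropy is dropped by nonnegativity, and half the initial entropy is bounded by
  -- the whole of it.
  have h4 : l * ∫ r in Ioo 0 T, ∫ y, velocityFisher k ε σ r y ≤ C := by
    have := ENNReal.toReal_nonneg (a := klDiv (σ 0 : Measure Omega) stationary)
    change H 0 ≤ _ at h1
    linarith
  rw [hl, div_mul_eq_mul_div, div_le_iff₀ (by positivity)] at h4
  linarith

end Dissipation

end KacDiffusive

namespace KacDiffusive

/-! ### From Fisher information to a quadratic bound on the flux -/

section FluxBound

variable {α T V ε M : ℝ} {R : ℝ≥0∞} {σ : ℝ → ProbabilityMeasure Omega} {j : ℝ → SignedMeasure Omega}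
  {k k' : Torus → ℝ}

lemma abs_integral_smooth_mul_le (hk : Continuous k) (hk0 : ∀ x, 0 ≤ k x) (hk1 : ∫ x, k x = 1)
    {f : Torus → ℝ} (hM : ∀ y, |f y| ≤ M) (x : Torus) : |∫ y, k (y - x) * f y| ≤ M := by
  have hi : Integrable (fun y => k (y - x)) volume := integrable_of_continuous (by fun_prop) _
  rw [← Real.norm_eq_abs]
  refine (norm_integral_le_of_norm_le (hi.mul_const M) (ae_of_all _ fun y => ?_)).trans ?_
  · rw [norm_mul, Real.norm_of_nonneg (hk0 _)]
    exact mul_le_mul_of_nonneg_left (hM y) (hk0 _)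
  · rw [integral_mul_const, integral_smooth_sub hk1, one_mul]

/-- The quadratic test expression of the smoothed path. -/
noncomputable def smoothTest (V : ℝ) (k : Torus → ℝ) (ε : ℝ) (f : Torus → ℝ) (p : Omega) : ℝ :=
  V * (1 - ε) * vel p.2 * (∫ y, k (y - p.1) * f y) -
    1 / 2 * ((1 - ε) * (∫ y, k (y - p.1) * f y ^ 2) + ε * ∫ y, f y ^ 2)

/-- Fubini moves the smoothing from the path onto the test function, so that it can later be removed
by convergence of the test functions alone. -/
lemma integral_smoothDensity_test (hk : Continuous k) (σ : ℝ → ProbabilityMeasure Omega) (r : ℝ)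
    {f : Torus → ℝ} (hf : Continuous f) :
    ∫ y, (V * f y * (smoothDensity k ε σ true r y - smoothDensity k ε σ false r y) -
      1 / 2 * f y ^ 2 * (smoothDensity k ε σ true r y + smoothDensity k ε σ false r y)) =
      ∫ p, smoothTest V k ε f p ∂(σ r : Measure Omega) := by
  have hki : ∀ b y, Integrable (smoothKernel k ε b y) (σ r : Measure Omega) := fun b y =>
    integrable_of_continuous (continuous_smoothKernel_right hk b y) _
  have hv := continuous_vel_snd
  set W : Torus → Omega → ℝ := fun y p => V * f y * ((1 - ε) * (vel p.2 * k (y - p.1))) -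
    1 / 2 * f y ^ 2 * ((1 - ε) * k (y - p.1) + ε) with hW
  have hWc : Continuous (Function.uncurry W) := by
    simp only [hW, Function.uncurry_def]
    fun_prop
  have e1 : ∀ y, V * f y * (smoothDensity k ε σ true r y - smoothDensity k ε σ false r y) -
      1 / 2 * f y ^ 2 * (smoothDensity k ε σ true r y + smoothDensity k ε σ false r y) =
      ∫ p, W y p ∂(σ r : Measure Omega) := fun y => by
    simp only [smoothDensity]
    rw [← integral_sub (hki _ _) (hki _ _), ← integral_add (hki _ _) (hki _ _),
      ← integral_const_mul, ← integral_const_mul]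
    refine (integral_sub (((hki _ _).sub (hki _ _)).const_mul _)
      (((hki _ _).add (hki _ _)).const_mul _)).symm.trans ?_
    refine integral_congr_ae (ae_of_all _ fun p => ?_)
    have s1 := sum_velInd p
    have s2 := sum_vel_mul_velInd p
    simp only [Fintype.sum_bool, vel, if_true, Bool.false_eq_true, if_false] at s1 s2
    simp only [hW, smoothKernel, Pi.sub_apply, Pi.add_apply]
    simp only [vel] at s2 ⊢
    linear_combination (V * f y * ((1 - ε) * k (y - p.1))) * s2 -
      1 / 2 * f y ^ 2 * ((1 - ε) * k (y - p.1)) * s1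
  simp only [e1]
  rw [integral_integral_swap (integrable_of_continuous hWc _)]
  refine integral_congr_ae (ae_of_all _ fun p => ?_)
  have i1 : Integrable (fun y => k (y - p.1) * f y) volume :=
    integrable_of_continuous (by fun_prop) _
  have i2 : Integrable (fun y => k (y - p.1) * f y ^ 2) volume :=
    integrable_of_continuous (by fun_prop) _
  have i3 : Integrable (fun y => f y ^ 2) volume := integrable_of_continuous (by fun_prop) _
  simp only [hW, smoothTest]
  rw [← integral_const_mul, ← integral_const_mul, ← integral_const_mul, ← integral_add
    (i2.const_mul _) (i3.const_mul _), ← integral_const_mul]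
  refine Eq.trans ?_ (integral_sub (i1.const_mul _)
    (((i2.const_mul _).add (i3.const_mul _)).const_mul _))
  refine integral_congr_ae (ae_of_all _ fun y => ?_)
  dsimp only
  ring

/-- Here `p` and `q` stand for the roots of the two densities. Factor `p² - q² = (p - q)(p + q)`,
apply Young's inequality, and use `(p + q)² ≤ 2 (p² + q²)`. -/
lemma mul_sub_le_sq_sub {p q V f : ℝ} :
    V * f * (p ^ 2 - q ^ 2) - 1 / 2 * f ^ 2 * (p ^ 2 + q ^ 2) ≤ V ^ 2 * (p - q) ^ 2 := by
  nlinarith [sq_nonneg (V * (p - q) - f * (p + q) / 2), mul_nonneg (sq_nonneg f) (sq_nonneg (p - q))]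

lemma integral_smoothTest_le (h : KacPath α T V R σ j) (hα : 0 < α) (hT : 0 < T)
    (hk : IsC1 k k') (hk0 : ∀ x, 0 ≤ k x) (hk1 : ∫ x, k x = 1) (hε0 : 0 < ε) (hε1 : ε ≤ 1)
    {C : ℝ≥0} (hC : InformationTheory.klDiv (σ 0 : Measure Omega) stationary + R ≤ C)
    {φ : ℝ → Torus → ℝ} (hφm : Measurable (Function.uncurry φ)) (hφM : ∀ t x, |φ t x| ≤ M)
    (hφc : ∀ t, Continuous (φ t)) :
    ∫ r in Ioo 0 T, ∫ p, smoothTest V k ε (φ r) p ∂(σ r : Measure Omega) ≤ 2 * α * C := by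
  have hkc := hk.continuous
  refine le_trans ?_ (sq_mul_integral_velocityFisher_le h hα hT hk hk0 hk1 hε0 hε1 hC)
  obtain ⟨A, -, hA⟩ := exists_smoothKernel_le (ε := ε) hkc
  have hd : ∀ b, Measurable (Function.uncurry (smoothDensity k ε σ b)) := fun b =>
    measurable_smoothDensity h.continuous hkc b
  have hFi := integrable_velocityFisher (T := T) h.continuous hkc hk0 hε0 hε1
  simp only [← integral_smoothDensity_test hkc σ _ (hφc _)]
  have hdi : ∀ b, Integrable (Function.uncurry (smoothDensity k ε σ b))
      ((volume.restrict (Ioo 0 T)).prod (volume : Measure Torus)) := fun b =>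
    integrable_of_measurable_of_bound (hd b)
      (fun q => abs_integral_le_of_abs_le _ (hA b q.2)) _
  have hTi : Integrable (Function.uncurry fun r y =>
      V * φ r y * (smoothDensity k ε σ true r y - smoothDensity k ε σ false r y) -
      1 / 2 * φ r y ^ 2 * (smoothDensity k ε σ true r y + smoothDensity k ε σ false r y))
      ((volume.restrict (Ioo 0 T)).prod (volume : Measure Torus)) := by
    refine Integrable.sub (((hdi true).sub (hdi false)).bdd_mul (c := |V| * M)
      (hφm.const_mul V).aestronglyMeasurable (ae_of_all _ fun q => ?_))
      (((hdi true).add (hdi false)).bdd_mul (c := 1 / 2 * M ^ 2)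
      ((hφm.pow_const 2).const_mul (1 / 2)).aestronglyMeasurable (ae_of_all _ fun q => ?_))
    · rw [norm_mul]
      exact mul_le_mul_of_nonneg_left (hφM _ _) (abs_nonneg V)
    · rw [norm_mul, norm_pow, Real.norm_of_nonneg (by norm_num : (0 : ℝ) ≤ 1 / 2)]
      gcongr
      exact hφM _ _
  rw [integral_integral hTi, integral_integral hFi, ← integral_const_mul]
  refine integral_mono hTi (hFi.const_mul _) fun q => ?_
  have hs : ∀ b, 0 ≤ smoothDensity k ε σ b q.1 q.2 := fun b =>
    (by positivity : 0 ≤ ε / 2).trans (smoothDensity_ge hkc hk0 hε1 b q.1 q.2)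
  have := mul_sub_le_sq_sub (p := √(smoothDensity k ε σ true q.1 q.2))
    (q := √(smoothDensity k ε σ false q.1 q.2)) (V := V) (f := φ q.1 q.2)
  rwa [Real.sq_sqrt (hs _), Real.sq_sqrt (hs _)] at this

/-- The quadratic bound for the flux of a path with finite initial entropy and finite rate. -/
theorem flux_quadratic_bound (h : KacPath α T V R σ j) (hα : 0 < α) (hT : 0 < T)
    {C : ℝ≥0} (hC : InformationTheory.klDiv (σ 0 : Measure Omega) stationary + R ≤ C)
    {φ : ℝ → Torus → ℝ} (hφm : Measurable (Function.uncurry φ)) (hφM : ∀ t x, |φ t x| ≤ M)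
    (hφc : ∀ t, Continuous (φ t)) :
    ∫ r in Ioo 0 T, ∫ p, (V * vel p.2 * φ r p.1 - 1 / 2 * φ r p.1 ^ 2) ∂(σ r : Measure Omega) ≤
      2 * α * C := by
  obtain ⟨k, k', hk, hk0, hk1, hlim⟩ := exists_mollifier
  have hM0 : 0 ≤ M := (abs_nonneg _).trans (hφM 0 0)
  -- The mixing weight tends to zero together with the width of the mollifier. The bound `2αC`
  -- depends on neither, so the smoothing disappears by dominated convergence.
  set e : ℕ → ℝ := fun m => 1 / ((m : ℝ) + 1) with he
  have he0 : ∀ m, 0 < e m := fun m => by positivity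
  have he1 : ∀ m, e m ≤ 1 := fun m => by
    rw [he, div_le_one (by positivity)]; linarith [(Nat.cast_nonneg m : (0 : ℝ) ≤ m)]
  have helim : Tendsto e atTop (𝓝 0) := tendsto_one_div_add_atTop_nhds_zero_nat
  have hσm := measurable_of_continuous_curve h.continuous
  have hvm := continuous_vel_snd.measurable
  have hbound : ∀ m r p, |smoothTest V (k m) (e m) (φ r) p| ≤ |V| * M + 1 / 2 * (M ^ 2 + M ^ 2) := by
    intro m r p
    have b1 := abs_integral_smooth_mul_le (hk m).continuous (hk0 m) (hk1 m) (hφM r) p.1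
    have hM2 : ∀ y, |φ r y ^ 2| ≤ M ^ 2 := fun y => by
      rw [abs_pow]; exact pow_le_pow_left₀ (abs_nonneg _) (hφM r y) 2
    have b2 := abs_integral_smooth_mul_le (hk m).continuous (hk0 m) (hk1 m) hM2 p.1
    have b3 := abs_integral_le_of_abs_le (volume : Measure Torus) hM2
    have b4 : |1 - e m| ≤ 1 := by rw [abs_le]; constructor <;> linarith [he0 m, he1 m]
    have b5 : |e m| ≤ 1 := by rw [abs_of_pos (he0 m)]; exact he1 m
    refine (abs_sub _ _).trans (add_le_add ?_ ?_)
    · rw [abs_mul, abs_mul, abs_mul, abs_vel, mul_one]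
      refine mul_le_mul ?_ b1 (abs_nonneg _) (abs_nonneg _)
      exact mul_le_of_le_one_right (abs_nonneg _) b4
    · rw [abs_mul, abs_of_pos (by norm_num : (0 : ℝ) < 1 / 2)]
      refine mul_le_mul_of_nonneg_left ((abs_add_le _ _).trans (add_le_add ?_ ?_)) (by norm_num)
      · rw [abs_mul]
        exact (mul_le_of_le_one_left (abs_nonneg _) b4).trans b2
      · rw [abs_mul]
        exact (mul_le_of_le_one_left (abs_nonneg _) b5).trans b3
  have hmeas : ∀ m, Measurable (Function.uncurry fun r p =>
      smoothTest V (k m) (e m) (φ r) p) := fun m => by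
    have c1 : Measurable fun q : (ℝ × Omega) × Torus => φ q.1.1 q.2 :=
      hφm.comp ((measurable_fst.comp measurable_fst).prodMk measurable_snd)
    have c2 : Measurable fun q : (ℝ × Omega) × Torus => k m (q.2 - q.1.2.1) :=
      (by have := (hk m).continuous; fun_prop : Continuous fun q : (ℝ × Omega) × Torus =>
        k m (q.2 - q.1.2.1)).measurable
    have m1 : Measurable fun q : ℝ × Omega => ∫ y, k m (y - q.2.1) * φ q.1 y :=
      (c2.mul c1).stronglyMeasurable.integral_prod_right'.measurable
    have m2 : Measurable fun q : ℝ × Omega => ∫ y, k m (y - q.2.1) * φ q.1 y ^ 2 :=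
      (c2.mul (c1.pow_const 2)).stronglyMeasurable.integral_prod_right'.measurable
    have m3 : Measurable fun q : ℝ × Omega => ∫ y, φ q.1 y ^ 2 :=
      (c1.pow_const 2).stronglyMeasurable.integral_prod_right'.measurable
    have m4 : Measurable fun q : ℝ × Omega => vel q.2.2 := hvm.comp measurable_snd
    exact ((m4.const_mul _).mul m1).sub (((m2.const_mul _).add (m3.const_mul _)).const_mul _)
  have hpt : ∀ r p, Tendsto (fun m => smoothTest V (k m) (e m) (φ r) p) atTop
      (𝓝 (V * vel p.2 * φ r p.1 - 1 / 2 * φ r p.1 ^ 2)) := fun r p => by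
    have t1 := hlim (φ r) (hφc r) p.1
    have t2 := hlim (fun y => φ r y ^ 2) ((hφc r).pow 2) p.1
    have t3 : Tendsto (fun m => 1 - e m) atTop (𝓝 (1 - 0)) := helim.const_sub 1
    have := (((t3.const_mul V).mul_const (vel p.2)).mul t1).sub
      (((t3.mul t2).add (helim.mul_const (∫ y, φ r y ^ 2))).const_mul (1 / 2))
    simpa [smoothTest] using! this
  refine le_of_tendsto' (tendsto_integral_of_dominated_convergence
    (fun _ => |V| * M + 1 / 2 * (M ^ 2 + M ^ 2)) (fun m => ?_) (integrable_const _)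
    (fun m => ae_of_all _ fun r => ?_) (ae_of_all _ fun r => ?_)) fun m =>
    integral_smoothTest_le h hα hT (hk m) (hk0 m) (hk1 m) (he0 m) (he1 m) hC hφm hφM hφc
  · exact (measurable_integral_curve hσm (hmeas m) (hbound m)).aestronglyMeasurable
  · exact abs_integral_le_of_abs_le _ (hbound m r)
  · exact tendsto_integral_of_dominated_convergence
      (fun _ => |V| * M + 1 / 2 * (M ^ 2 + M ^ 2))
      (fun m => ((hmeas m).comp (measurable_const.prodMk measurable_id)).aestronglyMeasurable)
      (integrable_const _) (fun m => ae_of_all _ (hbound m r)) (ae_of_all _ (hpt r))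

end FluxBound

end KacDiffusive

namespace KacDiffusive

/-! ### Elimination of the transport flux -/

section Reduction

variable {α T V : ℝ}

lemma exists_continuous_extension {X : Type*} [TopologicalSpace X] (hT : 0 ≤ T) {σ : ℝ → X}
    (h : ContinuousOn σ (Icc 0 T)) : ∃ σ' : ℝ → X, Continuous σ' ∧ EqOn σ' σ (Icc 0 T) :=
  ⟨IccExtend hT ((Icc 0 T).domRestrict σ), (continuousOn_iff_continuous_domRestrict.1 h).Icc_extend',
    fun _ ht => IccExtend_of_mem hT _ ht⟩

lemma measurable_indicator_family {X : Type*} [MeasurableSpace X] {m : ℝ → SignedMeasure X}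
    (hm : IsMeasurableFamily T m) :
    ∀ E, MeasurableSet E → Measurable fun t => (Ioo 0 T).indicator m t E := by
  intro E hE
  refine measurable_of_restrict_of_restrict_compl (s := Ioo 0 T) measurableSet_Ioo ?_ ?_
  · convert hm E hE using 1
    ext t
    simp
  · convert measurable_const (a := (0 : ℝ)) using 1
    ext t
    simp [indicator_of_notMem t.2]

lemma IsC10.continuous_deriv {φ φ' : Omega → ℝ} (h : IsC10 φ φ') : Continuous φ' :=
  continuous_prod_of_discrete_right.2 fun b => (h b).1

/-- A solution of the continuity equation with finite rate is, up to its values outside the time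
interval, a path whose transport flux is the canonical one. -/
lemma KacCE.exists_kacPath (hT : 0 < T) {σ : ℝ → ProbabilityMeasure Omega}
    {j : ℝ → SignedMeasure Omega × SignedMeasure Omega} (h : KacCE T σ j)
    (hfin : rateV α T V σ j ≠ ⊤) :
    ∃ σ' j', EqOn σ' σ (Icc 0 T) ∧ (∀ t ∈ Ioo 0 T, j' t = (j t).2) ∧
      KacPath α T V (rateV α T V σ j) σ' j' := by
  obtain ⟨σ', hσ', heq⟩ := exists_continuous_extension hT.le h.continuousOn
  have hm1 := measurable_indicator_family h.measurable_fst
  have hm2 := measurable_indicator_family h.measurable_snd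
  set j1 : ℝ → SignedMeasure Omega := (Ioo 0 T).indicator fun t => (j t).1 with hj1
  set j2 : ℝ → SignedMeasure Omega := (Ioo 0 T).indicator fun t => (j t).2 with hj2
  have e1 : ∀ t ∈ Ioo 0 T, j1 t = (j t).1 := fun t ht => indicator_of_mem ht _
  have e2 : ∀ t ∈ Ioo 0 T, j2 t = (j t).2 := fun t ht => indicator_of_mem ht _
  have hrate : rateV α T V σ j = ∫⁻ t in Ioo (0 : ℝ) T, lagrangian α V (σ t) (j t) := if_pos h
  have hvm := continuous_vel_snd.measurable
  refine ⟨σ', j2, heq, e2, hσ', hm2, ?_, ?_, ?_⟩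
  · refine (setLIntegral_mono' measurableSet_Ioo fun t ht => ?_).trans_lt h.finite_variation
    rw [e2 t ht]
    exact le_add_self
  · intro φ φ' hφ s t hs hst ht
    rw [heq ⟨hs.trans hst, ht⟩, heq ⟨hs, hst.trans ht⟩, h.weak_eq φ φ' hφ s t hs hst ht]
    have hφ'c := hφ.continuous_deriv
    obtain ⟨B, hB0, hB⟩ := exists_abs_le_of_continuous hφ'c
    -- The times at which the transport flux is visibly not the canonical one for this test
    -- function. The Lagrangian is infinite there, so finite rate makes the set null; it may depend
    -- on `φ`, because the weak equation is checked for one test function at a time.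
    set A : Set ℝ := {r | ∫ᵛ p, φ' p ∂<•(j1 r) ≠
      V * ∫ p, vel p.2 * φ' p ∂(σ' r : Measure Omega)} with hA
    have hAm : MeasurableSet A := by
      refine (measurableSet_eq_fun ?_ ?_).compl
      · exact measurable_signedIntegral hm1 (F := fun _ => φ')
          (hφ'c.measurable.comp _root_.measurable_snd) fun _ => hB
      · refine (measurable_integral_curve (measurable_of_continuous_curve hσ')
          (F := fun _ p => vel p.2 * φ' p) (M := B)
          ((hvm.mul hφ'c.measurable).comp _root_.measurable_snd) fun _ p => ?_).const_mul V
        rw [abs_mul, abs_vel, one_mul]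
        exact hB p
    have hlag : ∀ r ∈ Ioo 0 T, r ∈ A → lagrangian α V (σ r) (j r) = ⊤ := by
      intro r hr hrA
      unfold lagrangian
      refine if_neg fun h1 => hrA ?_
      rw [e1 r hr, h1, heq ⟨hr.1.le, hr.2.le⟩,
        signedIntegral_withDensity _ hφ'c.measurable hB (hvm.const_mul V)
          (integrable_of_continuous (continuous_vel_snd.const_mul V) _), ← integral_const_mul]
      congr 1; ext p; ring
    have hnull : volume.restrict (Ioo 0 T) A = 0 := by
      by_contra hne
      refine hfin ?_
      rw [hrate, ← top_le_iff, ← ENNReal.top_mul hne, ← lintegral_indicator_const hAm]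
      refine setLIntegral_mono' measurableSet_Ioo fun r hr => ?_
      by_cases hrA : r ∈ A
      · rw [hlag r hr hrA]; exact le_top
      · simp [hrA]
    refine intervalIntegral.integral_congr_ae ?_
    rw [measure_eq_zero_iff_ae_notMem, ae_restrict_iff' measurableSet_Ioo] at hnull
    filter_upwards [hnull, (by simp [ae_iff] : ∀ᵐ r : ℝ, r ≠ T)] with r hr hrT hrm
    rw [uIoc_of_le hst] at hrm
    have hrI : r ∈ Ioo 0 T := ⟨hs.trans_lt hrm.1, lt_of_le_of_ne (hrm.2.trans ht) hrT⟩
    have := hr hrI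
    simp only [hA, mem_ofPred_eq, not_not] at this
    rw [← this, e1 r hrI, e2 r hrI]
  · rw [hrate]
    refine setLIntegral_mono' measurableSet_Ioo fun r hr => ?_
    rw [e2 r hr, heq ⟨hr.1.le, hr.2.le⟩]
    unfold lagrangian
    split_ifs
    · exact le_rfl
    · exact le_top

end Reduction

/-! ### Integrals against densities, fluxes and derived fluxes -/

section Slices

lemma signedIntegral_slice (b : Bool) (m : SignedMeasure Omega) {f : Torus → ℝ}
    (hf : Continuous f) : ∫ᵛ x, f x ∂<•(slice b m) = ∫ᵛ p, velInd b p * f p.1 ∂<•m := by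
  obtain ⟨B, -, hB⟩ := exists_abs_le_of_continuous hf
  have hs : MeasurableSet {p : Omega | p.2 = b} := measurable_snd (measurableSet_singleton b)
  rw [slice, VectorMeasure.integral_map measurable_fst hf.measurable.aestronglyMeasurable
    (integrable_of_measurable_of_bound (hf.measurable.comp measurable_fst) (fun p => hB p.1) _),
    ← VectorMeasure.integral_indicator hs]
  congr 1
  ext p
  by_cases hp : p.2 = b <;> simp [velInd, hp]

lemma signedIntegral_flux (V : ℝ) (σ : ProbabilityMeasure Omega) {f : Torus → ℝ}
    (hf : Continuous f) :
    ∫ᵛ x, f x ∂<•(flux V σ) = V * ∫ p, vel p.2 * f p.1 ∂(σ : Measure Omega) := by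
  obtain ⟨B, -, hB⟩ := exists_abs_le_of_continuous hf
  have hi : ∀ m : SignedMeasure Torus, m.Integrable f := fun m =>
    integrable_of_measurable_of_bound hf.measurable hB _
  have hv := fun b => continuous_velInd b
  rw [flux, VectorMeasure.integral_smul_vectorMeasure,
    VectorMeasure.integral_finsetSum_vectorMeasure fun b _ => hi _]
  simp only [VectorMeasure.integral_smul_vectorMeasure, signedIntegral_slice _ _ hf,
    VectorMeasure.integral_toSignedMeasure, smul_eq_mul, ← integral_const_mul]
  rw [← integral_finsetSum _ fun b _ => integrable_of_continuous (by fun_prop) _,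
    ← integral_const_mul]
  refine integral_congr_ae (ae_of_all _ fun p => ?_)
  dsimp only
  rw [← sum_vel_mul_velInd p, Finset.sum_mul]
  congr 1
  exact Finset.sum_congr rfl fun b _ => (mul_assoc _ _ _).symm

lemma signedIntegral_derivedFlux (V : ℝ) (j : SignedMeasure Omega × SignedMeasure Omega)
    {f : Torus → ℝ} (hf : Continuous f) :
    ∫ᵛ x, f x ∂<•(derivedFlux V j) = ∫ᵛ p, vel p.2 / V * f p.1 ∂<•j.2 := by
  obtain ⟨B, -, hB⟩ := exists_abs_le_of_continuous hf
  have hi : ∀ m : SignedMeasure Torus, m.Integrable f := fun m =>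
    integrable_of_measurable_of_bound hf.measurable hB _
  have hv := fun b => continuous_velInd b
  rw [derivedFlux, VectorMeasure.integral_finsetSum_vectorMeasure fun b _ => hi _]
  simp only [VectorMeasure.integral_smul_vectorMeasure, signedIntegral_slice _ _ hf,
    ← VectorMeasure.integral_fun_smul]
  have hi2 : ∀ b, j.2.Integrable fun p => (vel b / V) • (velInd b p * f p.1) := fun b =>
    integrable_of_continuous (by fun_prop) _
  rw [Fintype.sum_bool, ← VectorMeasure.integral_fun_add (hi2 _) (hi2 _)]
  congr 1; ext p
  have := sum_vel_mul_velInd p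
  rw [Fintype.sum_bool] at this
  rw [← this, smul_eq_mul, smul_eq_mul]
  ring

lemma integral_density (σ : ProbabilityMeasure Omega) {f : Torus → ℝ} (hf : Continuous f) :
    ∫ x, f x ∂(density σ : Measure Torus) = ∫ p, f p.1 ∂(σ : Measure Omega) := by
  rw [density, ProbabilityMeasure.toMeasure_map,
    integral_map measurable_fst.aemeasurable hf.aestronglyMeasurable]

end Slices

/-! ### Measures on space-time and extension by zero in time -/

section SpaceTime

variable {T : ℝ}

instance isFiniteMeasure_timeMeasure : IsFiniteMeasure (timeMeasure T) := by
  refine ⟨?_⟩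
  rw [timeMeasure, comap_subtype_coe_apply measurableSet_Ioo, image_univ,
    Subtype.range_coe, Real.volume_Ioo]
  exact ENNReal.ofReal_lt_top

lemma integral_timeMeasure (f : ℝ → ℝ) : ∫ t, f t ∂(timeMeasure T) = ∫ t in Ioo 0 T, f t :=
  integral_subtype_comap measurableSet_Ioo f

/-- Extension by zero of a function of time and space to all times. -/
noncomputable def extendTime (f : Ioo (0 : ℝ) T × Torus → ℝ) (t : ℝ) (x : Torus) : ℝ :=
  open scoped Classical in if h : t ∈ Ioo 0 T then f (⟨t, h⟩, x) else 0

lemma extendTime_coe (f : Ioo (0 : ℝ) T × Torus → ℝ) (t : Ioo (0 : ℝ) T) (x : Torus) :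
    extendTime f t x = f (t, x) := dif_pos t.2

lemma abs_extendTime_le {f : Ioo (0 : ℝ) T × Torus → ℝ} {M : ℝ} (hM0 : 0 ≤ M)
    (hM : ∀ z, |f z| ≤ M) (t : ℝ) (x : Torus) : |extendTime f t x| ≤ M := by
  unfold extendTime
  split_ifs
  · exact hM _
  · simpa

lemma continuous_extendTime {f : Ioo (0 : ℝ) T × Torus → ℝ} (hf : Continuous f) (t : ℝ) :
    Continuous (extendTime f t) := by
  unfold extendTime
  split_ifs with h
  · exact hf.comp (Continuous.prodMk_right _)
  · exact continuous_const

lemma measurable_extendTime {f : Ioo (0 : ℝ) T × Torus → ℝ} (hf : Measurable f) :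
    Measurable (Function.uncurry (extendTime f)) := by
  refine measurable_of_restrict_of_restrict_compl (s := Prod.fst ⁻¹' Ioo 0 T)
    (measurable_fst measurableSet_Ioo) ?_ ?_
  · have : Measurable fun z : (Prod.fst ⁻¹' Ioo (0 : ℝ) T : Set (ℝ × Torus)) =>
        ((⟨z.1.1, z.2⟩, z.1.2) : Ioo (0 : ℝ) T × Torus) :=
      (measurable_fst.comp measurable_subtype_coe).subtype_mk.prodMk
        (measurable_snd.comp measurable_subtype_coe)
    convert hf.comp this using 1
    ext z
    exact dif_pos z.2
  · convert measurable_const (a := (0 : ℝ)) using 1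
    ext z
    exact dif_neg z.2

/-- Rewriting the space-time measure with a Markov kernel gives access to Fubini and to finiteness.
-/
lemma spaceTime_eq_compProd {ρ : ℝ → ProbabilityMeasure Torus}
    (hρ : Measurable fun t : Ioo (0 : ℝ) T => (ρ t : Measure Torus)) :
    spaceTime T ρ = (timeMeasure T).compProd
      (⟨fun t : Ioo (0 : ℝ) T => (ρ t : Measure Torus), hρ⟩ : ProbabilityTheory.Kernel _ _) := by
  have : ProbabilityTheory.IsMarkovKernel
    (⟨fun t : Ioo (0 : ℝ) T => (ρ t : Measure Torus), hρ⟩ : ProbabilityTheory.Kernel _ _) :=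
    ⟨fun t => inferInstanceAs (IsProbabilityMeasure (ρ t : Measure Torus))⟩
  rw [Measure.compProd_eq_comp_prod, spaceTime]
  congr 1
  ext t : 1
  rw [ProbabilityTheory.Kernel.prod_apply, ProbabilityTheory.Kernel.id_apply, Measure.dirac_prod]
  rfl

lemma measurable_restrict_curve (hT : 0 ≤ T) {ρ : ℝ → ProbabilityMeasure Torus}
    (hρ : ContinuousOn ρ (Icc 0 T)) :
    Measurable fun t : Ioo (0 : ℝ) T => (ρ t : Measure Torus) := by
  obtain ⟨ρ', hρ', heq⟩ := exists_continuous_extension hT hρ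
  have := (measurable_of_continuous_curve hρ').comp (measurable_subtype_coe (p := (· ∈ Ioo 0 T)))
  convert this using 2 with t
  exact congrArg _ (heq (Ioo_subset_Icc_self t.2)).symm

lemma isFiniteMeasure_spaceTime (hT : 0 ≤ T) {ρ : ℝ → ProbabilityMeasure Torus}
    (hρ : ContinuousOn ρ (Icc 0 T)) : IsFiniteMeasure (spaceTime T ρ) := by
  have hm := measurable_restrict_curve hT hρ
  have : ProbabilityTheory.IsMarkovKernel
    (⟨fun t : Ioo (0 : ℝ) T => (ρ t : Measure Torus), hm⟩ : ProbabilityTheory.Kernel _ _) :=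
    ⟨fun t => inferInstanceAs (IsProbabilityMeasure (ρ t : Measure Torus))⟩
  rw [spaceTime_eq_compProd hm]
  infer_instance

lemma integral_spaceTime (hT : 0 ≤ T) {ρ : ℝ → ProbabilityMeasure Torus}
    (hρ : ContinuousOn ρ (Icc 0 T)) {f : Ioo (0 : ℝ) T × Torus → ℝ}
    (hf : Integrable f (spaceTime T ρ)) :
    ∫ z, f z ∂(spaceTime T ρ) = ∫ t, ∫ x, f (t, x) ∂(ρ t : Measure Torus) ∂(timeMeasure T) := by
  have hm := measurable_restrict_curve hT hρ
  have : ProbabilityTheory.IsMarkovKernel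
    (⟨fun t : Ioo (0 : ℝ) T => (ρ t : Measure Torus), hm⟩ : ProbabilityTheory.Kernel _ _) :=
    ⟨fun t => inferInstanceAs (IsProbabilityMeasure (ρ t : Measure Torus))⟩
  rw [spaceTime_eq_compProd hm] at hf ⊢
  exact Measure.integral_compProd hf

end SpaceTime

end KacDiffusive

namespace KacDiffusive

/-! ### Time cutoffs and integration by parts in time -/

section Cutoff

/-- Smooth functions with compact support in an open interval that increase to its indicator. -/
lemma exists_cutoff {s t : ℝ} (hst : s < t) : ∃ χ : ℕ → ℝ → ℝ,
    (∀ m, ContDiff ℝ 1 (χ m)) ∧ (∀ m, HasCompactSupport (χ m)) ∧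
    (∀ m, tsupport (χ m) ⊆ Ioo s t) ∧ (∀ m r, 0 ≤ χ m r ∧ χ m r ≤ 1) ∧
    ∀ r, Tendsto (fun m => χ m r) atTop (𝓝 ((Ioo s t).indicator (fun _ => 1) r)) := by
  have hh : 0 < (t - s) / 2 := by linarith
  -- Both radii increase to the half-length of the interval. The offset `3` makes the inner radius
  -- positive already at `m = 0`.
  let β : ∀ m : ℕ, ContDiffBump ((s + t) / 2) := fun m =>
    { rIn := (t - s) / 2 * (1 - 2 / (m + 3))
      rOut := (t - s) / 2 * (1 - 1 / (m + 3))
      rIn_pos := by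
        refine mul_pos hh ?_
        rw [sub_pos, div_lt_one (by positivity)]
        linarith [(Nat.cast_nonneg m : (0 : ℝ) ≤ m)]
      rIn_lt_rOut := by
        refine mul_lt_mul_of_pos_left ?_ hh
        have : (1 : ℝ) / (m + 3) < 2 / (m + 3) := by gcongr; norm_num
        linarith }
  have hsub : ∀ m, tsupport (β m) ⊆ Ioo s t := fun m => by
    rw [(β m).tsupport_eq]
    intro r hr
    rw [Metric.mem_closedBall, Real.dist_eq] at hr
    have h1 : (β m).rOut < (t - s) / 2 := by
      have : (0 : ℝ) < 1 / (m + 3) := by positivity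
      change (t - s) / 2 * (1 - 1 / (m + 3)) < _
      nlinarith
    have := abs_lt.1 (hr.trans_lt h1)
    constructor <;> linarith [this.1, this.2]
  refine ⟨fun m => β m, fun m => (β m).contDiff, fun m => (β m).hasCompactSupport, hsub,
    fun m r => ⟨(β m).nonneg, (β m).le_one⟩, fun r => ?_⟩
  by_cases hr : r ∈ Ioo s t
  · rw [indicator_of_mem hr]
    have hlim : Tendsto (fun m : ℕ => (t - s) / 2 * (1 - 2 / ((m : ℝ) + 3))) atTop
        (𝓝 ((t - s) / 2 * (1 - 0))) := by
      refine (Tendsto.const_sub 1 ?_).const_mul _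
      exact tendsto_const_nhds.div_atTop
        (tendsto_natCast_atTop_atTop.atTop_add tendsto_const_nhds)
    have hd : |r - (s + t) / 2| < (t - s) / 2 * (1 - 0) := by
      rw [abs_lt]; constructor <;> linarith [hr.1, hr.2]
    refine tendsto_const_nhds.congr' ?_
    filter_upwards [hlim.eventually (lt_mem_nhds hd)] with m hm
    refine ((β m).one_of_mem_closedBall ?_).symm
    rw [Metric.mem_closedBall, Real.dist_eq]
    exact hm.le
  · rw [indicator_of_notMem hr]
    refine tendsto_const_nhds.congr fun m => ?_
    by_contra hne
    exact hr (hsub m (subset_tsupport _ (Ne.symm hne)))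

lemma integral_mul_eq_neg_integral_deriv_mul {f U χ : ℝ → ℝ} {T : ℝ} (hT : 0 ≤ T)
    (hf : IntervalIntegrable f volume 0 T)
    (hU : ∀ t ∈ Icc 0 T, U t - U 0 = ∫ r in (0 : ℝ)..t, f r) (hχ : ContDiff ℝ 1 χ)
    (h0 : χ 0 = 0) (h1 : χ T = 0) :
    ∫ r in (0 : ℝ)..T, χ r * f r = -∫ r in (0 : ℝ)..T, deriv χ r * U r := by
  set W : ℝ → ℝ := fun t => U 0 + ∫ r in (0 : ℝ)..t, f r with hW
  have hUW : ∀ t ∈ Icc 0 T, U t = W t := fun t ht => by simp only [hW]; linarith [hU t ht]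
  have hm : (0 : ℝ) ∈ uIcc 0 T := left_mem_uIcc
  have hWac : AbsolutelyContinuousOnInterval W 0 T :=
    (LipschitzOnWith.absolutelyContinuousOnInterval (K := 0)
      (LipschitzWith.const (U 0)).lipschitzOnWith).fun_add
      (hf.absolutelyContinuousOnInterval_intervalIntegral hm)
  have hχac : AbsolutelyContinuousOnInterval χ 0 T :=
    hχ.contDiffOn.absolutelyContinuousOnInterval
  have h := hχac.integral_mul_deriv_eq_deriv_mul hWac
  rw [h0, h1, zero_mul, zero_mul, sub_zero, zero_sub] at h
  have e1 : ∫ r in (0 : ℝ)..T, χ r * f r = ∫ r in (0 : ℝ)..T, χ r * deriv W r := by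
    refine intervalIntegral.integral_congr_ae ?_
    filter_upwards [hf.ae_hasDerivAt_integral] with x hx hxm
    rw [((hx (uIoc_subset_uIcc hxm) 0 hm).const_add (U 0)).deriv]
  rw [e1, h]
  congr 1
  refine intervalIntegral.integral_congr fun r hr => ?_
  rw [uIcc_of_le hT] at hr
  simp only [hUW r hr]

end Cutoff

/-! ### Time-localized flux bounds and equicontinuity -/

section PathEstimates

variable {α T V : ℝ} {R : ℝ≥0∞} {σ : ℝ → ProbabilityMeasure Omega} {j : ℝ → SignedMeasure Omega}
  {ψ ψ' : Torus → ℝ}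

lemma isC10_comp_fst (hψ : IsC1 ψ ψ') : IsC10 (fun p => ψ p.1) fun p => ψ' p.1 := fun _ => hψ

lemma isC10_vel_mul (hψ : IsC1 ψ ψ') :
    IsC10 (fun p => vel p.2 * ψ p.1) fun p => vel p.2 * ψ' p.1 := fun b => hψ.const_mul (vel b)

/-- The flux of a path tested against a function of space. -/
noncomputable def fluxTest (V : ℝ) (σ : ℝ → ProbabilityMeasure Omega) (f : Torus → ℝ) (r : ℝ) : ℝ :=
  V * ∫ p, vel p.2 * f p.1 ∂(σ r : Measure Omega)

lemma continuous_fluxTest (hσ : Continuous σ) {f : Torus → ℝ} (hf : Continuous f) :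
    Continuous (fluxTest V σ f) :=
  (continuous_integral_of_continuous_curve hσ
    (continuous_vel_snd.mul (hf.comp continuous_fst))).const_mul V

lemma KacPath.integral_sub_eq (h : KacPath α T V R σ j) (hψ : IsC1 ψ ψ') {s t : ℝ} (hs : 0 ≤ s)
    (hst : s ≤ t) (ht : t ≤ T) :
    ∫ p, ψ p.1 ∂(σ t : Measure Omega) - ∫ p, ψ p.1 ∂(σ s : Measure Omega) =
      ∫ r in Ioo s t, fluxTest V σ ψ' r := by
  rw [h.weak_eq _ _ (isC10_comp_fst hψ) s t hs hst ht, intervalIntegral.integral_of_le hst,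
    integral_Ioc_eq_integral_Ioo]
  simp [reversal, fluxTest]

lemma setIntegral_indicator_mul {s t : ℝ} (hs : 0 ≤ s) (ht : t ≤ T) (f : ℝ → ℝ) :
    ∫ r in Ioo 0 T, (Ioo s t).indicator (fun _ => 1) r * f r = ∫ r in Ioo s t, f r := by
  have : (fun r => (Ioo s t).indicator (fun _ => (1 : ℝ)) r * f r) = (Ioo s t).indicator f := by
    ext r
    by_cases hr : r ∈ Ioo s t <;> simp [hr]
  rw [this, setIntegral_indicator measurableSet_Ioo,
    inter_eq_right.2 (Ioo_subset_Ioo hs ht)]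

/-- Time-localized control of the flux. -/
lemma KacPath.abs_integral_fluxTest_le (h : KacPath α T V R σ j) (hα : 0 < α) (hT : 0 < T)
    {C : ℝ≥0} (hC : InformationTheory.klDiv (σ 0 : Measure Omega) stationary + R ≤ C)
    {f : Torus → ℝ} (hf : Continuous f) {B : ℝ} (hB : ∀ x, |f x| ≤ B) {θ : ℝ → ℝ}
    (hθ : Measurable θ) (hθ1 : ∀ r, |θ r| ≤ 1) {L : ℝ} (hL : 0 < L) :
    L * |∫ r in Ioo 0 T, θ r * fluxTest V σ f r| ≤
      2 * α * C + 1 / 2 * L ^ 2 * B ^ 2 * ∫ r in Ioo 0 T, θ r ^ 2 := by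
  have hB0 : 0 ≤ B := (abs_nonneg _).trans (hB 0)
  -- The quadratic bound is applied to `c L θ(r) f(x)`. The sign `c` produces the absolute value,
  -- and the free scale `L` trades the constant `2αC` against the size of `θ` in `L²`.
  have key : ∀ c : ℝ, |c| = 1 → L * (c * ∫ r in Ioo 0 T, θ r * fluxTest V σ f r) ≤
      2 * α * C + 1 / 2 * L ^ 2 * B ^ 2 * ∫ r in Ioo 0 T, θ r ^ 2 := fun c hc => by
    have hφm : Measurable (Function.uncurry fun r x => c * L * θ r * f x) :=
      ((hθ.comp measurable_fst).const_mul (c * L)).mul (hf.measurable.comp measurable_snd)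
    have hφM : ∀ r x, |c * L * θ r * f x| ≤ L * B := fun r x => by
      rw [abs_mul, abs_mul, abs_mul, hc, one_mul, abs_of_pos hL]
      exact mul_le_mul (mul_le_of_le_one_right hL.le (hθ1 r)) (hB x) (abs_nonneg _) hL.le
    have hb := flux_quadratic_bound h hα hT hC hφm hφM fun t => by fun_prop
    have hcf : Continuous fun r => ∫ p, f p.1 ^ 2 ∂(σ r : Measure Omega) :=
      continuous_integral_of_continuous_curve h.continuous (f := fun p : Omega => f p.1 ^ 2)
        (by fun_prop)
    have hf2 : ∀ r, |∫ p, f p.1 ^ 2 ∂(σ r : Measure Omega)| ≤ B ^ 2 := fun r =>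
      abs_integral_le_of_abs_le _ fun p => by
        rw [abs_pow]; exact pow_le_pow_left₀ (abs_nonneg _) (hB p.1) 2
    have hθ2 : ∀ r, |θ r ^ 2| ≤ 1 := fun r => by
      rw [abs_pow]; exact pow_le_one₀ (abs_nonneg _) (hθ1 r)
    have hv := continuous_vel_snd
    have e : ∀ r, ∫ p, (V * vel p.2 * (c * L * θ r * f p.1) - 1 / 2 * (c * L * θ r * f p.1) ^ 2)
        ∂(σ r : Measure Omega) = L * c * (θ r * fluxTest V σ f r) -
        1 / 2 * L ^ 2 * (θ r ^ 2 * ∫ p, f p.1 ^ 2 ∂(σ r : Measure Omega)) := fun r => by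
      have hc2 : c ^ 2 = 1 := by rw [← sq_abs, hc, one_pow]
      rw [fluxTest, ← integral_const_mul, ← integral_const_mul, ← integral_const_mul,
        ← integral_const_mul, ← integral_const_mul, ← integral_sub
        (integrable_of_continuous (by fun_prop) _) (integrable_of_continuous (by fun_prop) _)]
      congr 1; ext p
      linear_combination (-1 / 2 * L ^ 2 * θ r ^ 2 * f p.1 ^ 2) * hc2
    simp only [e] at hb
    have hfl : IntegrableOn (fluxTest V σ f) (Ioo 0 T) :=
      ((continuous_fluxTest h.continuous hf).continuousOn.integrableOn_Icc).mono_set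
        Ioo_subset_Icc_self
    have i1 : IntegrableOn (fun r => θ r * fluxTest V σ f r) (Ioo 0 T) :=
      hfl.bdd_mul hθ.aestronglyMeasurable (ae_of_all _ hθ1)
    have i2 : IntegrableOn (fun r => θ r ^ 2) (Ioo 0 T) :=
      integrable_of_measurable_of_bound (hθ.pow_const 2) hθ2 _
    have i3 : IntegrableOn (fun r => θ r ^ 2 * ∫ p, f p.1 ^ 2 ∂(σ r : Measure Omega)) (Ioo 0 T) :=
      i2.mul_bdd (c := B ^ 2) hcf.aestronglyMeasurable (ae_of_all _ hf2)
    rw [integral_sub (i1.const_mul _) (i3.const_mul _), integral_const_mul,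
      integral_const_mul] at hb
    have hm : ∫ r in Ioo 0 T, θ r ^ 2 * ∫ p, f p.1 ^ 2 ∂(σ r : Measure Omega) ≤
        B ^ 2 * ∫ r in Ioo 0 T, θ r ^ 2 := by
      rw [← integral_const_mul]
      refine integral_mono i3 (i2.const_mul _) fun r => ?_
      dsimp only
      rw [mul_comm]
      exact mul_le_mul_of_nonneg_right ((le_abs_self _).trans (hf2 r)) (sq_nonneg _)
    have := mul_le_mul_of_nonneg_left hm (by positivity : 0 ≤ 1 / 2 * L ^ 2)
    linarith
  rcases abs_cases (∫ r in Ioo 0 T, θ r * fluxTest V σ f r) with ⟨h1, -⟩ | ⟨h1, -⟩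
  · have := key 1 abs_one
    rwa [one_mul, ← h1] at this
  · have := key (-1) (by simp)
    rwa [neg_one_mul, ← h1] at this

/-- The localized bound with `θ` the indicator of `(s, t)` and `L = (t - s)^(-1/2)`, which balances
its two terms. The modulus of continuity does not involve `V`. -/
lemma KacPath.abs_integral_sub_le (h : KacPath α T V R σ j) (hα : 0 < α) (hT : 0 < T)
    {C : ℝ≥0} (hC : InformationTheory.klDiv (σ 0 : Measure Omega) stationary + R ≤ C)
    (hψ : IsC1 ψ ψ') {B : ℝ} (hB : ∀ x, |ψ' x| ≤ B) {s t : ℝ} (hs : 0 ≤ s) (hst : s ≤ t)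
    (ht : t ≤ T) :
    |∫ p, ψ p.1 ∂(σ t : Measure Omega) - ∫ p, ψ p.1 ∂(σ s : Measure Omega)| ≤
      (2 * α * C + 1 / 2 * B ^ 2) * √(t - s) := by
  rcases hst.eq_or_lt with rfl | hlt
  · simp
  have hd : 0 < √(t - s) := Real.sqrt_pos.2 (sub_pos.2 hlt)
  rw [h.integral_sub_eq hψ hs hst ht, ← setIntegral_indicator_mul hs ht]
  have hb := h.abs_integral_fluxTest_le hα hT hC hψ.1 hB (θ := (Ioo s t).indicator fun _ => 1)
    (measurable_const.indicator measurableSet_Ioo)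
    (fun r => by by_cases hr : r ∈ Ioo s t <;> simp [hr]) (inv_pos.2 hd)
  have e : ∫ r in Ioo 0 T, (Ioo s t).indicator (fun _ => (1 : ℝ)) r ^ 2 = t - s := by
    have : ∀ r, (Ioo s t).indicator (fun _ => (1 : ℝ)) r ^ 2 =
        (Ioo s t).indicator (fun _ => 1) r * 1 := fun r => by
      by_cases hr : r ∈ Ioo s t <;> simp [hr]
    simp only [this]
    rw [setIntegral_indicator_mul hs ht]
    simp [hst]
  rw [e, inv_pow, Real.sq_sqrt (sub_nonneg.2 hst), inv_mul_eq_div, div_le_iff₀ hd] at hb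
  refine hb.trans_eq ?_
  congr 1
  field_simp [(sub_pos.2 hlt).ne']

end PathEstimates

end KacDiffusive

namespace KacDiffusive

/-- A sequence of paths with bounded entropy and rate whose densities, fluxes and derived fluxes
converge. -/
structure KacSequence (α T : ℝ) (V : ℕ → ℝ) (R : ℕ → ℝ≥0∞) (C : ℝ≥0)
    (σ : ℕ → ℝ → ProbabilityMeasure Omega) (j : ℕ → ℝ → SignedMeasure Omega)
    (ρ : ℝ → ProbabilityMeasure Torus) (ω J : SignedMeasure (Ioo (0 : ℝ) T × Torus)) : Prop where
  one_le : ∀ n, 1 ≤ V n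
  tendsto_atTop : Tendsto V atTop atTop
  path : ∀ n, KacPath α T (V n) (R n) (σ n) (j n)
  bound : ∀ n, InformationTheory.klDiv (σ n 0 : Measure Omega) stationary + R n ≤ C
  density : ∀ t ∈ Icc 0 T, ∀ f : Torus → ℝ, Continuous f →
    Tendsto (fun n => ∫ p, f p.1 ∂(σ n t : Measure Omega)) atTop
      (𝓝 (∫ x, f x ∂(ρ t : Measure Torus)))
  flux : ∀ f : (Ioo (0 : ℝ) T × Torus) →ᵇ ℝ,
    Tendsto (fun n => ∫ r in Ioo 0 T, fluxTest (V n) (σ n) (extendTime f r) r) atTop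
      (𝓝 (∫ᵛ z, f z ∂<•ω))
  derivedFlux : ∀ f : (Ioo (0 : ℝ) T × Torus) →ᵇ ℝ,
    Tendsto (fun n => ∫ r in Ioo 0 T, ∫ᵛ p, vel p.2 / V n * extendTime f r p.1 ∂<•(j n r)) atTop
      (𝓝 (∫ᵛ z, f z ∂<•J))

/-! ### Reduction of the hypotheses to converging sequences of paths -/

section Construction

variable {α T : ℝ}

lemma exists_kacSequence (hT : 0 < T) {V : ℕ → ℝ} {σ : ℕ → ℝ → ProbabilityMeasure Omega}
    {j : ℕ → ℝ → SignedMeasure Omega × SignedMeasure Omega} {C : ℝ≥0}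
    {ρ : ℝ → ProbabilityMeasure Torus} {ω J : SignedMeasure (Ioo (0 : ℝ) T × Torus)}
    (hV : ∀ n, 1 ≤ V n) (hVt : Tendsto V atTop atTop) (hCE : ∀ n, KacCE T (σ n) (j n))
    (hC : ∀ n, InformationTheory.klDiv (σ n 0 : Measure Omega) stationary
      + rateV α T (V n) (σ n) (j n) ≤ C)
    (hρ : ∀ t ∈ Icc 0 T, Tendsto (fun n => KacDiffusive.density (σ n t)) atTop (𝓝 (ρ t)))
    (hω : TendstoNarrowly T (fun n t => KacDiffusive.flux (V n) (σ n t)) ω)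
    (hJ : TendstoNarrowly T (fun n t => KacDiffusive.derivedFlux (V n) (j n t)) J) :
    ∃ σ' j', KacSequence α T V (fun n => rateV α T (V n) (σ n) (j n)) C σ' j' ρ ω J := by
  have hfin : ∀ n, rateV α T (V n) (σ n) (j n) ≠ ⊤ := fun n =>
    ((le_add_self.trans (hC n)).trans_lt ENNReal.coe_lt_top).ne
  choose σ' j' hσ' hj' hp using fun n => (hCE n).exists_kacPath hT (hfin n)
  refine ⟨σ', j', hV, hVt, hp, fun n => ?_, fun t ht f hf => ?_, fun f => ?_, fun f => ?_⟩
  · rw [hσ' n ⟨le_rfl, hT.le⟩]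
    exact hC n
  · have := ProbabilityMeasure.tendsto_iff_forall_integral_tendsto.1 (hρ t ht)
      (BoundedContinuousFunction.mkOfCompact ⟨f, hf⟩)
    refine this.congr fun n => ?_
    rw [hσ' n ht]
    exact integral_density _ hf
  · refine (hω f).congr fun n => ?_
    rw [← integral_timeMeasure]
    congr 1
    ext t
    rw [fluxTest, hσ' n (Ioo_subset_Icc_self t.2)]
    simp only [extendTime_coe]
    exact signedIntegral_flux _ _ (f.continuous.comp (Continuous.prodMk_right t))
  · refine (hJ f).congr fun n => ?_
    rw [← integral_timeMeasure]
    congr 1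
    ext t
    rw [hj' n t t.2]
    simp only [extendTime_coe]
    exact signedIntegral_derivedFlux _ _ (f.continuous.comp (Continuous.prodMk_right t))

end Construction

/-! ### Passage to the limit in the two moment equations -/

section LimitEquations

variable {α T : ℝ} {V : ℕ → ℝ} {R : ℕ → ℝ≥0∞} {C : ℝ≥0} {σ : ℕ → ℝ → ProbabilityMeasure Omega}
  {j : ℕ → ℝ → SignedMeasure Omega} {ρ : ℝ → ProbabilityMeasure Torus}
  {ω J : SignedMeasure (Ioo (0 : ℝ) T × Torus)} {ψ ψ' : Torus → ℝ}

/-- The product of a bounded function of time and a function of space. -/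
lemma exists_prodTest {χ : ℝ → ℝ} (hχ : Continuous χ) {A : ℝ} (hA : ∀ r, |χ r| ≤ A)
    {f : Torus → ℝ} (hf : Continuous f) :
    ∃ g : (Ioo (0 : ℝ) T × Torus) →ᵇ ℝ, ∀ z, g z = χ z.1 * f z.2 := by
  obtain ⟨B, -, hB⟩ := exists_abs_le_of_continuous hf
  refine ⟨BoundedContinuousFunction.ofNormedAddCommGroup (fun z => χ z.1 * f z.2) (by fun_prop)
    (A * B) fun z => ?_, fun z => rfl⟩
  rw [norm_mul]
  exact mul_le_mul (hA _) (hB _) (abs_nonneg _) ((abs_nonneg _).trans (hA 0))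

lemma extendTime_prodTest {χ : ℝ → ℝ} {f : Torus → ℝ} {g : (Ioo (0 : ℝ) T × Torus) →ᵇ ℝ}
    (hg : ∀ z, g z = χ z.1 * f z.2) {r : ℝ} (hr : r ∈ Ioo 0 T) (x : Torus) :
    extendTime g r x = χ r * f x := by
  rw [show extendTime g r x = g (⟨r, hr⟩, x) from extendTime_coe _ ⟨r, hr⟩ x, hg]

lemma KacSequence.tendsto_fluxTest (h : KacSequence α T V R C σ j ρ ω J) {χ : ℝ → ℝ}
    (hχ : Continuous χ) {A : ℝ} (hA : ∀ r, |χ r| ≤ A) {f : Torus → ℝ} (hf : Continuous f) :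
    Tendsto (fun n => ∫ r in Ioo 0 T, χ r * fluxTest (V n) (σ n) f r) atTop
      (𝓝 (∫ᵛ z, χ z.1 * f z.2 ∂<•ω)) := by
  obtain ⟨g, hg⟩ := exists_prodTest (T := T) hχ hA hf
  have := h.flux g
  simp only [hg] at this
  refine this.congr fun n => setIntegral_congr_fun measurableSet_Ioo fun r hr => ?_
  simp only [fluxTest, extendTime_prodTest hg hr, mul_left_comm _ (χ r), integral_const_mul]

lemma KacSequence.tendsto_derivedFlux (h : KacSequence α T V R C σ j ρ ω J) {χ : ℝ → ℝ}
    (hχ : Continuous χ) {A : ℝ} (hA : ∀ r, |χ r| ≤ A) {f : Torus → ℝ} (hf : Continuous f) :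
    Tendsto (fun n => ∫ r in Ioo 0 T, χ r * ((V n)⁻¹ * ∫ᵛ p, vel p.2 * f p.1 ∂<•(j n r))) atTop
      (𝓝 (∫ᵛ z, χ z.1 * f z.2 ∂<•J)) := by
  obtain ⟨g, hg⟩ := exists_prodTest (T := T) hχ hA hf
  have := h.derivedFlux g
  simp only [hg] at this
  refine this.congr fun n => setIntegral_congr_fun measurableSet_Ioo fun r hr => ?_
  rw [← smul_eq_mul, ← smul_eq_mul, ← VectorMeasure.integral_fun_smul,
    ← VectorMeasure.integral_fun_smul]
  congr 1; ext p
  rw [extendTime_prodTest hg hr, smul_eq_mul, smul_eq_mul]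
  ring

lemma KacSequence.tendsto_integral_density (h : KacSequence α T V R C σ j ρ ω J)
    {F : ℝ → Torus → ℝ} {M : ℝ} (hF : Measurable (Function.uncurry F)) (hM : ∀ r x, |F r x| ≤ M)
    (hFc : ∀ r, Continuous (F r)) :
    Tendsto (fun n => ∫ r in Ioo 0 T, ∫ p, F r p.1 ∂(σ n r : Measure Omega)) atTop
      (𝓝 (∫ r in Ioo 0 T, ∫ x, F r x ∂(ρ r : Measure Torus))) := by
  refine tendsto_integral_of_dominated_convergence (fun _ => M) (fun n => ?_)
    (integrable_const _) (fun n => ae_of_all _ fun r => ?_) ?_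
  · exact (measurable_integral_curve (measurable_of_continuous_curve (h.path n).continuous)
      (F := fun r p => F r p.1) (hF.comp (measurable_fst.prodMk
        (measurable_fst.comp measurable_snd))) fun r p => hM r p.1).aestronglyMeasurable
  · exact abs_integral_le_of_abs_le _ fun p => hM r p.1
  · filter_upwards [ae_restrict_mem measurableSet_Ioo] with r hr
    exact h.density r (Ioo_subset_Icc_self hr) _ (hFc r)

lemma KacSequence.abs_integral_sub_le (h : KacSequence α T V R C σ j ρ ω J) (hα : 0 < α)
    (hT : 0 < T) (hψ : IsC1 ψ ψ') {B : ℝ} (hB : ∀ x, |ψ' x| ≤ B) {s t : ℝ} (hs : 0 ≤ s)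
    (hst : s ≤ t) (ht : t ≤ T) :
    |∫ x, ψ x ∂(ρ t : Measure Torus) - ∫ x, ψ x ∂(ρ s : Measure Torus)| ≤
      (2 * α * C + 1 / 2 * B ^ 2) * √(t - s) :=
  le_of_tendsto' ((h.density t ⟨hs.trans hst, ht⟩ ψ hψ.continuous).sub
    (h.density s ⟨hs, hst.trans ht⟩ ψ hψ.continuous)).abs fun n =>
    (h.path n).abs_integral_sub_le hα hT (h.bound n) hψ hB hs hst ht

/-- Convergence is assumed only at each time, so continuity of the limit comes from the Hölder-½
bound, which survives pointwise limits. -/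
lemma KacSequence.continuousOn (h : KacSequence α T V R C σ j ρ ω J) (hα : 0 < α)
    (hT : 0 < T) : ContinuousOn ρ (Icc 0 T) := by
  refine continuousOn_of_forall_isC1 fun ψ ψ' hψ s hs => ?_
  obtain ⟨B, -, hB⟩ := exists_abs_le_of_continuous hψ.1
  rw [ContinuousWithinAt, tendsto_iff_norm_sub_tendsto_zero]
  have hlim : Tendsto (fun t => (2 * α * C + 1 / 2 * B ^ 2) * √|t - s|) (𝓝[Icc 0 T] s) (𝓝 0) := by
    have hc : Continuous fun t => (2 * α * C + 1 / 2 * B ^ 2) * √|t - s| := by fun_prop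
    have := hc.tendsto s
    rw [sub_self, abs_zero, Real.sqrt_zero, mul_zero] at this
    exact this.mono_left nhdsWithin_le_nhds
  refine squeeze_zero' (Eventually.of_forall fun _ => norm_nonneg _) ?_ hlim
  filter_upwards [self_mem_nhdsWithin] with t ht
  rw [Real.norm_eq_abs]
  rcases le_total s t with hst | hst
  · rw [abs_of_nonneg (sub_nonneg.2 hst)]
    exact h.abs_integral_sub_le hα hT hψ hB hs.1 hst ht.2
  · rw [abs_sub_comm t s, abs_of_nonneg (sub_nonneg.2 hst), abs_sub_comm]
    exact h.abs_integral_sub_le hα hT hψ hB ht.1 hst hs.2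

/-- Cutoffs in time of a signed measure on space-time converge to its restriction. -/
lemma tendsto_signedIntegral_cutoff (μ : SignedMeasure (Ioo (0 : ℝ) T × Torus)) {s t : ℝ}
    {χ : ℕ → ℝ → ℝ} (hχc : ∀ m, Continuous (χ m)) (hχ01 : ∀ m r, 0 ≤ χ m r ∧ χ m r ≤ 1)
    (hχ : ∀ r, Tendsto (fun m => χ m r) atTop (𝓝 ((Ioo s t).indicator (fun _ => 1) r)))
    {f : Torus → ℝ} (hf : Continuous f) :
    Tendsto (fun m => ∫ᵛ z, χ m z.1 * f z.2 ∂<•μ) atTop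
      (𝓝 (∫ᵛ z in {z : Ioo (0 : ℝ) T × Torus | s < z.1 ∧ z.1 < t}, f z.2 ∂<•μ)) := by
  obtain ⟨B, -, hB⟩ := exists_abs_le_of_continuous hf
  have hms : MeasurableSet {z : Ioo (0 : ℝ) T × Torus | s < z.1 ∧ z.1 < t} :=
    (measurable_subtype_coe.comp measurable_fst) measurableSet_Ioo
  rw [← VectorMeasure.integral_indicator hms]
  refine VectorMeasure.tendsto_integral_of_dominated_convergence (fun _ => B) (fun m => ?_)
    (integrable_const _) (fun m => ae_of_all _ fun z => ?_) (ae_of_all _ fun z => ?_)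
  · have := hχc m
    have hc : Continuous fun z : Ioo (0 : ℝ) T × Torus => χ m z.1 * f z.2 := by fun_prop
    exact hc.measurable.aestronglyMeasurable
  · rw [norm_mul, Real.norm_of_nonneg (hχ01 m _).1]
    exact (mul_le_of_le_one_left (norm_nonneg _) (hχ01 m _).2).trans (hB _)
  · have := (hχ z.1).mul_const (f z.2)
    convert this using 2
    by_cases hz : (z.1 : ℝ) ∈ Ioo s t
    · rw [indicator_of_mem hz, indicator_of_mem (show z ∈ {z : Ioo (0 : ℝ) T × Torus |
        s < z.1 ∧ z.1 < t} from hz), one_mul]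
    · rw [indicator_of_notMem hz, indicator_of_notMem (show z ∉ {z : Ioo (0 : ℝ) T × Torus |
        s < z.1 ∧ z.1 < t} from hz), zero_mul]

lemma tendsto_integral_cutoff {s t : ℝ} (hs : 0 ≤ s) (ht : t ≤ T)
    {χ : ℕ → ℝ → ℝ} (hχc : ∀ m, Continuous (χ m)) (hχ01 : ∀ m r, 0 ≤ χ m r ∧ χ m r ≤ 1)
    (hχ : ∀ r, Tendsto (fun m => χ m r) atTop (𝓝 ((Ioo s t).indicator (fun _ => 1) r)))
    {f : ℝ → ℝ} (hf : IntegrableOn f (Ioo 0 T)) :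
    Tendsto (fun m => ∫ r in Ioo 0 T, χ m r * f r) atTop (𝓝 (∫ r in Ioo s t, f r)) := by
  rw [← setIntegral_indicator_mul hs ht]
  refine tendsto_integral_of_dominated_convergence (fun r => ‖f r‖) (fun m => ?_)
    hf.norm (fun m => ae_of_all _ fun r => ?_) (ae_of_all _ fun r => (hχ r).mul_const _)
  · exact (hχc m).aestronglyMeasurable.mul hf.aestronglyMeasurable
  · rw [norm_mul, Real.norm_of_nonneg (hχ01 m _).1]
    exact mul_le_of_le_one_left (norm_nonneg _) (hχ01 m _).2

/-- Narrow convergence of the fluxes cannot be tested with the indicator of `(s, t)`. Continuous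
cutoffs are used instead, and the quadratic flux bound controls the replacement uniformly in `n`. -/
lemma KacSequence.torusCE (h : KacSequence α T V R C σ j ρ ω J) (hα : 0 < α) (hT : 0 < T) :
    TorusCE T ρ ω := by
  refine ⟨h.continuousOn hα hT, fun ψ ψ' hψ s t hs hst ht => ?_⟩
  rcases hst.eq_or_lt with rfl | hlt
  · have : {z : Ioo (0 : ℝ) T × Torus | s < z.1 ∧ z.1 < s} = ∅ :=
      eq_empty_of_forall_notMem fun z hz => lt_asymm hz.1 hz.2
    simp [this]
  obtain ⟨B, -, hB⟩ := exists_abs_le_of_continuous hψ.1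
  obtain ⟨χ, hχd, -, -, hχ01, hχ⟩ := exists_cutoff hlt
  have hχc := fun m => (hχd m).continuous
  have hχ1 : ∀ m r, |χ m r| ≤ 1 := fun m r => by
    rw [abs_of_nonneg (hχ01 m r).1]; exact (hχ01 m r).2
  set one : ℝ → ℝ := (Ioo s t).indicator fun _ => 1 with hone
  have hθm : ∀ m, Measurable fun r => one r - χ m r := fun m =>
    (measurable_const.indicator measurableSet_Ioo).sub (hχc m).measurable
  have hone01 : ∀ r, 0 ≤ one r ∧ one r ≤ 1 := fun r => by
    by_cases hr : r ∈ Ioo s t <;> simp [hone, hr]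
  have hθ1 : ∀ m r, |one r - χ m r| ≤ 1 := fun m r => by
    rw [abs_le]
    constructor <;> linarith [hone01 r, hχ01 m r]
  -- The replacement error is measured in `L²` of time because this is the quantity in the localized
  -- flux bound.
  have hδ : Tendsto (fun m => ∫ r in Ioo 0 T, (one r - χ m r) ^ 2) atTop (𝓝 0) := by
    have : Tendsto (fun m => ∫ r in Ioo 0 T, (one r - χ m r) ^ 2) atTop
        (𝓝 (∫ r in Ioo 0 T, (one r - one r) ^ 2)) := by
      refine tendsto_integral_of_dominated_convergence (fun _ => 1) (fun m => ?_)
        (integrable_const _) (fun m => ae_of_all _ fun r => ?_)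
        (ae_of_all _ fun r => ((hχ r).const_sub _).pow 2)
      · exact ((hθm m).pow_const 2).aestronglyMeasurable
      · rw [norm_pow]
        exact pow_le_one₀ (norm_nonneg _) (hθ1 m r)
    simpa using this
  set a := ∫ x, ψ x ∂(ρ t : Measure Torus) - ∫ x, ψ x ∂(ρ s : Measure Torus) with ha
  set b := ∫ᵛ z in {z : Ioo (0 : ℝ) T × Torus | s < z.1 ∧ z.1 < t}, ψ' z.2 ∂<•ω with hb
  have hbm := tendsto_signedIntegral_cutoff ω hχc hχ01 hχ hψ.1
  have hLm : ∀ L : ℝ, 0 < L → ∀ m, L * |a - ∫ᵛ z, χ m z.1 * ψ' z.2 ∂<•ω| ≤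
      2 * α * C + 1 / 2 * L ^ 2 * B ^ 2 * ∫ r in Ioo 0 T, (one r - χ m r) ^ 2 := by
    intro L hL m
    refine le_of_tendsto' ((((h.density t ⟨hs.trans hst, ht⟩ ψ hψ.continuous).sub
      (h.density s ⟨hs, hst.trans ht⟩ ψ hψ.continuous)).sub
      (h.tendsto_fluxTest (hχc m) (hχ1 m) hψ.1)).abs.const_mul L) fun n => ?_
    have hfl : IntegrableOn (fluxTest (V n) (σ n) ψ') (Ioo 0 T) :=
      ((continuous_fluxTest (h.path n).continuous hψ.1).continuousOn.integrableOn_Icc).mono_set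
        Ioo_subset_Icc_self
    rw [(h.path n).integral_sub_eq hψ hs hst ht, ← setIntegral_indicator_mul hs ht,
      ← integral_sub]
    · simp only [← sub_mul]
      exact (h.path n).abs_integral_fluxTest_le hα hT (h.bound n) hψ.1 hB (hθm m) (hθ1 m) hL
    · refine hfl.bdd_mul (c := 1) (measurable_const.indicator measurableSet_Ioo).aestronglyMeasurable
        (ae_of_all _ fun r => ?_)
      rw [Real.norm_of_nonneg (hone01 r).1]; exact (hone01 r).2
    · exact hfl.bdd_mul (c := 1) (hχc m).aestronglyMeasurable (ae_of_all _ (hχ1 m))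
  -- The order of limits matters: after `n → ∞`, the cutoffs converge with `L` fixed, which removes
  -- the term in `L²`. Only then is `L` taken large, which forces `a = b`.
  have hL : ∀ L : ℝ, 0 < L → L * |a - b| ≤ 2 * α * C := fun L hL => by
    have := le_of_tendsto_of_tendsto' ((hbm.const_sub a).abs.const_mul L)
      ((hδ.const_mul (1 / 2 * L ^ 2 * B ^ 2)).const_add (2 * α * C)) (hLm L hL)
    simpa using this
  by_contra hne
  have hpos : 0 < |a - b| := abs_pos.2 (sub_ne_zero.2 hne)
  have h0 : 0 ≤ 2 * α * (C : ℝ) := by positivity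
  have := hL ((2 * α * C + 1) / |a - b|) (by positivity)
  rw [div_mul_cancel₀ _ hpos.ne'] at this
  linarith

/-- The equation for the velocity moment, divided by `V`. Its time derivative is moved onto `χ` and
is of order `1/V`, so the limit keeps only the balance between `Dρ` and the derived flux. -/
lemma KacSequence.isSpaceDerivative (h : KacSequence α T V R C σ j ρ ω J) (hT : 0 < T) :
    IsSpaceDerivative T ρ ((-2 : ℝ) • J) := by
  intro χ hχ hχs hχt ψ ψ' hψ
  have hψc := hψ.continuous
  have hv := continuous_vel_snd
  obtain ⟨A, hA⟩ := hχs.exists_bound_of_continuous hχ.continuous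
  obtain ⟨A', hA'⟩ := hχs.deriv.exists_bound_of_continuous (hχ.continuous_deriv le_rfl)
  obtain ⟨B, -, hB⟩ := exists_abs_le_of_continuous hψc
  obtain ⟨B', hB'0, hB'⟩ := exists_abs_le_of_continuous hψ.1
  have h0 : χ 0 = 0 := by
    by_contra hne; exact lt_irrefl _ (hχt (subset_tsupport _ hne)).1
  have h1 : χ T = 0 := by
    by_contra hne; exact lt_irrefl _ (hχt (subset_tsupport _ hne)).2
  have hA0 : 0 ≤ A := (norm_nonneg _).trans (hA 0)
  have hlim1 : Tendsto (fun n => ∫ r in Ioo 0 T, χ r * ∫ p, ψ' p.1 ∂(σ n r : Measure Omega)) atTop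
      (𝓝 (∫ r in Ioo 0 T, χ r * ∫ x, ψ' x ∂(ρ r : Measure Torus))) := by
    simp only [← integral_const_mul]
    refine h.tendsto_integral_density (F := fun r x => χ r * ψ' x) (M := A * B') ?_
      (fun r x => ?_) fun r => hψ.1.const_mul _
    · exact ((hχ.continuous.comp continuous_fst).mul (hψ.1.comp continuous_snd)).measurable
    · rw [abs_mul]
      exact mul_le_mul (hA r) (hB' x) (abs_nonneg _) hA0
  have hlim2 := (h.tendsto_derivedFlux hχ.continuous hA hψc).const_mul 2
  have hlim3 : Tendsto (fun n => (V n)⁻¹ * -∫ r in (0 : ℝ)..T, deriv χ r *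
      ∫ p, vel p.2 * ψ p.1 ∂(σ n r : Measure Omega)) atTop (𝓝 0) := by
    refine (tendsto_inv_atTop_zero.comp h.tendsto_atTop).zero_mul_isBoundedUnder_le
      (isBoundedUnder_of ⟨A' * B * |T - 0|, fun n => ?_⟩)
    rw [Function.comp_apply, norm_neg]
    refine intervalIntegral.norm_integral_le_of_norm_le_const fun r _ => ?_
    rw [norm_mul]
    refine mul_le_mul (hA' r) (abs_integral_le_of_abs_le _ fun p => ?_) (norm_nonneg _)
      ((norm_nonneg _).trans (hA' 0))
    rw [abs_mul, abs_vel, one_mul]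
    exact hB _
  -- The test function is `v ψ(x)`: `v² = 1` turns the transport term into one in the density alone,
  -- and reversal changes the sign of `v`, which produces the factor `2`.
  have heq : ∀ n, (V n)⁻¹ * -∫ r in (0 : ℝ)..T, deriv χ r *
      ∫ p, vel p.2 * ψ p.1 ∂(σ n r : Measure Omega) =
      (∫ r in Ioo 0 T, χ r * ∫ p, ψ' p.1 ∂(σ n r : Measure Omega)) -
      2 * ∫ r in Ioo 0 T, χ r * ((V n)⁻¹ * ∫ᵛ p, vel p.2 * ψ p.1 ∂<•(j n r)) := by
    intro n
    have hVn : V n ≠ 0 := (zero_lt_one.trans_le (h.one_le n)).ne'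
    have i1 : IntegrableOn (fun r => ∫ p, ψ' p.1 ∂(σ n r : Measure Omega)) (Ioo 0 T) :=
      ((continuous_integral_of_continuous_curve (h.path n).continuous
        (f := fun p : Omega => ψ' p.1) (hψ.1.comp continuous_fst)).continuousOn.integrableOn_Icc).mono_set
        Ioo_subset_Icc_self
    have i2 : IntegrableOn (fun r => ∫ᵛ p, vel p.2 * ψ p.1 ∂<•(j n r)) (Ioo 0 T) := by
      refine integrableOn_signedIntegral (h.path n) (F := fun _ p => vel p.2 * ψ p.1) (A := B)
        ?_ fun _ p => ?_
      · exact (hv.mul (hψc.comp continuous_fst)).measurable.comp measurable_snd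
      · rw [abs_mul, abs_vel, one_mul]; exact hB _
    have hparts := integral_mul_eq_neg_integral_deriv_mul (T := T) (χ := χ)
      (f := fun r => V n * (∫ p, ψ' p.1 ∂(σ n r : Measure Omega)) -
        2 * ∫ᵛ p, vel p.2 * ψ p.1 ∂<•(j n r))
      (U := fun r => ∫ p, vel p.2 * ψ p.1 ∂(σ n r : Measure Omega)) hT.le ?_ ?_ hχ h0 h1
    · rw [← hparts, intervalIntegral.integral_of_le hT.le, integral_Ioc_eq_integral_Ioo,
        ← integral_const_mul, ← integral_const_mul, ← integral_sub]
      · congr 1; ext r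
        field_simp
      · exact i1.bdd_mul hχ.continuous.aestronglyMeasurable (ae_of_all _ hA)
      · exact ((i2.const_mul _).bdd_mul hχ.continuous.aestronglyMeasurable
          (ae_of_all _ hA)).const_mul 2
    · rw [intervalIntegrable_iff_integrableOn_Ioo_of_le hT.le]
      exact (i1.const_mul _).sub (i2.const_mul _)
    · intro t ht
      rw [(h.path n).weak_eq _ _ (isC10_vel_mul hψ) 0 t le_rfl ht.1 ht.2]
      refine intervalIntegral.integral_congr fun r _ => ?_
      rw [sub_eq_add_neg]
      congr 1
      · simp only [← mul_assoc, vel_mul_self, one_mul]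
      · rw [← neg_mul, ← smul_eq_mul, ← VectorMeasure.integral_fun_smul]
        congr 1; ext p
        simp only [reversal, vel_not, smul_eq_mul]
        ring
  have := tendsto_nhds_unique hlim3 ((hlim1.sub hlim2).congr fun n => (heq n).symm)
  rw [intervalIntegral.integral_of_le hT.le, integral_Ioc_eq_integral_Ioo,
    VectorMeasure.integral_smul_vectorMeasure, smul_eq_mul]
  linarith

end LimitEquations

end KacDiffusive

namespace KacDiffusive

/-! ### Duality lower bound for the rate at finite speed -/

section RateLowerBound

variable {α T V : ℝ} {R : ℝ≥0∞} {σ : ℝ → ProbabilityMeasure Omega} {j : ℝ → SignedMeasure Omega}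

lemma ofReal_signedIntegral_sub_le_relEnt {X : Type*} [MeasurableSpace X] (m : SignedMeasure X)
    (ν : Measure X) [IsFiniteMeasure ν] {g : X → ℝ} {B : ℝ} (hg : Measurable g)
    (hgB : ∀ x, |g x| ≤ B) :
    ENNReal.ofReal (∫ᵛ x, g x ∂<•m - ∫ x, (Real.exp (g x) - 1) ∂ν) ≤ relEnt m ν := by
  unfold relEnt
  split_ifs with hneg
  swap
  · exact le_top
  have hm : m = m.toJordanDecomposition.posPart.toSignedMeasure := by
    conv_lhs => rw [← SignedMeasure.toSignedMeasure_toJordanDecomposition m]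
    rw [JordanDecomposition.toSignedMeasure]
    simp [hneg]
  rw [InformationTheory.klDiv_eq_lintegral_klFun]
  split_ifs with hac
  swap
  · exact le_top
  have := ofReal_sub_le_lintegral_klFun hac (w := fun _ => 1) (A := 1) measurable_const
    (fun _ => zero_le_one) (fun _ => le_rfl) hg hgB
  simp only [one_mul, ENNReal.ofReal_one] at this
  have e : ∫ᵛ x, g x ∂<•m = ∫ x, g x ∂m.toJordanDecomposition.posPart := by
    conv_lhs => rw [hm]
    rw [VectorMeasure.integral_toSignedMeasure]
  rwa [e]

/-- Second-order Taylor expansion with a crude cubic remainder. At `x = v φ / V`, after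
multiplication by `V²/(2α)`, the remainder is of order `1/V`. -/
lemma exp_sub_one_le {x : ℝ} (hx : |x| ≤ 1) : Real.exp x - 1 ≤ x + x ^ 2 / 2 + |x| ^ 3 := by
  have h := (abs_le.1 (Real.exp_bound hx (n := 3) (by norm_num))).2
  simp only [Finset.sum_range_succ, Finset.sum_range_zero, Nat.factorial] at h
  norm_num at h
  have h3 : 0 ≤ |x| ^ 3 := by positivity
  linarith

lemma measurable_fluxTest (hσ : Continuous σ) {φ : ℝ → Torus → ℝ} {M : ℝ}
    (hφ : Measurable (Function.uncurry φ)) (hM : ∀ r x, |φ r x| ≤ M) :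
    Measurable fun r => fluxTest V σ (φ r) r := by
  refine (measurable_integral_curve (measurable_of_continuous_curve hσ)
    (F := fun r p => vel p.2 * φ r p.1) (M := M) ?_ fun r p => ?_).const_mul V
  · exact (continuous_vel_snd.measurable.comp measurable_snd).mul
      (hφ.comp (measurable_fst.prodMk (measurable_fst.comp measurable_snd)))
  · rw [abs_mul, abs_vel, one_mul]; exact hM _ _

lemma integrableOn_fluxTest (hσ : Continuous σ) {φ : ℝ → Torus → ℝ} {M : ℝ}
    (hφ : Measurable (Function.uncurry φ)) (hM : ∀ r x, |φ r x| ≤ M) :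
    IntegrableOn (fun r => fluxTest V σ (φ r) r) (Ioo 0 T) := by
  refine integrable_of_measurable_of_bound (M := |V| * M) (measurable_fluxTest hσ hφ hM)
    (fun r => ?_) _
  rw [fluxTest, abs_mul]
  refine mul_le_mul_of_nonneg_left (abs_integral_le_of_abs_le _ fun p => ?_) (abs_nonneg _)
  rw [abs_mul, abs_vel, one_mul]; exact hM _ _

lemma integrableOn_integral_sq (hσ : Continuous σ) {φ : ℝ → Torus → ℝ} {M : ℝ}
    (hφ : Measurable (Function.uncurry φ)) (hM : ∀ r x, |φ r x| ≤ M) :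
    IntegrableOn (fun r => ∫ p, φ r p.1 ^ 2 ∂(σ r : Measure Omega)) (Ioo 0 T) := by
  have hb : ∀ r x, |φ r x ^ 2| ≤ M ^ 2 := fun r x => by
    rw [abs_pow]; exact pow_le_pow_left₀ (abs_nonneg _) (hM r x) 2
  refine integrable_of_measurable_of_bound (M := M ^ 2) (measurable_integral_curve
    (measurable_of_continuous_curve hσ) (F := fun r p => φ r p.1 ^ 2) ?_ fun r p => hb r p.1)
    (fun r => abs_integral_le_of_abs_le _ fun p => hb r p.1) _
  exact (hφ.comp (measurable_fst.prodMk (measurable_fst.comp measurable_snd))).pow_const 2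

lemma KacPath.integral_fluxTest_sub_le (h : KacPath α T V R σ j) (hα : 0 < α) (hT : 0 < T)
    {C : ℝ≥0} (hC : InformationTheory.klDiv (σ 0 : Measure Omega) stationary + R ≤ C)
    {φ : ℝ → Torus → ℝ} {M : ℝ} (hφ : Measurable (Function.uncurry φ))
    (hM : ∀ r x, |φ r x| ≤ M) (hφc : ∀ r, Continuous (φ r)) :
    (∫ r in Ioo 0 T, fluxTest V σ (φ r) r) -
      1 / 2 * ∫ r in Ioo 0 T, ∫ p, φ r p.1 ^ 2 ∂(σ r : Measure Omega) ≤ 2 * α * C := by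
  refine (le_of_eq ?_).trans (flux_quadratic_bound h hα hT hC hφ hM hφc)
  rw [← integral_const_mul, ← integral_sub (integrableOn_fluxTest h.continuous hφ hM)
    ((integrableOn_integral_sq h.continuous hφ hM).const_mul _)]
  congr 1; ext r
  have := hφc r
  have := continuous_vel_snd
  rw [fluxTest, ← integral_const_mul, ← integral_const_mul,
    ← integral_sub (integrable_of_continuous (by fun_prop) _)
      (integrable_of_continuous (by fun_prop) _)]
  simp only [mul_assoc]

/-- Duality lower bound for the rate of a path. -/
lemma KacPath.ofReal_le_rate (h : KacPath α T V R σ j) (hα : 0 < α) (hV : 0 < V)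
    {φ : ℝ → Torus → ℝ} {M : ℝ} (hφ : Measurable (Function.uncurry φ))
    (hM : ∀ r x, |φ r x| ≤ M) (hφc : ∀ r, Continuous (φ r)) (hMV : M ≤ V) :
    ENNReal.ofReal ((∫ r in Ioo 0 T, ∫ᵛ p, vel p.2 / V * φ r p.1 ∂<•(j r)) -
      (1 / (2 * α) * (∫ r in Ioo 0 T, fluxTest V σ (φ r) r) +
        1 / (4 * α) * (∫ r in Ioo 0 T, ∫ p, φ r p.1 ^ 2 ∂(σ r : Measure Omega)) +
        ∫ _ in Ioo 0 T, M ^ 3 / (2 * α * V))) ≤ R := by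
  have hv := continuous_vel_snd
  have hg1 : ∀ r (p : Omega), |vel p.2 / V * φ r p.1| ≤ M / V := fun r p => by
    rw [abs_mul, abs_div, abs_vel, abs_of_pos hV, one_div, inv_mul_eq_div]
    exact div_le_div_of_nonneg_right (hM r p.1) hV.le
  have hgm : Measurable (Function.uncurry fun r (p : Omega) => vel p.2 / V * φ r p.1) :=
    ((hv.measurable.comp measurable_snd).div_const V).mul
      (hφ.comp (measurable_fst.prodMk (measurable_fst.comp measurable_snd)))
  have i1 := integrableOn_signedIntegral h hgm hg1
  have i2 := integrableOn_fluxTest (T := T) (V := V) h.continuous hφ hM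
  have i3 := integrableOn_integral_sq (T := T) h.continuous hφ hM
  have i4 : IntegrableOn (fun r => 1 / (2 * α) * fluxTest V σ (φ r) r +
      1 / (4 * α) * ∫ p, φ r p.1 ^ 2 ∂(σ r : Measure Omega)) (Ioo 0 T) :=
    (i2.const_mul _).add (i3.const_mul _)
  have i5 : IntegrableOn (fun r => 1 / (2 * α) * fluxTest V σ (φ r) r +
      1 / (4 * α) * (∫ p, φ r p.1 ^ 2 ∂(σ r : Measure Omega)) + M ^ 3 / (2 * α * V)) (Ioo 0 T) :=
    i4.add (integrable_const _)
  rw [← integral_const_mul, ← integral_const_mul,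
    ← integral_add (i2.const_mul _) (i3.const_mul _), ← integral_add i4 (integrable_const _),
    ← integral_sub i1 i5]
  refine (ofReal_integral_le_lintegral_ofReal _).trans ((lintegral_mono fun r => ?_).trans
    h.entropy_le)
  have : IsFiniteMeasure (ENNReal.ofReal (V ^ 2 / (2 * α)) • (σ r : Measure Omega)) :=
    Measure.smul_finite _ ENNReal.ofReal_ne_top
  -- Entropy duality with exponent `v φ / V`. What remains is the expansion of the exponential term
  -- into the flux, the square of `φ` and a cubic error; `M ≤ V` keeps the exponent in `[-1, 1]`.
  refine (ENNReal.ofReal_le_ofReal (sub_le_sub_left ?_ _)).trans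
    (ofReal_signedIntegral_sub_le_relEnt (j r) _ (hgm.comp measurable_prodMk_left) (hg1 r))
  have hφr := hφc r
  rw [integral_smul_measure, ENNReal.toReal_ofReal (by positivity), smul_eq_mul, fluxTest,
    ← integral_const_mul, ← integral_const_mul, ← integral_const_mul, ← integral_const_mul,
    ← integral_add (integrable_of_continuous (by fun_prop) _)
      (integrable_of_continuous (by fun_prop) _)]
  have hconst : M ^ 3 / (2 * α * V) = ∫ _, M ^ 3 / (2 * α * V) ∂(σ r : Measure Omega) := by simp
  rw [hconst, ← integral_add (integrable_of_continuous (by fun_prop) _) (integrable_const _)]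
  refine integral_mono (integrable_of_continuous ?_ _) (integrable_of_continuous ?_ _) fun p => ?_
  · exact (((hv.div_const V).mul (hφr.comp continuous_fst)).rexp.sub continuous_const).const_mul _
  · fun_prop
  · dsimp only
    have hx : |vel p.2 / V * φ r p.1| ≤ 1 := (hg1 r p).trans ((div_le_one hV).2 hMV)
    have he := exp_sub_one_le hx
    have h3 : |vel p.2 / V * φ r p.1| ^ 3 ≤ (M / V) ^ 3 :=
      pow_le_pow_left₀ (abs_nonneg _) (hg1 r p) 3
    have hsq : vel p.2 ^ 2 = 1 := by rw [sq, vel_mul_self]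
    calc V ^ 2 / (2 * α) * (Real.exp (vel p.2 / V * φ r p.1) - 1)
        ≤ V ^ 2 / (2 * α) * (vel p.2 / V * φ r p.1 + (vel p.2 / V * φ r p.1) ^ 2 / 2 +
          (M / V) ^ 3) := by
          refine mul_le_mul_of_nonneg_left ?_ (by positivity)
          linarith
      _ = _ := by
          rw [mul_pow, div_pow (vel p.2), hsq]
          field_simp
          ring

end RateLowerBound

/-! ### The liminf inequality -/

section LimitInequality

variable {α T : ℝ} {V : ℕ → ℝ} {R : ℕ → ℝ≥0∞} {C : ℝ≥0} {σ : ℕ → ℝ → ProbabilityMeasure Omega}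
  {j : ℕ → ℝ → SignedMeasure Omega} {ρ : ℝ → ProbabilityMeasure Torus}
  {ω J : SignedMeasure (Ioo (0 : ℝ) T × Torus)}

lemma abs_extendTime_le_norm (f : (Ioo (0 : ℝ) T × Torus) →ᵇ ℝ) (r : ℝ) (x : Torus) :
    |extendTime f r x| ≤ ‖f‖ :=
  abs_extendTime_le (norm_nonneg f) f.norm_coe_le_norm r x

lemma KacSequence.tendsto_integral_sq (h : KacSequence α T V R C σ j ρ ω J) (hα : 0 < α)
    (hT : 0 < T) (f : (Ioo (0 : ℝ) T × Torus) →ᵇ ℝ) :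
    Tendsto (fun n => ∫ r in Ioo 0 T, ∫ p, extendTime f r p.1 ^ 2 ∂(σ n r : Measure Omega)) atTop
      (𝓝 (∫ z, f z ^ 2 ∂(spaceTime T ρ))) := by
  have hρ := h.continuousOn hα hT
  have := isFiniteMeasure_spaceTime hT.le hρ
  have hb : ∀ z, |f z ^ 2| ≤ ‖f‖ ^ 2 := fun z => by
    rw [abs_pow]; exact pow_le_pow_left₀ (abs_nonneg _) (f.norm_coe_le_norm z) 2
  have e : ∫ z, f z ^ 2 ∂(spaceTime T ρ) =
      ∫ r in Ioo 0 T, ∫ x, extendTime f r x ^ 2 ∂(ρ r : Measure Torus) := by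
    rw [integral_spaceTime hT.le hρ
      (integrable_of_measurable_of_bound (f.continuous.measurable.pow_const 2) hb _),
      ← integral_timeMeasure]
    simp only [extendTime_coe]
  rw [e]
  refine h.tendsto_integral_density (F := fun r x => extendTime f r x ^ 2) (M := ‖f‖ ^ 2)
    ((measurable_extendTime f.continuous.measurable).pow_const 2) (fun r x => ?_) fun r =>
    (continuous_extendTime f.continuous r).pow 2
  rw [abs_pow]
  exact pow_le_pow_left₀ (abs_nonneg _) (abs_extendTime_le_norm f r x) 2

lemma KacSequence.signedIntegral_flux_sub_le (h : KacSequence α T V R C σ j ρ ω J) (hα : 0 < α)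
    (hT : 0 < T) (f : (Ioo (0 : ℝ) T × Torus) →ᵇ ℝ) :
    ∫ᵛ z, f z ∂<•ω - 1 / 2 * ∫ z, f z ^ 2 ∂(spaceTime T ρ) ≤ 2 * α * C :=
  le_of_tendsto' ((h.flux f).sub ((h.tendsto_integral_sq hα hT f).const_mul (1 / 2))) fun n =>
    (h.path n).integral_fluxTest_sub_le hα hT (h.bound n)
      (measurable_extendTime f.continuous.measurable) (abs_extendTime_le_norm f)
      (continuous_extendTime f.continuous)

lemma KacSequence.ofReal_le_liminf (h : KacSequence α T V R C σ j ρ ω J) (hα : 0 < α)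
    (hT : 0 < T) (f : (Ioo (0 : ℝ) T × Torus) →ᵇ ℝ) :
    ENNReal.ofReal (∫ᵛ z, f z ∂<•J - (1 / (2 * α) * ∫ᵛ z, f z ∂<•ω +
      1 / (4 * α) * ∫ z, f z ^ 2 ∂(spaceTime T ρ))) ≤ liminf R atTop := by
  have herr : Tendsto (fun n => ∫ _ in Ioo 0 T, ‖f‖ ^ 3 / (2 * α * V n)) atTop (𝓝 0) := by
    have h1 : Tendsto (fun n => ‖f‖ ^ 3 / (2 * α * V n)) atTop (𝓝 0) :=
      tendsto_const_nhds.div_atTop (h.tendsto_atTop.const_mul_atTop (by positivity))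
    have := h1.const_mul (volume.real (Ioo 0 T))
    rw [mul_zero] at this
    simpa using this
  have hlim := (h.derivedFlux f).sub ((((h.flux f).const_mul (1 / (2 * α))).add
    ((h.tendsto_integral_sq hα hT f).const_mul (1 / (4 * α)))).add herr)
  rw [add_zero] at hlim
  rw [← (ENNReal.tendsto_ofReal hlim).liminf_eq]
  refine liminf_le_liminf ?_
  filter_upwards [h.tendsto_atTop.eventually_ge_atTop ‖f‖] with n hn
  exact (h.path n).ofReal_le_rate hα (zero_lt_one.trans_le (h.one_le n))
    (measurable_extendTime f.continuous.measurable) (abs_extendTime_le_norm f)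
    (continuous_extendTime f.continuous) hn

theorem KacSequence.limitFunctional_le_liminf (h : KacSequence α T V R C σ j ρ ω J) (hα : 0 < α)
    (hT : 0 < T) : limitFunctional α T ρ ω ≤ liminf R atTop := by
  have := isFiniteMeasure_spaceTime hT.le (h.continuousOn hα hT)
  set ν := spaceTime T ρ with hν
  have hfin : liminf R atTop ≠ ⊤ := by
    refine ((liminf_le_liminf (Eventually.of_forall fun n => ?_)).trans_eq
      (liminf_const (C : ℝ≥0∞))).trans_lt ENNReal.coe_lt_top |>.ne
    exact le_add_self.trans (h.bound n)
  -- The duality bound for the rate sees only the combination `κ`, so the a priori flux estimate is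
  -- needed here.
  have hωac : ω ≪ᵥ ν.toENNRealVectorMeasure :=
    (absolutelyContinuous_and_lintegral_rnDeriv_sq_le ω ν one_pos
      (h.signedIntegral_flux_sub_le hα hT)).1
  set κ : SignedMeasure (Ioo (0 : ℝ) T × Torus) := J - (1 / (2 * α)) • ω with hκ
  -- The quadratic coefficient `1/(4α)` equals `c/2` for `c = 1/(2α)`.
  obtain ⟨hκac, hκ2⟩ := absolutelyContinuous_and_lintegral_rnDeriv_sq_le κ ν
    (c := 1 / (2 * α)) (C := (liminf R atTop).toReal) (by positivity) fun f => by
      rw [hκ, VectorMeasure.integral_sub_vectorMeasure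
        (integrable_of_measurable_of_bound f.continuous.measurable f.norm_coe_le_norm _)
        (integrable_of_measurable_of_bound f.continuous.measurable f.norm_coe_le_norm _),
        VectorMeasure.integral_smul_vectorMeasure, smul_eq_mul]
      refine (le_of_eq ?_).trans ((ENNReal.ofReal_le_iff_le_toReal hfin).1
        (h.ofReal_le_liminf hα hT f))
      rw [← hν]
      field_simp
      ring
  -- Absolute continuity of `κ` and `ω` passes to `Dρ = -2J` by this identity, which also yields `α
  -- Dρ + ω = -2α κ`.
  have hD : (-2 : ℝ) • J = (-2 : ℝ) • κ - (1 / α) • ω := by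
    rw [hκ, smul_sub, smul_smul, sub_sub, ← add_smul]
    rw [show -2 * (1 / (2 * α)) + 1 / α = 0 by field_simp; ring, zero_smul, sub_zero]
  have hJac : ((-2 : ℝ) • J) ≪ᵥ ν.toENNRealVectorMeasure := by
    rw [hD]
    exact hκac.smul.sub hωac.smul
  refine (iInf₂_le ((-2 : ℝ) • J) ⟨hωac, h.isSpaceDerivative hT, hJac,
    h.torusCE hα hT⟩).trans ?_
  have hrn : ∀ᵐ z ∂ν, α * ((-2 : ℝ) • J).rnDeriv ν z + ω.rnDeriv ν z =
      -(2 * α) * κ.rnDeriv ν z := by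
    filter_upwards [SignedMeasure.rnDeriv_sub ((-2 : ℝ) • κ) ((1 / α) • ω) ν,
      SignedMeasure.rnDeriv_smul κ ν (-2), SignedMeasure.rnDeriv_smul ω ν (1 / α)] with z h1 h2 h3
    rw [hD, h1, Pi.sub_apply, h2, h3, Pi.smul_apply, Pi.smul_apply, smul_eq_mul, smul_eq_mul]
    field_simp
    ring
  rw [← hν, lintegral_congr_ae (g := fun z => ENNReal.ofReal ((2 * α) ^ 2) *
    ENNReal.ofReal (|κ.rnDeriv ν z| ^ 2)) (hrn.mono fun z hz => by
      dsimp only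
      rw [hz, sq_abs, sq_abs, mul_pow, neg_sq, ENNReal.ofReal_mul (by positivity)]),
    lintegral_const_mul' _ _ ENNReal.ofReal_ne_top]
  -- The constants cancel exactly: `(1/4α) (2α)² · 2 · (1/2α) = 1`.
  calc _ ≤ ENNReal.ofReal (1 / (4 * α)) * (ENNReal.ofReal ((2 * α) ^ 2) *
        ENNReal.ofReal (2 * (1 / (2 * α)) * (liminf R atTop).toReal)) := by gcongr
    _ = liminf R atTop := by
        rw [← ENNReal.ofReal_mul (by positivity), ← ENNReal.ofReal_mul (by positivity),
          ← ENNReal.ofReal_toReal hfin]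
        congr 1
        rw [ENNReal.toReal_ofReal ENNReal.toReal_nonneg]
        field_simp
        ring

end LimitInequality

end KacDiffusive

namespace KacDiffusive

/-! ### Zeros of the limit functional -/

section HeatEquation

variable {α T : ℝ} {ρ : ℝ → ProbabilityMeasure Torus}
  {ω : SignedMeasure (Ioo (0 : ℝ) T × Torus)}

lemma integrableOn_integral_curve (hρ : ContinuousOn ρ (Icc 0 T)) {f : Torus → ℝ}
    (hf : Continuous f) : IntegrableOn (fun t => ∫ x, f x ∂(ρ t : Measure Torus)) (Ioo 0 T) := by
  refine (ContinuousOn.integrableOn_Icc fun t ht => ?_).mono_set Ioo_subset_Icc_self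
  exact ProbabilityMeasure.tendsto_iff_forall_integral_tendsto.1 (hρ t ht)
    (BoundedContinuousFunction.mkOfCompact ⟨f, hf⟩)

/-- The integral of a bounded function against a density is small if the density is small in
mean square. -/
lemma ofReal_abs_integral_mul_le {Z : Type*} [MeasurableSpace Z] (ν : Measure Z)
    {f a : Z → ℝ} {M η : ℝ} (hM : ∀ z, |f z| ≤ M) (hη : 0 < η) :
    ENNReal.ofReal |∫ z, f z * a z ∂ν| ≤ ENNReal.ofReal (η * M ^ 2) * ν univ +
      ENNReal.ofReal (1 / (4 * η)) * ∫⁻ z, ENNReal.ofReal (|a z| ^ 2) ∂ν := by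
  rw [← Real.enorm_eq_ofReal_abs, ← lintegral_const, ← lintegral_const_mul' _ _
    ENNReal.ofReal_ne_top, ← lintegral_add_left measurable_const]
  refine (enorm_integral_le_lintegral_enorm _).trans (lintegral_mono fun z => ?_)
  dsimp only
  rw [Real.enorm_eq_ofReal_abs, ← ENNReal.ofReal_mul (by positivity),
    ← ENNReal.ofReal_add (by positivity) (by positivity)]
  refine ENNReal.ofReal_le_ofReal ?_
  rw [abs_mul]
  have h1 : |f z| * |a z| ≤ M * |a z| := mul_le_mul_of_nonneg_right (hM z) (abs_nonneg _)
  have h2 : η * M ^ 2 + 1 / (4 * η) * |a z| ^ 2 - M * |a z| =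
      1 / (4 * η) * (2 * η * M - |a z|) ^ 2 := by
    field_simp
    ring
  have h3 : 0 ≤ 1 / (4 * η) * (2 * η * M - |a z|) ^ 2 := by positivity
  linarith

lemma torusCE_of_limitFunctional_eq_zero (h : limitFunctional α T ρ ω = 0) : TorusCE T ρ ω := by
  have : limitFunctional α T ρ ω < 1 := h ▸ one_pos
  simp only [limitFunctional, iInf_lt_iff] at this
  obtain ⟨D, hD, -⟩ := this
  exact hD.2.2.2

/-- If the limit functional vanishes, then the flux is given by Fick's law `ω = -α Dρ`. -/
lemma signedIntegral_flux_eq_of_limitFunctional_eq_zero (hα : 0 < α) (hT : 0 < T)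
    (h : limitFunctional α T ρ ω = 0) {χ : ℝ → ℝ} (hχ : ContDiff ℝ 1 χ)
    (hχs : HasCompactSupport χ) (hχt : tsupport χ ⊆ Ioo 0 T) {ψ ψ' : Torus → ℝ}
    (hψ : IsC1 ψ ψ') :
    ∫ᵛ z, χ z.1 * ψ z.2 ∂<•ω =
      α * ∫ r in Ioo 0 T, χ r * ∫ x, ψ' x ∂(ρ r : Measure Torus) := by
  have hρ := (torusCE_of_limitFunctional_eq_zero h).continuousOn
  have := isFiniteMeasure_spaceTime hT.le hρ
  set ν := spaceTime T ρ with hν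
  obtain ⟨A, hA⟩ := hχs.exists_bound_of_continuous hχ.continuous
  obtain ⟨f, hf⟩ := exists_prodTest (T := T) hχ.continuous hA hψ.continuous
  set x := ∫ᵛ z, χ z.1 * ψ z.2 ∂<•ω -
    α * ∫ r in Ioo 0 T, χ r * ∫ x, ψ' x ∂(ρ r : Measure Torus) with hx
  -- The functional is an infimum over candidate derivatives, so each `η` only supplies some `D` of
  -- cost below `η²`. The quantity `x` does not involve `D`, so the candidates may vary with `η` and
  -- their uniqueness is not needed.
  have key : ∀ η : ℝ, 0 < η → |x| ≤ η * (‖f‖ ^ 2 * ν.real univ + α) := by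
    intro η hη
    have hlt : limitFunctional α T ρ ω < ENNReal.ofReal (η ^ 2) := by
      rw [h]; exact ENNReal.ofReal_pos.2 (by positivity)
    simp only [limitFunctional, iInf_lt_iff] at hlt
    obtain ⟨D, ⟨hωac, hD, hDac, -⟩, hlt⟩ := hlt
    rw [← hν] at hωac hDac hlt
    have hint : ∀ {m : SignedMeasure (Ioo (0 : ℝ) T × Torus)},
        m ≪ᵥ ν.toENNRealVectorMeasure → ∫ᵛ z, f z ∂<•m = ∫ z, f z * m.rnDeriv ν z ∂ν := by
      intro m hm
      conv_lhs => rw [← SignedMeasure.withDensityᵥ_rnDeriv_eq m ν hm]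
      exact signedIntegral_withDensity ν f.continuous.measurable f.norm_coe_le_norm
        (SignedMeasure.measurable_rnDeriv m ν) (SignedMeasure.integrable_rnDeriv m ν)
    have hfi : ∀ m : SignedMeasure (Ioo (0 : ℝ) T × Torus),
        Integrable (fun z => f z * m.rnDeriv ν z) ν := fun m =>
      (SignedMeasure.integrable_rnDeriv m ν).bdd_mul f.continuous.measurable.aestronglyMeasurable
        (ae_of_all _ f.norm_coe_le_norm)
    have hxe : x = ∫ z, f z * (α * D.rnDeriv ν z + ω.rnDeriv ν z) ∂ν := by
      have e1 := hD χ hχ hχs hχt ψ ψ' hψ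
      rw [intervalIntegral.integral_of_le hT.le, integral_Ioc_eq_integral_Ioo] at e1
      rw [hx, e1]
      simp only [← hf]
      rw [hint hωac, hint hDac, mul_neg, sub_neg_eq_add, ← integral_const_mul,
        ← integral_add (hfi ω) ((hfi D).const_mul α)]
      congr 1; ext z; ring
    have hb := ofReal_abs_integral_mul_le ν (a := fun z => α * D.rnDeriv ν z + ω.rnDeriv ν z)
      f.norm_coe_le_norm hη
    rw [← hxe] at hb
    have hsmall : ENNReal.ofReal (1 / (4 * η)) *
        ∫⁻ z, ENNReal.ofReal (|α * D.rnDeriv ν z + ω.rnDeriv ν z| ^ 2) ∂ν ≤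
        ENNReal.ofReal (η * α) := by
      have e1 : ENNReal.ofReal (1 / (4 * η)) = ENNReal.ofReal (α / η) *
          ENNReal.ofReal (1 / (4 * α)) := by
        rw [← ENNReal.ofReal_mul (by positivity)]
        congr 1
        field_simp
      -- The factor `α/η` against the cost `η²` leaves `ηα`, of the same order in `η` as the other
      -- term of the bound.
      rw [e1, mul_assoc]
      refine (mul_le_mul_right hlt.le _).trans_eq ?_
      rw [← ENNReal.ofReal_mul (by positivity)]
      congr 1
      field_simp
    have hb' := hb.trans (add_le_add_right hsmall _)
    rw [← ofReal_measureReal, ← ENNReal.ofReal_mul (by positivity),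
      ← ENNReal.ofReal_add (by positivity) (by positivity),
      ENNReal.ofReal_le_ofReal_iff (by positivity)] at hb'
    linarith
  have hx0 : |x| ≤ 0 := by
    have hlim : Tendsto (fun η : ℝ => η * (‖f‖ ^ 2 * ν.real univ + α)) (𝓝[>] 0) (𝓝 0) := by
      have : Continuous fun η : ℝ => η * (‖f‖ ^ 2 * ν.real univ + α) := by fun_prop
      have := this.tendsto 0
      rw [zero_mul] at this
      exact this.mono_left nhdsWithin_le_nhds
    refine ge_of_tendsto hlim ?_
    filter_upwards [self_mem_nhdsWithin] with η hη
    exact key η hη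
  exact sub_eq_zero.1 (abs_nonpos_iff.1 hx0)

/-- The continuity equation tested with `ψ` puts `ψ'` against the flux, and Fick's law then
differentiates once more. Fick's law is available only for smooth time cutoffs, so these are let
increase to the indicator of `(s, t)`. -/
theorem isWeakHeatSolution_of_limitFunctional_eq_zero (hα : 0 < α) (hT : 0 < T)
    (h : limitFunctional α T ρ ω = 0) : IsWeakHeatSolution α T ρ := by
  have hCE := torusCE_of_limitFunctional_eq_zero h
  refine ⟨hCE.continuousOn, fun ψ ψ' ψ'' hψ hψ' s t hs hst ht => ?_⟩
  rcases hst.eq_or_lt with rfl | hlt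
  · simp
  obtain ⟨χ, hχd, hχs, hχt, hχ01, hχ⟩ := exists_cutoff hlt
  rw [hCE.weak_eq ψ ψ' hψ s t hs hst ht, intervalIntegral.integral_of_le hst,
    integral_Ioc_eq_integral_Ioo]
  refine tendsto_nhds_unique (tendsto_signedIntegral_cutoff ω (fun m => (hχd m).continuous)
    hχ01 hχ hψ.1) (((tendsto_integral_cutoff hs ht (fun m => (hχd m).continuous) hχ01 hχ
    (integrableOn_integral_curve hCE.continuousOn hψ'.1)).const_mul α).congr fun m => ?_)
  exact (signedIntegral_flux_eq_of_limitFunctional_eq_zero hα hT h (hχd m) (hχs m)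
    ((hχt m).trans (Ioo_subset_Ioo hs ht)) hψ').symm

end HeatEquation

end KacDiffusive

open KacDiffusive in
theorem theorem4p7 {α T : ℝ} (hα : 0 < α) (hT : 0 < T) :
    (∀ (V : ℕ → ℝ) (σ : ℕ → ℝ → ProbabilityMeasure Omega)
      (j : ℕ → ℝ → SignedMeasure Omega × SignedMeasure Omega) (C : ℝ≥0)
      (ρbar : ℝ → ProbabilityMeasure Torus)
      (ωbar Jbar : SignedMeasure (Set.Ioo (0 : ℝ) T × Torus)),
      (∀ n, 1 ≤ V n) → Tendsto V atTop atTop →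
      (∀ n, KacCE T (σ n) (j n)) →
      (∀ n, InformationTheory.klDiv (σ n 0 : Measure Omega) stationary
        + rateV α T (V n) (σ n) (j n) ≤ C) →
      (∀ t ∈ Set.Icc 0 T, Tendsto (fun n => density (σ n t)) atTop (𝓝 (ρbar t))) →
      TendstoNarrowly T (fun n t => flux (V n) (σ n t)) ωbar →
      TendstoNarrowly T (fun n t => derivedFlux (V n) (j n t)) Jbar →
      limitFunctional α T ρbar ωbar ≤
        liminf (fun n => rateV α T (V n) (σ n) (j n)) atTop) ∧
    (∀ (ρ : ℝ → ProbabilityMeasure Torus) (ω : SignedMeasure (Set.Ioo (0 : ℝ) T × Torus)),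
      limitFunctional α T ρ ω = 0 → IsWeakHeatSolution α T ρ) := by
  refine ⟨fun V σ j C ρ ω J hV hVt hCE hC hρ hω hJ => ?_, fun ρ ω h =>
    isWeakHeatSolution_of_limitFunctional_eq_zero hα hT h⟩
  obtain ⟨σ', j', h⟩ := exists_kacSequence hT hV hVt hCE hC hρ hω hJ
  exact h.limitFunctional_le_liminf hα hT
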